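/- Let $E=(E^0,E^1,r,s)$ be a countable directed graph that is locally finite (each vertex emits and receives only finitely many edges) and has no sources (each vertex receives an edge). Paths are strings $e_1e_2\cdots$ of edges with $s(e_i)=r(e_{i+1})$; $E^n$ is the set of paths of length $n$, $E^*=\bigcup_n E^n$, $\mu(m,n)=\mu_{m+1}\cdots\mu_n$ (a vertex if $m=n$), and $E^{\mathrm{op}}$ is $E$ with $r$ and $s$ exchanged. *Quivers.* The suspension $\mathcal SE$ has vertex space $\mathcal SE^0=\big((E^1\times[0,1])\sqcup E^0\big)/{\sim}$, with $(f,0)\sim r(f)$ and $(e,1)\sim s(e)$, and edge space $\mathcal SE^1=\big((E^2\times[0,1])\sqcup E^1\big)/{\sim}$, with $(ef,0)\sim e$ and $(ef,1)\sim f$; $r[ef,t]=[e,t]$, $s[ef,t]=[f,t]$. (The same formulas define $\mathcal S E^{\mathrm{op}}$, also if $E$ has sinks.) For $l\in\mathbb R$ the quiver $\mathcal S_lE$ has as edge space the quotient of $\{(\mu,t):\mu\in E^*,\ t,t+l\in[0,|\mu|]\}$ by the relation $(\mu,s)\approx_l(\nu,t)$ iff $s-\lfloor s\rfloor=t-\lfloor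 t\rfloor$ and $\mu(\lfloor s\rfloor,\lceil s+l\rceil)=\nu(\lfloor t\rfloor,\lceil t+l\rceil)$ (if $l\ge0$), respectively $\mu(\lfloor s+l\rfloor,\lceil s\rceil)=\nu(\lfloor t+l\rfloor,\lceil t\rceil)$ (if $l\le0$). Its vertex space is the quotient of $\{(\mu,t):t\in[0,|\mu|]\}$ by the same relation with $l=0$ (homeomorphic to $\mathcal SE^0$ by $[e,t]\mapsto[e,t]$), and $r[\mu,t]_l=[\mu,t]$, $s[\mu,t]_l=[\mu,t+l]$. All spaces carry the quotient topologies, sets of paths being discrete. *Algebras.* For each of these quivers $G=(G^0,G^1,r,s)$ let $G^*$ be the set of its finite paths (vertices included) and, on $\ell^2(G^*)$, let $\rho(a)h_\alpha=a(r(\alpha))h_\alpha$ for $a\in C_0(G^0)$ and $\psi(\xi)h_\alpha=\sum_{\beta\in G^1,\,s(\beta)=r(\alpha)}\xi(\beta)h_{\beta\alpha}$ for $\xi\in C_c(G^1)$. Let $\mathcal TC^*(G)$ be the $C^*$-subalgebra of $\mathcal B(\ell^2(G^*))$ generated by all $\rho(a)$ and $\psi(\xi)$, and let $C^*(G)$ be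 its image in $\prod_{\omega\in G^0}\mathcal Q(\ell^2(G^*\omega))$ under restriction to the invariant subspaces $\ell^2(G^*\omega)$, $G^*\omega=\{\alpha:s(\alpha)=\omega\}$, followed by the maps to the Calkin algebras $\mathcal Q=\mathcal B/\mathcal K$. Let $C^*_{\mathbb S}(G)$ be the analogous image in $\prod_{t\in\mathbb R/\mathbb Z}\mathcal Q(\ell^2(G^*_t))$, where $G^*_t$ is the set of paths whose source is of the form $[\mu,t']$ with $t'+\mathbb Z=t$. **Theorem.** For $G=\mathcal SE,\ \mathcal SE^{\mathrm{op}},\ \mathcal S_lE$ $(l=1,0,-1)$ all $\rho(a),\psi(\xi)$ are well-defined bounded operators, written $\rho_l(a),\psi_l(\xi)$ for $\mathcal S_lE$, and the following hold. 1. There are homeomorphisms $\theta$ of the vertex space and the edge space of $\mathcal S_1E$ onto those of $\mathcal SE$, compatible with $r$ and $s$, with $\theta[e,t]=[e,t]$ and $\theta[ef,t]_1=[ef,t]$ for $t\in[0,1]$, and an isomorphism $\mathcal TC^*(\mathcal S_1E)\cong\mathcal TC^*(\mathcal SE)$ that carries $\rho_1(a\circ\theta)$ to $\rho(a)$ and $\psi_1(\xi\circ\theta)$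 to $\psi(\xi)$. It descends to isomorphisms $C^*(\mathcal S_1E)\cong C^*(\mathcal SE)$ and $C^*_{\mathbb S}(\mathcal S_1E)\cong C^*_{\mathbb S}(\mathcal SE)$ and, if $E^0$ is finite, also to $C^*(\mathcal S_1E)\cong C^*_{\mathbb S}(\mathcal SE)$. 2. The range map $r_0$ of $\mathcal S_0E$ is a homeomorphism onto the vertex space $X$ of $\mathcal S_0E$ (which is homeomorphic to $\mathcal SE^0$). Let $\mathcal T$ be the classical Toeplitz algebra, the $C^*$-algebra generated by the unilateral shift $S$ on $\ell^2(\mathbb N)$. There is an isomorphism $\mathcal TC^*(\mathcal S_0E)\cong C_0(X)\otimes\mathcal T$ that carries $\rho_0(a)$ to $a\otimes1$ and $\psi_0(\xi)$ to $(\xi\circ r_0^{-1})\otimes S$. It descends to an isomorphism $C^*(\mathcal S_0E)\cong C_0(X)\otimes C(\mathbb T)$, the quotient map corresponding to $\mathrm{id}\otimes\tau$ for the symbol map $\tau:\mathcal T\to C(\mathbb T)$, the unital $*$-homomorphism with $\tau(S)=(z\mapsto z)$. 3. There are homeomorphisms $\theta$ of the vertex space and the edge space of $\mathcal S_{-1}E$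 onto those of $\mathcal SE^{\mathrm{op}}$, compatible with $r$ and $s$, with $\theta[e,t]=[e^{\mathrm{op}},1-t]$ and $\theta[ef,1+t]_{-1}=[f^{\mathrm{op}}e^{\mathrm{op}},1-t]$ for $t\in[0,1]$, and an isomorphism $\mathcal TC^*(\mathcal S_{-1}E)\cong\mathcal TC^*(\mathcal SE^{\mathrm{op}})$ that carries $\rho_{-1}(a\circ\theta)$ to $\rho(a)$ and $\psi_{-1}(\xi\circ\theta)$ to $\psi(\xi)$. It descends to isomorphisms $C^*(\mathcal S_{-1}E)\cong C^*(\mathcal SE^{\mathrm{op}})$ and $C^*_{\mathbb S}(\mathcal S_{-1}E)\cong C^*_{\mathbb S}(\mathcal SE^{\mathrm{op}})$ and, if $E^0$ is finite, also to $C^*(\mathcal S_{-1}E)\cong C^*_{\mathbb S}(\mathcal SE^{\mathrm{op}})$. -/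

import Mathlib

open scoped ZeroAtInfty CompactlySupported

universe u v w

noncomputable section

/-! ## Directed graphs and their finite paths -/

/-- A directed graph `(E⁰, E¹, r, s)`. -/
structure DirGraph where
  V : Type u
  Edge : Type u
  r : Edge → V
  s : Edge → V

namespace DirGraph

/-- The opposite graph. -/
def op (E : DirGraph.{u}) : DirGraph.{u} where
  V := E.V
  Edge := E.Edge
  r := E.s
  s := E.r

/-- Each vertex emits and receives only finitely many edges. -/
def LocallyFinite (E : DirGraph.{u}) : Prop :=
  ∀ v : E.V, {e : E.Edge | E.s e = v}.Finite ∧ {e : E.Edge | E.r e = v}.Finite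

/-- Each vertex receives an edge. -/
def NoSources (E : DirGraph.{u}) : Prop :=
  ∀ v : E.V, ∃ e : E.Edge, E.r e = v

/-- The range of the string of edges `l` followed by the vertex `v`. -/
def rangeOf (E : DirGraph.{u}) : List E.Edge → E.V → E.V
  | [], v => v
  | e :: _, _ => E.r e

/-- The string of edges `l = e₁ e₂ ⋯ eₙ` is composable (`s eᵢ = r eᵢ₊₁`) with source `v`. -/
def IsPath (E : DirGraph.{u}) : List E.Edge → E.V → Prop
  | [], _ => True
  | e :: l, v => E.s e = E.rangeOf l v ∧ E.IsPath l v

/-- A finite path: a composable string of edges together with its source;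
vertices are the paths without edges. -/
structure Path (E : DirGraph.{u}) where
  edges : List E.Edge
  source : E.V
  isPath : E.IsPath edges source

variable {E : DirGraph.{u}}

/-- The length of a path. -/
def Path.length (μ : E.Path) : ℕ := μ.edges.length

/-- The range of a path. -/
def Path.range (μ : E.Path) : E.V := E.rangeOf μ.edges μ.source

/-- The path `βα`, for an edge `β` with `s(β) = r(α)`. -/
def Path.cons (β : E.Edge) (α : E.Path) (h : E.s β = α.range) : E.Path where
  edges := β :: α.edges
  source := α.source
  isPath := ⟨h, α.isPath⟩

/-- An edge `e` as a path of length one. -/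
def Path.single (e : E.Edge) : E.Path where
  edges := [e]
  source := E.s e
  isPath := ⟨rfl, trivial⟩

/-- The path `ef` of length two. -/
def Path.pair (e f : E.Edge) (h : E.s e = E.r f) : E.Path where
  edges := [e, f]
  source := E.s f
  isPath := ⟨h, rfl, trivial⟩

/-- The vertex reached after the first `k` edges of `μ`, that is, `r(μ_{k+1})` if `k < |μ|`
and `s(μ)` if `k = |μ|`. -/
def Path.vertexAt (μ : E.Path) (k : ℕ) : E.V := E.rangeOf (μ.edges.drop k) μ.source

/-- The segment `μ(m, n) = μ_{m+1} ⋯ μ_n` of `μ` for `m ≤ n ≤ |μ|` (the vertex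
`r(μ_{m+1})` if `m = n`), recorded as its string of edges and its source. -/
def Path.seg (μ : E.Path) (m n : ℕ) : List E.Edge × E.V :=
  ((μ.edges.drop m).take (n - m), μ.vertexAt n)

end DirGraph

/-! ## Operators on `ℓ²(X)` and the Calkin algebra -/

/-- The Hilbert space `ℓ²(X)` of a set `X`. -/
abbrev EllTwo (X : Type w) : Type w := lp (fun _ : X => ℂ) 2

open Classical in
/-- The canonical basis vector `h_x` of `ℓ²(X)`. -/
def basisVec {X : Type w} (x : X) : EllTwo X := lp.single 2 x (1 : ℂ)

/-- The algebra `B(H)` of bounded operators. -/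
abbrev BddOp (H : Type w) [NormedAddCommGroup H] [InnerProductSpace ℂ H] : Type w := H →L[ℂ] H

theorem orthonormal_basisVec (X : Type w) :
    Orthonormal ℂ (basisVec : X → EllTwo X) := by
  classical
  rw [orthonormal_iff_ite]
  intro i j
  unfold basisVec
  rw [lp.inner_single_left, lp.single_apply]
  by_cases h : i = j
  · subst h; simp
  · simp [h]

theorem EllTwo.op_ext {X : Type w} {H : Type v} [NormedAddCommGroup H] [NormedSpace ℂ H]
    {S T : EllTwo X →L[ℂ] H} (h : ∀ x, S (basisVec x) = T (basisVec x)) : S = T := by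
  classical
  refine lp.ext_continuousLinearMap (by simp) fun x => ?_
  ext
  simpa [basisVec] using h x

/-- For injective `f : X → Y`, the isometry `ℓ²(X) → ℓ²(Y)`, `h_x ↦ h_{f x}`. -/
def pushIsometry {X : Type v} {Y : Type w} (f : X → Y) (hf : Function.Injective f) :
    EllTwo X →ₗᵢ[ℂ] EllTwo Y :=
  ((orthonormal_basisVec Y).comp f hf).orthogonalFamily.linearIsometry

theorem pushIsometry_basisVec {X : Type v} {Y : Type w} (f : X → Y)
    (hf : Function.Injective f) (x : X) :
    pushIsometry f hf (basisVec x) = basisVec (f x) := by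
  classical
  unfold pushIsometry
  rw [basisVec]
  erw [OrthogonalFamily.linearIsometry_apply_single]
  simp

/-- The isometric inclusion `ℓ²(A) → ℓ²(X)` for `A ⊆ X`. -/
def inclOp {X : Type w} (A : Set X) : EllTwo A →L[ℂ] EllTwo X :=
  (pushIsometry (Subtype.val : A → X) Subtype.val_injective).toContinuousLinearMap

/-- The part `T|_{ℓ²(A)}` of `T ∈ B(ℓ²(X))`, for `A ⊆ X`: it is the restriction of `T` if
`ℓ²(A)` is invariant under `T`, and the compression of `T` to `ℓ²(A)` in general. -/
def restrictOp {X : Type w} (A : Set X) (T : BddOp (EllTwo X)) : BddOp (EllTwo A) :=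
  ContinuousLinearMap.adjoint (inclOp A) ∘L T ∘L inclOp A

/-- The orthogonal projection of `ℓ²(X)` onto `ℓ²(A)`. -/
def projOp {X : Type w} (A : Set X) : BddOp (EllTwo X) :=
  inclOp A ∘L ContinuousLinearMap.adjoint (inclOp A)

section Calkin

variable (H : Type w) [NormedAddCommGroup H] [InnerProductSpace ℂ H] [CompleteSpace H]

/-- The ideal `K(H)` of compact operators in `B(H)`. -/
def compactIdeal : Ideal (BddOp H) where
  carrier := {T | IsCompactOperator T}
  add_mem' := fun ha hb => ha.add hb
  zero_mem' := isCompactOperator_zero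
  smul_mem' := fun c _ hT => hT.clm_comp c

instance : (compactIdeal H).IsTwoSided where
  mul_mem_of_left := fun {_} b ha => IsCompactOperator.comp_clm ha b

variable {H}

theorem isCompactOperator_adjoint {T : BddOp H} (hT : IsCompactOperator T) :
    IsCompactOperator (ContinuousLinearMap.adjoint T) := by
  set S : BddOp H := ContinuousLinearMap.adjoint T with hS
  have hTS : IsCompactOperator (T ∘L S) := hT.comp_clm S
  have hc := (isCompactOperator_iff_isCompact_closure_image_closedBall (𝕜₁ := ℂ)
    ((T ∘L S : BddOp H) : H →ₗ[ℂ] H) zero_lt_one).1 hTS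
  refine (isCompactOperator_iff_isCompact_closure_image_closedBall (𝕜₁ := ℂ)
    (S : H →ₗ[ℂ] H) zero_lt_one).2 ?_
  refine (TotallyBounded.closure ?_).isCompact_of_isClosed isClosed_closure
  have htb : TotallyBounded ((fun x => T (S x)) '' Metric.closedBall (0 : H) 1) :=
    hc.totallyBounded.subset subset_closure
  rw [Metric.totallyBounded_iff] at htb
  refine Metric.totallyBounded_of_finite_discretization fun ε hε => ?_
  obtain ⟨t, htf, ht⟩ := htb (ε ^ 2 / 4) (by positivity)
  have hch : ∀ z : (S '' Metric.closedBall (0 : H) 1 : Set H), ∃ x : H, ‖x‖ ≤ 1 ∧ S x = z ∧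
      ∃ y : t, ‖T (S x) - y‖ < ε ^ 2 / 4 := by
    rintro ⟨_, x, hx, rfl⟩
    obtain ⟨y, hy, hxy⟩ := Set.mem_iUnion₂.1 (ht ⟨x, hx, rfl⟩)
    exact ⟨x, by simpa using hx, rfl, ⟨y, hy⟩, by simpa [dist_eq_norm] using hxy⟩
  choose x hx1 hx2 F hF using hch
  refine ⟨t, htf.fintype, F, fun z z' hzz => ?_⟩
  rw [dist_eq_norm, ← hx2 z, ← hx2 z', ← map_sub]
  have h1 : ‖T (S (x z)) - T (S (x z'))‖ < ε ^ 2 / 2 := by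
    have := norm_sub_le_norm_sub_add_norm_sub (T (S (x z))) (F z : H) (T (S (x z')))
    have h2 := hF z
    have h3 := hF z'
    rw [← hzz, norm_sub_rev] at h3
    linarith
  have h2 : ‖x z - x z'‖ ≤ 2 := by
    have := norm_sub_le (x z) (x z')
    linarith [hx1 z, hx1 z']
  have h3 : ‖S (x z - x z')‖ ^ 2 ≤ ‖T (S (x z - x z'))‖ * ‖x z - x z'‖ := by
    have h : inner ℂ (S (x z - x z')) (S (x z - x z')) =
        inner ℂ (x z - x z') (T (S (x z - x z'))) := by
      rw [hS, ContinuousLinearMap.adjoint_inner_left]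
    have h' := norm_inner_le_norm (𝕜 := ℂ) (x z - x z') (T (S (x z - x z')))
    rw [← h, inner_self_eq_norm_sq_to_K] at h'
    simpa [mul_comm] using h'
  have h4 : ‖S (x z - x z')‖ ^ 2 < ε ^ 2 := by
    have : T (S (x z - x z')) = T (S (x z)) - T (S (x z')) := by simp
    rw [this] at h3
    nlinarith [norm_nonneg (T (S (x z)) - T (S (x z')))]
  exact lt_of_pow_lt_pow_left₀ 2 hε.le h4

theorem star_mem_compactIdeal {T : BddOp H} (hT : T ∈ compactIdeal H) :
    star T ∈ compactIdeal H := isCompactOperator_adjoint hT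

variable (H) in
/-- The Calkin algebra `Q(H) = B(H) / K(H)`. -/
def Calkin : Type w := BddOp H ⧸ compactIdeal H

instance : Ring (Calkin H) := inferInstanceAs (Ring (BddOp H ⧸ compactIdeal H))

instance : Algebra ℂ (Calkin H) := inferInstanceAs (Algebra ℂ (BddOp H ⧸ compactIdeal H))

/-- The involution of the Calkin algebra: `(T + K(H))* = T* + K(H)`. -/
instance : StarRing (Calkin H) where
  star := Quotient.map' star (fun a b h => by
    rw [Submodule.quotientRel_def] at h ⊢
    rw [← star_sub]
    exact star_mem_compactIdeal h)
  star_involutive := by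
    rintro ⟨a⟩
    exact congrArg (Ideal.Quotient.mk (compactIdeal H)) (star_star a)
  star_mul := by
    rintro ⟨a⟩ ⟨b⟩
    exact congrArg (Ideal.Quotient.mk (compactIdeal H)) (star_mul a b)
  star_add := by
    rintro ⟨a⟩ ⟨b⟩
    exact congrArg (Ideal.Quotient.mk (compactIdeal H)) (star_add a b)

/-- The quotient map `B(H) → Q(H)`. -/
def toCalkin : BddOp H →⋆ₐ[ℂ] Calkin H where
  toFun := Ideal.Quotient.mk (compactIdeal H)
  map_one' := rfl
  map_mul' _ _ := rfl
  map_zero' := rfl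
  map_add' _ _ := rfl
  commutes' _ := rfl
  map_star' _ := rfl

theorem toCalkin_eq_zero_iff (T : BddOp H) : toCalkin T = 0 ↔ IsCompactOperator T :=
  Ideal.Quotient.eq_zero_iff_mem

end Calkin

theorem projOp_basisVec {X : Type w} (A : Set X) (x : X) [Decidable (x ∈ A)] :
    projOp A (basisVec x) = if x ∈ A then basisVec x else 0 := by
  have hin : ∀ y : A, inclOp A (basisVec y) = basisVec (y : X) :=
    fun y => pushIsometry_basisVec _ Subtype.val_injective y
  have hid : ContinuousLinearMap.adjoint (inclOp A) ∘L inclOp A =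
      ContinuousLinearMap.id ℂ (EllTwo A) := by
    refine ContinuousLinearMap.ext fun f => ext_inner_right ℂ fun g => ?_
    simp only [ContinuousLinearMap.comp_apply, ContinuousLinearMap.adjoint_inner_left,
      ContinuousLinearMap.id_apply]
    exact (pushIsometry (Subtype.val : A → X) Subtype.val_injective).inner_map_map f g
  split_ifs with h
  · rw [← hin ⟨x, h⟩]
    change inclOp A ((ContinuousLinearMap.adjoint (inclOp A) ∘L inclOp A) _) = _
    rw [hid]; rfl
  · have h0 : ContinuousLinearMap.adjoint (inclOp A) (basisVec x) = 0 := by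
      refine ext_inner_right ℂ fun g => ?_
      rw [ContinuousLinearMap.adjoint_inner_left, inner_zero_left]
      have : (innerSL ℂ (basisVec x)) ∘L inclOp A = 0 := by
        refine EllTwo.op_ext fun y => ?_
        have hne : x ≠ y := fun hxy => h (hxy ▸ y.2)
        simpa [hin] using (orthonormal_basisVec X).2 hne
      exact congrArg (fun T => T g) this
    exact (congrArg (inclOp A) h0).trans (map_zero _)

theorem star_projOp {X : Type w} (A : Set X) : star (projOp A) = projOp A := by
  rw [ContinuousLinearMap.star_eq_adjoint, projOp, ContinuousLinearMap.adjoint_comp,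
    ContinuousLinearMap.adjoint_adjoint]

theorem restrictOp_mul {X : Type w} (A : Set X) (S T : BddOp (EllTwo X))
    (hT : projOp A * T = T * projOp A) :
    restrictOp A (S * T) = restrictOp A S * restrictOp A T := by
  have hid : ContinuousLinearMap.adjoint (inclOp A) ∘L inclOp A =
      ContinuousLinearMap.id ℂ (EllTwo A) := by
    refine ContinuousLinearMap.ext fun f => ext_inner_right ℂ fun g => ?_
    simp only [ContinuousLinearMap.comp_apply, ContinuousLinearMap.adjoint_inner_left,
      ContinuousLinearMap.id_apply]
    exact (pushIsometry (Subtype.val : A → X) Subtype.val_injective).inner_map_map f g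
  refine ContinuousLinearMap.ext fun f => ?_
  have h1 := congrArg (fun R : BddOp (EllTwo X) => R (inclOp A f)) hT
  have h2 := congrArg (fun R : BddOp (EllTwo A) => R f) hid
  simp only [projOp, ContinuousLinearMap.mul_def, ContinuousLinearMap.comp_apply,
    ContinuousLinearMap.id_apply] at h1 h2
  rw [h2] at h1
  simp only [restrictOp, ContinuousLinearMap.mul_def, ContinuousLinearMap.comp_apply]
  rw [h1]

/-- The closed `*`-subalgebra generated by `S`. -/
abbrev cstarGen {A : Type w} [NonUnitalNormedRing A] [StarRing A] [NormedSpace ℂ A]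
    [IsScalarTower ℂ A A] [SMulCommClass ℂ A A] [StarModule ℂ A] [NormedStarGroup A] (S : Set A) :
    NonUnitalStarSubalgebra ℂ A :=
  (NonUnitalStarAlgebra.adjoin ℂ S).topologicalClosure

/-! ## Topological quivers and their algebras -/

/-- A quiver whose vertex and edge spaces are topological spaces. -/
structure TopQuiver extends DirGraph.{u} where
  [topV : TopologicalSpace V]
  [topEdge : TopologicalSpace Edge]

namespace TopQuiver

instance (G : TopQuiver.{u}) : TopologicalSpace G.V := G.topV
instance (G : TopQuiver.{u}) : TopologicalSpace G.Edge := G.topEdge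

/-- An isomorphism of quivers that is a homeomorphism on vertices and on edges. -/
structure Iso (G H : TopQuiver.{u}) where
  onV : G.V ≃ₜ H.V
  onEdge : G.Edge ≃ₜ H.Edge
  r_comm : ∀ x, onV (G.r x) = H.r (onEdge x)
  s_comm : ∀ x, onV (G.s x) = H.s (onEdge x)

/-- The map `a ↦ a ∘ θ`, `C₀(H⁰) → C₀(G⁰)`. -/
def Iso.pullV {G H : TopQuiver.{u}} (θ : Iso G H) (a : C₀(H.V, ℂ)) : C₀(G.V, ℂ) :=
  a.comp θ.onV.toCocompactMap

/-- The map `ξ ↦ ξ ∘ θ`, `C_c(H¹) → C_c(G¹)`. -/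
def Iso.pullEdge {G H : TopQuiver.{u}} (θ : Iso G H) (ξ : C_c(H.Edge, ℂ)) : C_c(G.Edge, ℂ) where
  toFun := ξ ∘ θ.onEdge
  continuous_toFun := ξ.continuous.comp θ.onEdge.continuous
  hasCompactSupport' := ξ.hasCompactSupport.comp_homeomorph θ.onEdge

variable (G : TopQuiver.{u})

/-- The Hilbert space `ℓ²(G*)` with basis indexed by the finite paths of `G`. -/
abbrev Hilb : Type u := EllTwo G.toDirGraph.Path

/-- `T h_α = a(r(α)) h_α` for every path `α`. -/
def IsRho (a : C₀(G.V, ℂ)) (T : BddOp G.Hilb) : Prop :=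
  ∀ α : G.toDirGraph.Path, T (basisVec α) = a α.range • basisVec α

/-- `T h_α = ∑_{β ∈ G¹ r(α)} ξ(β) h_{βα}` for every path `α`. -/
def IsPsi (ξ : C_c(G.Edge, ℂ)) (T : BddOp G.Hilb) : Prop :=
  ∀ α : G.toDirGraph.Path,
    HasSum (fun β : {β : G.Edge // G.s β = α.range} =>
      ξ β.1 • basisVec (DirGraph.Path.cons β.1 α β.2)) (T (basisVec α))

open Classical in
/-- The operator `ρ(a)`: the unique bounded operator with `ρ(a) h_α = a(r(α)) h_α`. -/
def rho (a : C₀(G.V, ℂ)) : BddOp G.Hilb :=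
  if h : ∃ T, G.IsRho a T then h.choose else 0

open Classical in
/-- The operator `ψ(ξ)`: the unique bounded operator with
`ψ(ξ) h_α = ∑_{β ∈ G¹ r(α)} ξ(β) h_{βα}`. -/
def psi (ξ : C_c(G.Edge, ℂ)) : BddOp G.Hilb :=
  if h : ∃ T, G.IsPsi ξ T then h.choose else 0

/-- All the operators `ρ(a)` and `ψ(ξ)` exist as bounded operators. -/
def Represented : Prop :=
  (∀ a, G.IsRho a (G.rho a)) ∧ ∀ ξ, G.IsPsi ξ (G.psi ξ)

/-- The Toeplitz algebra: the `C*`-subalgebra of `B(ℓ²(G*))` generated by the `ρ(a)`,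
`a ∈ C₀(G⁰)`, and the `ψ(ξ)`, `ξ ∈ C_c(G¹)`. -/
def Toeplitz : NonUnitalStarSubalgebra ℂ (BddOp G.Hilb) :=
  cstarGen (Set.range G.rho ∪ Set.range G.psi)

instance : NonUnitalRing G.Toeplitz := inferInstance

instance : Module ℂ G.Toeplitz := inferInstance

instance : StarRing G.Toeplitz := inferInstance

instance : Add G.Toeplitz := inferInstance

instance : Mul G.Toeplitz := inferInstance

instance : Star G.Toeplitz := inferInstance

/-- `ρ(a)` as an element of the Toeplitz algebra. -/
def rhoT (a : C₀(G.V, ℂ)) : G.Toeplitz :=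
  ⟨G.rho a, subset_closure (NonUnitalStarAlgebra.subset_adjoin ℂ _ (Or.inl ⟨a, rfl⟩))⟩

/-- `ψ(ξ)` as an element of the Toeplitz algebra. -/
def psiT (ξ : C_c(G.Edge, ℂ)) : G.Toeplitz :=
  ⟨G.psi ξ, subset_closure (NonUnitalStarAlgebra.subset_adjoin ℂ _ (Or.inr ⟨ξ, rfl⟩))⟩

variable {ι : Type v}

/-- The set of paths `α` with `p(s(α)) = i`. -/
def fibre (p : G.V → ι) (i : ι) : Set G.toDirGraph.Path := {α | p α.source = i}

theorem projOp_commute (p : G.V → ι) (i : ι) (T : BddOp G.Hilb) (hT : T ∈ G.Toeplitz) :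
    projOp (G.fibre p i) * T = T * projOp (G.fibre p i) := by
  classical
  have hle : G.Toeplitz ≤
      NonUnitalStarSubalgebra.centralizer ℂ {projOp (G.fibre p i)} := by
    refine NonUnitalStarSubalgebra.topologicalClosure_minimal _
      (NonUnitalStarAlgebra.adjoin_le ?_) (Set.isClosed_centralizer _)
    suffices h : ∀ T ∈ Set.range G.rho ∪ Set.range G.psi,
        projOp (G.fibre p i) * T = T * projOp (G.fibre p i) by
      intro T hT
      rw [SetLike.mem_coe, NonUnitalStarSubalgebra.mem_centralizer_iff]
      rintro _ rfl
      rw [star_projOp]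
      exact ⟨h T hT, h T hT⟩
    rintro _ (⟨a, rfl⟩ | ⟨ξ, rfl⟩)
    · unfold rho
      split_ifs with h
      · refine EllTwo.op_ext fun α => ?_
        have h1 := h.choose_spec α
        simp only [ContinuousLinearMap.mul_def, ContinuousLinearMap.comp_apply, h1, projOp_basisVec, map_smul]
        split_ifs <;> simp [h1]
      · simp
    · unfold psi
      split_ifs with h
      · refine EllTwo.op_ext fun α => ?_
        have h1 := h.choose_spec α
        have h2 := h1.mapL (projOp (G.fibre p i))
        have hm : ∀ β : {β : G.Edge // G.s β = α.range},
            DirGraph.Path.cons β.1 α β.2 ∈ G.fibre p i ↔ α ∈ G.fibre p i := fun β => Iff.rfl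
        simp only [map_smul, projOp_basisVec, hm] at h2
        simp only [ContinuousLinearMap.mul_def, ContinuousLinearMap.comp_apply, projOp_basisVec]
        by_cases hα : α ∈ G.fibre p i
        · simp only [hα, if_true] at h2 ⊢
          exact h2.unique h1
        · simp only [hα, if_false, smul_zero] at h2 ⊢
          rw [map_zero]
          exact h2.unique hasSum_zero
      · simp
  exact (NonUnitalStarSubalgebra.mem_centralizer_iff ℂ).1 (hle hT) _ rfl |>.1

/-- For `p : G⁰ → ι`, the homomorphism from the Toeplitz algebra to `∏_i Q(ℓ²(G*_i))` that
restricts an operator to the invariant subspaces `ℓ²(G*_i)`, where `G*_i` is the set of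
paths `α` with `p(s(α)) = i`, and passes to the Calkin algebras. -/
def calkinRep (p : G.V → ι) :
    G.Toeplitz →⋆ₙₐ[ℂ] (∀ i : ι, Calkin (EllTwo (G.fibre p i))) where
  toFun T i := toCalkin (restrictOp (G.fibre p i) T)
  map_smul' c T := by
    funext i
    simp [restrictOp]
  map_zero' := by
    funext i
    simp [restrictOp]
  map_add' S T := by
    funext i
    simp [restrictOp]
  map_mul' S T := by
    funext i
    have := restrictOp_mul (G.fibre p i) S T (G.projOp_commute p i T T.2)
    simp [this]
  map_star' T := by
    funext i
    rw [Pi.star_apply, ← map_star]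
    congr 1
    simp [restrictOp, ContinuousLinearMap.star_eq_adjoint, ContinuousLinearMap.adjoint_comp,
      ContinuousLinearMap.comp_assoc]

/-- The Cuntz--Krieger algebra of `G` formed with respect to `p : G⁰ → ι`: the image of the
Toeplitz algebra in `∏_i Q(ℓ²(G*_i))`. For `p = id` this is the image in
`∏_ω Q(ℓ²(G* ω))`, the product over all vertices `ω`. -/
def CuntzKrieger (p : G.V → ι) :
    NonUnitalStarSubalgebra ℂ (∀ i : ι, Calkin (EllTwo (G.fibre p i))) :=
  NonUnitalStarAlgHom.range (G.calkinRep p)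

instance (p : G.V → ι) : NonUnitalRing (G.CuntzKrieger p) := inferInstance

instance (p : G.V → ι) : Module ℂ (G.CuntzKrieger p) := inferInstance

instance (p : G.V → ι) : StarRing (G.CuntzKrieger p) := inferInstance

instance (p : G.V → ι) : Add (G.CuntzKrieger p) := inferInstance

instance (p : G.V → ι) : Mul (G.CuntzKrieger p) := inferInstance

instance (p : G.V → ι) : SMul ℂ (G.CuntzKrieger p) := inferInstance

instance (p : G.V → ι) : Star (G.CuntzKrieger p) := inferInstance

/-- The quotient map from the Toeplitz algebra onto the Cuntz--Krieger algebra. -/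
def quotMap (p : G.V → ι) : G.Toeplitz →⋆ₙₐ[ℂ] G.CuntzKrieger p :=
  NonUnitalStarAlgHom.rangeRestrict (G.calkinRep p)

variable {G}

/-- Isomorphisms of Toeplitz algebras. -/
abbrev ToeplitzEquiv (G H : TopQuiver.{u}) : Type u := G.Toeplitz ≃⋆ₐ[ℂ] H.Toeplitz

/-- `Φ` carries `ρ_G(a ∘ θ)` to `ρ_H(a)` for `a ∈ C₀(H⁰)` and `ψ_G(ξ ∘ θ)` to `ψ_H(ξ)` for
`ξ ∈ C_c(H¹)`. -/
def ToeplitzEquiv.Carries {G H : TopQuiver.{u}} (Φ : ToeplitzEquiv G H) (θ : Iso G H) : Prop :=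
  (∀ a : C₀(H.V, ℂ), Φ (G.rhoT (θ.pullV a)) = H.rhoT a) ∧
    ∀ ξ : C_c(H.Edge, ℂ), Φ (G.psiT (θ.pullEdge ξ)) = H.psiT ξ

/-- The isomorphism `Φ` of Toeplitz algebras descends to an isomorphism of the
Cuntz--Krieger algebras formed with respect to `p` and `q`. -/
def ToeplitzEquiv.Descends {G H : TopQuiver.{u}} {κ : Type w} (Φ : ToeplitzEquiv G H)
    (p : G.V → ι) (q : H.V → κ) : Prop :=
  ∃ Φ' : G.CuntzKrieger p ≃⋆ₐ[ℂ] H.CuntzKrieger q,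
    ∀ x : G.Toeplitz, Φ' (G.quotMap p x) = H.quotMap q (Φ x)

end TopQuiver

/-! ## The suspension of a graph -/

namespace DirGraph

variable (E : DirGraph.{u})

/-- The paths of length two. -/
abbrev TwoPath : Type u := {p : E.Edge × E.Edge // E.s p.1 = E.r p.2}

/-- The gluing relation on `(E¹ × [0,1]) ⊔ E⁰`: `(f, 0) ∼ r(f)` and `(e, 1) ∼ s(e)`. -/
inductive SuspVRel : ((Σ _ : E.Edge, unitInterval) ⊕ E.V) → ((Σ _ : E.Edge, unitInterval) ⊕ E.V) → Prop
  | zero (f : E.Edge) : SuspVRel (Sum.inl ⟨f, 0⟩) (Sum.inr (E.r f))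
  | one (e : E.Edge) : SuspVRel (Sum.inl ⟨e, 1⟩) (Sum.inr (E.s e))

/-- The gluing relation on `(E² × [0,1]) ⊔ E¹`: `(ef, 0) ∼ e` and `(ef, 1) ∼ f`. -/
inductive SuspEdgeRel :
    ((Σ _ : E.TwoPath, unitInterval) ⊕ E.Edge) → ((Σ _ : E.TwoPath, unitInterval) ⊕ E.Edge) → Prop
  | zero (p : E.TwoPath) : SuspEdgeRel (Sum.inl ⟨p, 0⟩) (Sum.inr p.1.1)
  | one (p : E.TwoPath) : SuspEdgeRel (Sum.inl ⟨p, 1⟩) (Sum.inr p.1.2)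

/-- The vertex space of the suspension, the quotient of `(E¹ × [0,1]) ⊔ E⁰` by the smallest
equivalence relation containing the gluing relation. -/
def SuspV : Type u := Quot E.SuspVRel

/-- The edge space of the suspension, the quotient of `(E² × [0,1]) ⊔ E¹` by the smallest
equivalence relation containing the gluing relation. -/
def SuspEdge : Type u := Quot E.SuspEdgeRel

/-- The quotient topology, where `E⁰` and `E¹` are discrete. -/
instance : TopologicalSpace E.SuspV :=
  letI : TopologicalSpace E.V := ⊥
  inferInstanceAs (TopologicalSpace (Quot E.SuspVRel))

/-- The quotient topology, where `E¹` and `E²` are discrete. -/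
instance : TopologicalSpace E.SuspEdge :=
  letI : TopologicalSpace E.Edge := ⊥
  inferInstanceAs (TopologicalSpace (Quot E.SuspEdgeRel))

variable {E}

/-- The class `[e, t]`. -/
def SuspV.mk (e : E.Edge) (t : unitInterval) : E.SuspV := Quot.mk _ (Sum.inl ⟨e, t⟩)

/-- The class `[v]`. -/
def SuspV.ofVertex (v : E.V) : E.SuspV := Quot.mk _ (Sum.inr v)

/-- The class `[ef, t]`. -/
def SuspEdge.mk (e f : E.Edge) (h : E.s e = E.r f) (t : unitInterval) : E.SuspEdge :=
  Quot.mk _ (Sum.inl ⟨⟨(e, f), h⟩, t⟩)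

/-- The range map: `r [ef, t] = [e, t]` and `r [e] = [r(e)]`. -/
def SuspEdge.range : E.SuspEdge → E.SuspV :=
  Quot.lift
    (Sum.elim (fun x => SuspV.mk x.1.1.1 x.2) (fun e => SuspV.ofVertex (E.r e)))
    (by
      rintro _ _ (p | p)
      · exact Quot.sound (SuspVRel.zero p.1.1)
      · refine (Quot.sound (SuspVRel.one p.1.1)).trans ?_
        exact congrArg SuspV.ofVertex p.2)

/-- The source map: `s [ef, t] = [f, t]` and `s [e] = [s(e)]`. -/
def SuspEdge.source : E.SuspEdge → E.SuspV :=
  Quot.lift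
    (Sum.elim (fun x => SuspV.mk x.1.1.2 x.2) (fun e => SuspV.ofVertex (E.s e)))
    (by
      rintro _ _ (p | p)
      · refine (Quot.sound (SuspVRel.zero p.1.2)).trans ?_
        exact congrArg SuspV.ofVertex p.2.symm
      · exact Quot.sound (SuspVRel.one p.1.2))

variable (E) in
/-- The suspension of `E`. -/
def suspension : TopQuiver.{u} where
  V := E.SuspV
  Edge := E.SuspEdge
  r := SuspEdge.range
  s := SuspEdge.source

/-- The map `ϖ` from the vertices of the suspension to the circle `ℝ/ℤ`: `[e, t] ↦ t`. -/
def SuspV.toCircle : E.SuspV → UnitAddCircle :=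
  Quot.lift (Sum.elim (fun x => ((x.2 : ℝ) : UnitAddCircle)) (fun _ => 0))
    (by
      rintro _ _ (f | e)
      · simp
      · simp)

/-! ## Fractional higher-power graphs -/

variable (E) in
/-- The space `⨆_n Eⁿ × [0, n]`. -/
abbrev FracVPre : Type u := Σ μ : E.Path, {t : ℝ // 0 ≤ t ∧ t ≤ μ.length}

variable (E) in
/-- The space of all `(μ, t)` with `t, t + l ∈ [0, |μ|]`. -/
abbrev FracEdgePre (l : ℝ) : Type u :=
  Σ μ : E.Path, {t : ℝ // (0 ≤ t ∧ t ≤ μ.length) ∧ 0 ≤ t + l ∧ t + l ≤ μ.length}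

variable (E) in
/-- The relation `(μ, s) ∼ (ν, t)`: `s - ⌊s⌋ = t - ⌊t⌋` and
`μ(⌊s⌋, ⌈s⌉) = ν(⌊t⌋, ⌈t⌉)`. -/
def fracVSetoid : Setoid E.FracVPre :=
  Setoid.ker fun x : E.FracVPre => (Int.fract x.2.1, x.1.seg ⌊x.2.1⌋₊ ⌈x.2.1⌉₊)

variable (E) in
/-- The relation `(μ, s) ≈ (ν, t)`: `s - ⌊s⌋ = t - ⌊t⌋` and
`μ(⌊s⌋, ⌈s + l⌉) = ν(⌊t⌋, ⌈t + l⌉)` if `l ≥ 0`,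
`μ(⌊s + l⌋, ⌈s⌉) = ν(⌊t + l⌋, ⌈t⌉)` if `l ≤ 0`. -/
def fracEdgeSetoid (l : ℝ) : Setoid (E.FracEdgePre l) :=
  Setoid.ker fun x : E.FracEdgePre l => (Int.fract x.2.1,
    if 0 ≤ l then x.1.seg ⌊x.2.1⌋₊ ⌈x.2.1 + l⌉₊ else x.1.seg ⌊x.2.1 + l⌋₊ ⌈x.2.1⌉₊)

variable (E) in
/-- The common vertex space of the fractional higher-power graphs: the topological quotient
of `⨆_n Eⁿ × [0, n]`, where each `Eⁿ` is discrete. -/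
def FracV : Type u := Quotient E.fracVSetoid

variable (E) in
/-- The edge space of the fractional higher-power graph with parameter `l`: the topological
quotient of the space of all `(μ, t)` with `t, t + l ∈ [0, |μ|]`. -/
def FracEdge (l : ℝ) : Type u := Quotient (E.fracEdgeSetoid l)

instance : TopologicalSpace E.FracV := inferInstanceAs (TopologicalSpace (Quotient _))

instance (l : ℝ) : TopologicalSpace (E.FracEdge l) :=
  inferInstanceAs (TopologicalSpace (Quotient _))

/-- The class `[μ, t]` in the vertex space. -/
def FracV.mk (μ : E.Path) (t : ℝ) (h : 0 ≤ t ∧ t ≤ μ.length) : E.FracV :=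
  Quotient.mk _ ⟨μ, t, h⟩

/-- The class `[μ, t]_l` in the edge space. -/
def FracEdge.mk {l : ℝ} (μ : E.Path) (t : ℝ)
    (h : (0 ≤ t ∧ t ≤ μ.length) ∧ 0 ≤ t + l ∧ t + l ≤ μ.length) : E.FracEdge l :=
  Quotient.mk _ ⟨μ, t, h⟩

/-- Equal segments have equal subsegments. -/
theorem Path.seg_sub {μ ν : E.Path} {m n m' n' : ℕ} (hn : n ≤ μ.length) (hn' : n' ≤ ν.length)
    (hmn : m ≤ n) (hmn' : m' ≤ n') (hlen : n - m = n' - m') (h : μ.seg m n = ν.seg m' n')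
    {i j : ℕ} (hij : i ≤ j) (hj : j ≤ n - m) :
    μ.seg (m + i) (m + j) = ν.seg (m' + i) (m' + j) := by
  have key : ∀ (κ : E.Path) (a b : ℕ), b ≤ κ.length → a ≤ b → j ≤ b - a →
      κ.seg (a + i) (a + j) = ((((κ.seg a b).1).drop i).take (j - i),
        E.rangeOf ((κ.seg a b).1.drop j) (κ.seg a b).2) := by
    intro κ a b hb hab hjb
    have e1 : a + j - (a + i) = j - i := by omega
    refine Prod.ext ?_ ?_
    · simp only [Path.seg, e1, List.drop_take, List.drop_drop, List.take_take]
      congr 1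
      omega
    · have e2 : κ.edges.drop (a + j) =
          ((κ.edges.drop a).take (b - a)).drop j ++ κ.edges.drop b := by
        have e3 : κ.edges.drop a = (κ.edges.drop a).take (b - a) ++ κ.edges.drop b := by
          conv_lhs => rw [← List.take_append_drop (b - a) (κ.edges.drop a)]
          rw [List.drop_drop, Nat.add_sub_cancel' hab]
        rw [← List.drop_drop, e3, List.drop_append_of_le_length]
        · rw [← e3]
        · have : κ.edges.length = κ.length := rfl
          simp only [List.length_take, List.length_drop]
          omega
      simp only [Path.seg, Path.vertexAt, e2]
      cases ((κ.edges.drop a).take (b - a)).drop j <;> rfl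
  rw [key μ m n hn hmn hj, key ν m' n' hn' hmn' (hlen ▸ hj), h]

theorem fracV_sound_aux {μ ν : E.Path} {s t k : ℝ} (hk : 0 ≤ k) (hs : 0 ≤ s) (ht : 0 ≤ t)
    (hs' : s + k ≤ μ.length) (ht' : t + k ≤ ν.length) (hf : Int.fract s = Int.fract t)
    (h : μ.seg ⌊s⌋₊ ⌈s + k⌉₊ = ν.seg ⌊t⌋₊ ⌈t + k⌉₊) :
    μ.seg ⌊s⌋₊ ⌈s⌉₊ = ν.seg ⌊t⌋₊ ⌈t⌉₊ ∧
      μ.seg ⌊s + k⌋₊ ⌈s + k⌉₊ = ν.seg ⌊t + k⌋₊ ⌈t + k⌉₊ := by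
  have dec : ∀ x : ℝ, 0 ≤ x → ⌈x⌉₊ = ⌊x⌋₊ + ⌈Int.fract x⌉₊ ∧
      ⌊x + k⌋₊ = ⌊x⌋₊ + ⌊Int.fract x + k⌋₊ ∧ ⌈x + k⌉₊ = ⌊x⌋₊ + ⌈Int.fract x + k⌉₊ := by
    intro x hx
    have h0 := Int.fract_nonneg x
    have hx' : x = Int.fract x + (⌊x⌋₊ : ℝ) := by
      rw [natCast_floor_eq_intCast_floor hx, Int.fract_add_floor]
    refine ⟨?_, ?_, ?_⟩
    · conv_lhs => rw [hx']
      rw [Nat.ceil_add_natCast h0, add_comm]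
    · conv_lhs => rw [hx', add_right_comm]
      rw [Nat.floor_add_natCast (by positivity), add_comm]
    · conv_lhs => rw [hx', add_right_comm]
      rw [Nat.ceil_add_natCast (by positivity), add_comm]
  obtain ⟨s1, s2, s3⟩ := dec s hs
  obtain ⟨t1, t2, t3⟩ := dec t ht
  have hn : ⌈s + k⌉₊ ≤ μ.length := Nat.ceil_le.2 hs'
  have hn' : ⌈t + k⌉₊ ≤ ν.length := Nat.ceil_le.2 ht'
  have hle : ⌈Int.fract t⌉₊ ≤ ⌈Int.fract t + k⌉₊ := Nat.ceil_mono (by linarith)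
  have hle2 : ⌊Int.fract t + k⌋₊ ≤ ⌈Int.fract t + k⌉₊ := Nat.floor_le_ceil _
  rw [hf] at s1 s2 s3
  rw [s3] at hn
  rw [t3] at hn'
  rw [s3, t3] at h
  constructor
  · have := Path.seg_sub hn hn' (by omega) (by omega) (by omega) h
      (i := 0) (j := ⌈Int.fract t⌉₊) (by omega) (by omega)
    rwa [s1, t1]
  · have := Path.seg_sub hn hn' (by omega) (by omega) (by omega) h
      (i := ⌊Int.fract t + k⌋₊) (j := ⌈Int.fract t + k⌉₊) hle2 (by omega)
    rwa [s2, t2, s3, t3]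

theorem fract_add_congr {s t : ℝ} (h : Int.fract s = Int.fract t) (l : ℝ) :
    Int.fract (s + l) = Int.fract (t + l) := by
  obtain ⟨z, hz⟩ := Int.fract_eq_fract.1 h
  exact Int.fract_eq_fract.2 ⟨z, by rw [← hz]; ring⟩

/-- If `[μ, s]_l = [ν, t]_l`, then `[μ, s] = [ν, t]` and `[μ, s + l] = [ν, t + l]`. -/
theorem fracEdge_sound {l : ℝ} {x y : E.FracEdgePre l} (h : E.fracEdgeSetoid l x y) :
    FracV.mk x.1 x.2.1 x.2.2.1 = FracV.mk y.1 y.2.1 y.2.2.1 ∧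
      FracV.mk x.1 (x.2.1 + l) x.2.2.2 = FracV.mk y.1 (y.2.1 + l) y.2.2.2 := by
  obtain ⟨μ, s, ⟨hs1, hs2⟩, hs3, hs4⟩ := x
  obtain ⟨ν, t, ⟨ht1, ht2⟩, ht3, ht4⟩ := y
  have hf : Int.fract s = Int.fract t := congrArg Prod.fst h
  have hf' := fract_add_congr hf l
  have hseg := congrArg Prod.snd h
  simp only at hseg
  by_cases hl : 0 ≤ l
  · simp only [hl, if_true] at hseg
    obtain ⟨h1, h2⟩ := fracV_sound_aux hl hs1 ht1 hs4 ht4 hf hseg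
    exact ⟨Quotient.sound (Prod.ext hf h1), Quotient.sound (Prod.ext hf' h2)⟩
  · simp only [hl, if_false] at hseg
    have e : ∀ x : ℝ, x + l + -l = x := fun x => by ring
    have := fracV_sound_aux (μ := μ) (ν := ν) (s := s + l) (t := t + l) (k := -l)
      (by linarith) hs3 ht3 (by rwa [e]) (by rwa [e]) hf' (by simpa only [e] using hseg)
    simp only [e] at this
    exact ⟨Quotient.sound (Prod.ext hf this.2), Quotient.sound (Prod.ext hf' this.1)⟩

/-- The range map `r_l [μ, t]_l = [μ, t]`. -/
def FracEdge.range {l : ℝ} : E.FracEdge l → E.FracV :=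
  Quotient.lift (fun x => FracV.mk x.1 x.2.1 x.2.2.1) fun _ _ h => (fracEdge_sound h).1

/-- The source map `s_l [μ, t]_l = [μ, t + l]`. -/
def FracEdge.source {l : ℝ} : E.FracEdge l → E.FracV :=
  Quotient.lift (fun x => FracV.mk x.1 (x.2.1 + l) x.2.2.2) fun _ _ h => (fracEdge_sound h).2

variable (E) in
/-- The fractional higher-power graph of `E` with parameter `l`. -/
def fractional (l : ℝ) : TopQuiver.{u} where
  V := E.FracV
  Edge := E.FracEdge l
  r := FracEdge.range
  s := FracEdge.source

/-- The map `ϖ` to the circle `ℝ/ℤ`: `[μ, t] ↦ t`. -/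
def FracV.toCircle : E.FracV → UnitAddCircle :=
  Quotient.lift (fun x => ((x.2.1 : ℝ) : UnitAddCircle)) (by
    intro x y h
    have h1 : Int.fract x.2.1 = Int.fract y.2.1 := congrArg Prod.fst h
    obtain ⟨z, hz⟩ := Int.fract_eq_fract.1 h1
    have : x.2.1 = y.2.1 + z := by linarith
    change ((x.2.1 : ℝ) : UnitAddCircle) = ((y.2.1 : ℝ) : UnitAddCircle)
    rw [this]
    simp)

end DirGraph

/-! ## The classical Toeplitz algebra and tensor products with `C₀(X)` -/

/-- The unilateral shift `S h_n = h_{n+1}` on `ℓ²(ℕ)`. -/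
def unilateralShift : BddOp (EllTwo ℕ) :=
  (pushIsometry Nat.succ Nat.succ_injective).toContinuousLinearMap

/-- The classical Toeplitz algebra, the unital `C*`-algebra generated by the shift `S`. -/
def ToeplitzAlg : Type := StarAlgebra.elemental ℂ unilateralShift

instance : CStarAlgebra ToeplitzAlg :=
  have : IsClosed (StarAlgebra.elemental ℂ unilateralShift : Set (BddOp (EllTwo ℕ))) :=
    StarAlgebra.elemental.isClosed ℂ _
  inferInstanceAs (CStarAlgebra (StarAlgebra.elemental ℂ unilateralShift))

/-- The shift as an element of the Toeplitz algebra. -/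
def shiftT : ToeplitzAlg := ⟨unilateralShift, StarAlgebra.elemental.self_mem ℂ _⟩

/-- The generator `z ↦ z` of `C(𝕋)`. -/
def circleCoord : C(Circle, ℂ) := ⟨fun z => (z : ℂ), continuous_subtype_val⟩

/-- The elementary tensor `a ⊗ b`, as the function `x ↦ a(x) b` in `C₀(X, A)`. -/
def elemTensor {X : Type u} [TopologicalSpace X] {A : Type v} [CStarAlgebra A]
    (a : C₀(X, ℂ)) (b : A) : C₀(X, A) where
  toFun x := a x • b
  continuous_toFun := a.continuous.smul continuous_const
  zero_at_infty' := by
    simpa using a.zero_at_infty'.smul_const b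

/-- The `C*`-tensor product `C₀(X) ⊗ A`: the completion of the algebraic tensor product in
its unique `C*`-norm, realised inside `C₀(X, A)` with the supremum norm as the closed
`*`-subalgebra generated by the elementary tensors `a ⊗ b = (x ↦ a(x) b)`. -/
def C0Tensor (X : Type u) [TopologicalSpace X] (A : Type v) [CStarAlgebra A] :
    NonUnitalStarSubalgebra ℂ C₀(X, A) :=
  cstarGen {f | ∃ (a : C₀(X, ℂ)) (b : A), f = elemTensor a b}

instance (X : Type u) [TopologicalSpace X] (A : Type v) [CStarAlgebra A] :
    Add (C0Tensor X A) := inferInstance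

instance (X : Type u) [TopologicalSpace X] (A : Type v) [CStarAlgebra A] :
    Mul (C0Tensor X A) := inferInstance

instance (X : Type u) [TopologicalSpace X] (A : Type v) [CStarAlgebra A] :
    Star (C0Tensor X A) := inferInstance

namespace TopQuiver

/-- Isomorphisms of the Toeplitz algebra of `G` with `C₀(G⁰) ⊗ A`. -/
abbrev ToeplitzTensorEquiv (G : TopQuiver.{u}) (A : Type v) [CStarAlgebra A] : Type (max u v) :=
  G.Toeplitz ≃⋆ₐ[ℂ] C0Tensor G.V A

/-- Isomorphisms of the Cuntz--Krieger algebra of `G` (formed in `∏_ω Q(ℓ²(G* ω))`) with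
`C₀(G⁰) ⊗ A`. -/
abbrev CuntzKriegerTensorEquiv (G : TopQuiver.{u}) (A : Type v) [CStarAlgebra A] :
    Type (max u v) :=
  G.CuntzKrieger (id : G.V → G.V) ≃⋆ₐ[ℂ] C0Tensor G.V A

/-- `Φ` carries `ρ(a)` to `a ⊗ 1` and `ψ(ξ)` to `(ξ ∘ θ⁻¹) ⊗ S`. -/
def ToeplitzTensorEquiv.Carries {G : TopQuiver.{u}} (Φ : G.ToeplitzTensorEquiv ToeplitzAlg)
    (θ : G.Edge ≃ₜ G.V) : Prop :=
  (∀ a : C₀(G.V, ℂ), (Φ (G.rhoT a)).1 = elemTensor a 1) ∧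
    ∀ (ξ : C_c(G.Edge, ℂ)) (ω : G.V), (Φ (G.psiT ξ)).1 ω = ξ (θ.symm ω) • shiftT

/-- `Φ` descends to `Φ'`: the quotient map of the Toeplitz algebra onto the Cuntz--Krieger
algebra corresponds under `Φ` and `Φ'` to `id ⊗ τ`. -/
def ToeplitzTensorEquiv.DescendsTo {G : TopQuiver.{u}} {A : Type v} {B : Type w}
    [CStarAlgebra A] [CStarAlgebra B] (Φ : G.ToeplitzTensorEquiv A) (τ : A →⋆ₐ[ℂ] B)
    (Φ' : G.CuntzKriegerTensorEquiv B) : Prop :=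
  ∀ (x : G.Toeplitz) (ω : G.V), (Φ' (G.quotMap id x)).1 ω = τ ((Φ x).1 ω)

end TopQuiver

end

/-!
The quivers `𝒮₁E` and `𝒮₋₁E` are isomorphic to the suspensions of `E` and of the opposite graph,
and `𝒮₀E` has exactly one loop at each of its vertices. The assertions on algebras follow from
these two facts.

*Parameter `1`.* A pair `(μ, t)` describes the point reached at time `t` on a walk along `μ` at
unit speed (`walkPt`). This defines a continuous map onto the vertex space of the suspension. It
is a quotient map, because its restriction to the paths of length at most one is the defining
quotient map of the suspension, and two pairs have the same image exactly if they are equivalent.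
The edge space of the suspension of `E` is the vertex space of the suspension of the line graph of
`E`, so the same argument applies to edges. The isomorphism of quivers induces a unitary between
the `ℓ²`-spaces of the sets of paths, which conjugates one Toeplitz algebra to the other and
matches the kernels of the quotient maps (`Iso.toeplitzEquiv`, `Iso.toeplitzEquiv_descends`). If
`E⁰` is finite, then every fibre of the map to the circle is finite, the part of an operator over
a point of the circle is a finite direct sum of its parts over vertices, and both quotient maps of
the Toeplitz algebra have the same kernel (`quotMap_id_eq_zero_iff`).

*Parameter `-1`.* The shift `(μ, t) ↦ (μ, t - 1)` identifies `𝒮₋₁E` with the opposite of `𝒮₁E`, and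
`[e, t] ↦ [e, 1 - t]` identifies the opposite of the suspension with the suspension of the opposite
graph.

*Parameter `0`.* The paths at a vertex `ω` are the powers of the loop at `ω`, so that `ℓ²(G*)` is
the direct sum of copies of `ℓ²(ℕ)`, and `ψ(ξ)` acts on the copy at `ω` as a multiple of the
unilateral shift. The elements of the Toeplitz algebra of `G` are therefore direct sums of
Toeplitz operators `f(ω)` (`IsLoopQuiver.Decomposes`), where `f` ranges over `C₀(X) ⊗ 𝒯`. The
operator and the function determine each other and have equal norms, as injective
`*`-homomorphisms of `C*`-algebras are isometric. An element is compact on each summand exactly if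
the symbol of each `f(ω)` vanishes (`isCompactOperator_toeplitzIncl_iff`). The symbol of a Toeplitz
operator is obtained as its asymptotic eigenvalue on approximate eigenvectors of the shift, and
the compressions `T_φ` of `φ(U)` to `ℓ²(ℕ)`, for the bilateral shift `U`, provide a bounded linear
section of the symbol map, which shows that `id ⊗ τ` is onto `C₀(X) ⊗ C(𝕋)`.

*Boundedness.* A weighted composition operator on `ℓ²` is bounded if its weight is bounded and is
supported by a bounded number of points in each fibre (`exists_weightedComp`). For the suspension
this applies to `ψ(ξ)`, because the compact support of `ξ` meets only finitely many cells.
-/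

/-! ### Unitaries given by bijections of index sets -/

theorem adjoint_pushIsometry_comp {X : Type v} {Y : Type w} (f : X → Y)
    (hf : Function.Injective f) :
    ContinuousLinearMap.adjoint (pushIsometry f hf).toContinuousLinearMap ∘L
      (pushIsometry f hf).toContinuousLinearMap = ContinuousLinearMap.id ℂ (EllTwo X) := by
  refine ContinuousLinearMap.ext fun x => ext_inner_right ℂ fun y => ?_
  simp only [ContinuousLinearMap.comp_apply, ContinuousLinearMap.adjoint_inner_left,
    ContinuousLinearMap.id_apply]
  exact (pushIsometry f hf).inner_map_map x y

theorem adjoint_inclOp_comp {X : Type w} (A : Set X) :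
    ContinuousLinearMap.adjoint (inclOp A) ∘L inclOp A =
      ContinuousLinearMap.id ℂ (EllTwo A) :=
  adjoint_pushIsometry_comp _ Subtype.val_injective

/-- The unitary `ℓ²(X) → ℓ²(Y)`, `h_x ↦ h_{e x}`, of a bijection `e`. -/
noncomputable def permOp {X : Type v} {Y : Type w} (e : X ≃ Y) : EllTwo X →L[ℂ] EllTwo Y :=
  (pushIsometry e e.injective).toContinuousLinearMap

@[simp]
theorem permOp_basisVec {X : Type v} {Y : Type w} (e : X ≃ Y) (x : X) :
    permOp e (basisVec x) = basisVec (e x) :=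
  pushIsometry_basisVec e e.injective x

theorem permOp_symm_comp {X : Type v} {Y : Type w} (e : X ≃ Y) :
    permOp e.symm ∘L permOp e = ContinuousLinearMap.id ℂ (EllTwo X) :=
  EllTwo.op_ext fun x => by simp

@[simp]
theorem permOp_symm_apply_permOp {X : Type v} {Y : Type w} (e : X ≃ Y) (f : EllTwo X) :
    permOp e.symm (permOp e f) = f :=
  congrArg (fun T => T f) (permOp_symm_comp e)

@[simp]
theorem permOp_apply_permOp_symm {X : Type v} {Y : Type w} (e : X ≃ Y) (f : EllTwo Y) :
    permOp e (permOp e.symm f) = f :=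
  permOp_symm_apply_permOp e.symm f

theorem adjoint_permOp {X : Type v} {Y : Type w} (e : X ≃ Y) :
    ContinuousLinearMap.adjoint (permOp e) = permOp e.symm := by
  refine ContinuousLinearMap.ext fun y => ?_
  have h := congrArg (fun T => T (permOp e.symm y))
    (adjoint_pushIsometry_comp e e.injective)
  change ContinuousLinearMap.adjoint (permOp e) (permOp e (permOp e.symm y)) = _ at h
  rwa [permOp_apply_permOp_symm] at h

/-- Conjugation by the unitary of a bijection. -/
noncomputable def conjPerm {X : Type v} {Y : Type w} (e : X ≃ Y) :
    BddOp (EllTwo X) →⋆ₙₐ[ℂ] BddOp (EllTwo Y) where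
  toFun T := permOp e ∘L T ∘L permOp e.symm
  map_smul' c T := by ext1 f; simp
  map_zero' := by simp
  map_add' S T := by ext1 f; simp
  map_mul' S T := by ext1 f; simp
  map_star' T := by
    simp only [ContinuousLinearMap.star_eq_adjoint, ContinuousLinearMap.adjoint_comp,
      adjoint_permOp, ContinuousLinearMap.comp_assoc, Equiv.symm_symm]

theorem conjPerm_apply {X : Type v} {Y : Type w} (e : X ≃ Y) (T : BddOp (EllTwo X)) :
    conjPerm e T = permOp e ∘L T ∘L permOp e.symm := rfl

theorem continuous_conjPerm {X : Type v} {Y : Type w} (e : X ≃ Y) :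
    Continuous (conjPerm e) :=
  continuous_const.clm_comp (continuous_id.clm_comp continuous_const)

theorem conjPerm_symm_conjPerm {X : Type v} {Y : Type w} (e : X ≃ Y) (T : BddOp (EllTwo X)) :
    conjPerm e.symm (conjPerm e T) = T := by
  ext1 f; simp [conjPerm_apply]

theorem projOp_mul_projOp_of_subset {X : Type w} {A B : Set X} (h : A ⊆ B) :
    projOp B * projOp A = projOp A := by
  classical
  refine EllTwo.op_ext fun x => ?_
  simp only [ContinuousLinearMap.mul_def, ContinuousLinearMap.comp_apply, projOp_basisVec]
  split_ifs with hx
  · simp [projOp_basisVec, h hx]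
  · simp

theorem conjPerm_projOp {X : Type v} {Y : Type w} (e : X ≃ Y) (A : Set X) (B : Set Y)
    (h : ∀ x, x ∈ A ↔ e x ∈ B) : conjPerm e (projOp A) = projOp B := by
  classical
  refine EllTwo.op_ext fun y => ?_
  have h' := h (e.symm y)
  rw [e.apply_symm_apply] at h'
  simp only [conjPerm_apply, ContinuousLinearMap.comp_apply, permOp_basisVec, projOp_basisVec, h']
  split_ifs <;> simp

/-! ### Compactness of the parts of an operator -/

theorem restrictOp_eq_adjoint_comp {X : Type w} (A : Set X) (T : BddOp (EllTwo X)) :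
    restrictOp A T =
      ContinuousLinearMap.adjoint (inclOp A) ∘L (projOp A * T * projOp A) ∘L inclOp A := by
  refine ContinuousLinearMap.ext fun f => ?_
  have h2 : ∀ f, ContinuousLinearMap.adjoint (inclOp A) (inclOp A f) = f :=
    fun f => congrArg (fun R : BddOp (EllTwo A) => R f) (adjoint_inclOp_comp A)
  simp only [restrictOp, projOp, ContinuousLinearMap.mul_def, ContinuousLinearMap.comp_apply, h2]

/-- The part of `T` on `ℓ²(A)` is compact if and only if the compression `P_A T P_A` is. -/
theorem isCompactOperator_restrictOp_iff {X : Type w} (A : Set X) (T : BddOp (EllTwo X)) :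
    IsCompactOperator (restrictOp A T) ↔ IsCompactOperator (projOp A * T * projOp A) := by
  constructor
  · intro h
    exact (h.comp_clm (ContinuousLinearMap.adjoint (inclOp A))).clm_comp (inclOp A)
  · intro h
    rw [restrictOp_eq_adjoint_comp]
    exact (h.comp_clm (inclOp A)).clm_comp (ContinuousLinearMap.adjoint (inclOp A))

theorem isCompactOperator_conjPerm {X : Type v} {Y : Type w} (e : X ≃ Y)
    {T : BddOp (EllTwo X)} (h : IsCompactOperator T) : IsCompactOperator (conjPerm e T) :=
  (h.comp_clm (permOp e.symm)).clm_comp (permOp e)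

theorem isCompactOperator_restrictOp_conjPerm {X : Type v} {Y : Type w} (e : X ≃ Y)
    {A : Set X} {B : Set Y} (hAB : ∀ x, x ∈ A ↔ e x ∈ B) (T : BddOp (EllTwo X)) :
    IsCompactOperator (restrictOp B (conjPerm e T)) ↔ IsCompactOperator (restrictOp A T) := by
  rw [isCompactOperator_restrictOp_iff, isCompactOperator_restrictOp_iff,
    ← conjPerm_projOp e A B hAB, ← map_mul, ← map_mul]
  refine ⟨fun h => ?_, isCompactOperator_conjPerm e⟩
  have := isCompactOperator_conjPerm e.symm h
  rwa [conjPerm_symm_conjPerm] at this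

/-! ### Isomorphisms between quotients -/

/-- Two surjective `*`-homomorphisms on `A` with the same kernel have isomorphic images. -/
theorem exists_starAlgEquiv_of_ker_eq {A : Type u} {B : Type v} {C : Type w}
    [NonUnitalNonAssocRing A] [NonUnitalNonAssocRing B] [NonUnitalNonAssocRing C]
    [Module ℂ A] [Module ℂ B] [Module ℂ C] [Star A] [Star B] [Star C]
    (f : A →⋆ₙₐ[ℂ] B) (g : A →⋆ₙₐ[ℂ] C) (hf : Function.Surjective f)
    (hg : Function.Surjective g) (h : ∀ x, f x = 0 ↔ g x = 0) :
    ∃ e : B ≃⋆ₐ[ℂ] C, ∀ x, e (f x) = g x := by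
  have key : ∀ x y, f x = f y ↔ g x = g y := fun x y => by
    rw [← sub_eq_zero, ← map_sub, h, map_sub, sub_eq_zero]
  have h1 : ∀ x, f (Function.surjInv hf (f x)) = f x := fun x => Function.surjInv_eq hf _
  have h2 : ∀ x, g (Function.surjInv hg (g x)) = g x := fun x => Function.surjInv_eq hg _
  have h3 : ∀ x, g (Function.surjInv hf (f x)) = g x := fun x => (key _ _).1 (h1 x)
  have h4 : ∀ x, f (Function.surjInv hg (g x)) = f x := fun x => (key _ _).2 (h2 x)
  refine ⟨{ toFun := fun b => g (Function.surjInv hf b)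
            invFun := fun c => f (Function.surjInv hg c)
            left_inv := fun b => ?_
            right_inv := fun c => ?_
            map_mul' := fun b b' => ?_
            map_add' := fun b b' => ?_
            map_star' := fun b => ?_
            map_smul' := fun c b => ?_ }, h3⟩
  · obtain ⟨x, rfl⟩ := hf b
    exact (h4 _).trans (h1 x)
  · obtain ⟨x, rfl⟩ := hg c
    exact (h3 _).trans (h2 x)
  · obtain ⟨x, rfl⟩ := hf b
    obtain ⟨y, rfl⟩ := hf b'
    rw [← map_mul, h3, h3, h3, map_mul]
  · obtain ⟨x, rfl⟩ := hf b
    obtain ⟨y, rfl⟩ := hf b'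
    rw [← map_add, h3, h3, h3, map_add]
  · obtain ⟨x, rfl⟩ := hf b
    rw [← map_star, h3, h3, map_star]
  · obtain ⟨x, rfl⟩ := hf b
    rw [← map_smul, h3, h3, map_smul]

/-! ### Transport along isomorphisms of topological quivers -/

namespace TopQuiver

variable {G H K : TopQuiver.{u}}

theorem IsRho.unique {a : C₀(G.V, ℂ)} {S T : BddOp G.Hilb} (hS : G.IsRho a S)
    (hT : G.IsRho a T) : S = T :=
  EllTwo.op_ext fun α => (hS α).trans (hT α).symm

theorem IsPsi.unique {ξ : C_c(G.Edge, ℂ)} {S T : BddOp G.Hilb} (hS : G.IsPsi ξ S)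
    (hT : G.IsPsi ξ T) : S = T :=
  EllTwo.op_ext fun α => (hS α).unique (hT α)

theorem represented_iff : G.Represented ↔ (∀ a, ∃ T, G.IsRho a T) ∧ ∀ ξ, ∃ T, G.IsPsi ξ T := by
  refine ⟨fun h => ⟨fun a => ⟨_, h.1 a⟩, fun ξ => ⟨_, h.2 ξ⟩⟩, fun h => ⟨fun a => ?_, fun ξ => ?_⟩⟩
  · rw [rho, dif_pos (h.1 a)]
    exact (h.1 a).choose_spec
  · rw [psi, dif_pos (h.2 ξ)]
    exact (h.2 ξ).choose_spec

/-- The inverse isomorphism. -/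
def Iso.symm (θ : Iso G H) : Iso H G where
  onV := θ.onV.symm
  onEdge := θ.onEdge.symm
  r_comm x := by rw [Homeomorph.symm_apply_eq, θ.r_comm, Homeomorph.apply_symm_apply]
  s_comm x := by rw [Homeomorph.symm_apply_eq, θ.s_comm, Homeomorph.apply_symm_apply]

/-- The composition of isomorphisms. -/
def Iso.trans (θ : Iso G H) (η : Iso H K) : Iso G K where
  onV := θ.onV.trans η.onV
  onEdge := θ.onEdge.trans η.onEdge
  r_comm x := by simp [θ.r_comm, η.r_comm]
  s_comm x := by simp [θ.s_comm, η.s_comm]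

theorem Iso.rangeOf_map (θ : Iso G H) (l : List G.Edge) (v : G.V) :
    H.rangeOf (l.map θ.onEdge) (θ.onV v) = θ.onV (G.rangeOf l v) := by
  cases l with
  | nil => rfl
  | cons e l => exact (θ.r_comm e).symm

theorem Iso.isPath_map (θ : Iso G H) (l : List G.Edge) (v : G.V) (h : G.IsPath l v) :
    H.IsPath (l.map θ.onEdge) (θ.onV v) := by
  induction l with
  | nil => trivial
  | cons e l ih =>
    refine ⟨?_, ih h.2⟩
    rw [θ.rangeOf_map, ← h.1, θ.s_comm]

/-- The map of paths induced by an isomorphism of quivers. -/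
def Iso.mapPath (θ : Iso G H) (α : G.toDirGraph.Path) : H.toDirGraph.Path where
  edges := α.edges.map θ.onEdge
  source := θ.onV α.source
  isPath := θ.isPath_map _ _ α.isPath

theorem Iso.mapPath_symm_mapPath (θ : Iso G H) (α : G.toDirGraph.Path) :
    θ.symm.mapPath (θ.mapPath α) = α := by
  obtain ⟨l, v, h⟩ := α
  simp [mapPath, symm]

/-- The bijection of paths induced by an isomorphism of quivers. -/
def Iso.pathEquiv (θ : Iso G H) : G.toDirGraph.Path ≃ H.toDirGraph.Path where
  toFun := θ.mapPath
  invFun := θ.symm.mapPath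
  left_inv := θ.mapPath_symm_mapPath
  right_inv := θ.symm.mapPath_symm_mapPath

theorem Iso.pathEquiv_range (θ : Iso G H) (α : G.toDirGraph.Path) :
    (θ.pathEquiv α).range = θ.onV α.range :=
  θ.rangeOf_map _ _

theorem Iso.isRho_conj (θ : Iso G H) {a : C₀(H.V, ℂ)} {T : BddOp G.Hilb}
    (h : G.IsRho (θ.pullV a) T) : H.IsRho a (conjPerm θ.pathEquiv T) := by
  intro β
  obtain ⟨α, rfl⟩ := θ.pathEquiv.surjective β
  have e : θ.pullV a α.range = a (θ.onV α.range) := rfl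
  simp [conjPerm_apply, h α, e, θ.pathEquiv_range]

theorem Iso.isPsi_conj (θ : Iso G H) {ξ : C_c(H.Edge, ℂ)} {T : BddOp G.Hilb}
    (h : G.IsPsi (θ.pullEdge ξ) T) : H.IsPsi ξ (conjPerm θ.pathEquiv T) := by
  intro β
  obtain ⟨α, rfl⟩ := θ.pathEquiv.surjective β
  have h1 := (h α).mapL (permOp θ.pathEquiv)
  have e1 : conjPerm θ.pathEquiv T (basisVec (θ.pathEquiv α)) =
      permOp θ.pathEquiv (T (basisVec α)) := by simp [conjPerm_apply]
  have hs : ∀ x : G.Edge, G.s x = α.range ↔ H.s (θ.onEdge x) = (θ.pathEquiv α).range := fun x => by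
    rw [θ.pathEquiv_range, ← θ.s_comm, θ.onV.injective.eq_iff]
  rw [e1, ← (θ.onEdge.toEquiv.subtypeEquiv hs).hasSum_iff]
  convert h1 using 1
  funext x
  simp only [map_smul, permOp_basisVec]
  rfl

theorem Iso.represented (θ : Iso G H) (h : H.Represented) : G.Represented := by
  rw [represented_iff] at h ⊢
  refine ⟨fun a => ?_, fun ξ => ?_⟩
  · obtain ⟨T, hT⟩ := h.1 (θ.symm.pullV a)
    exact ⟨_, θ.symm.isRho_conj hT⟩
  · obtain ⟨T, hT⟩ := h.2 (θ.symm.pullEdge ξ)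
    exact ⟨_, θ.symm.isPsi_conj hT⟩

theorem Iso.conj_rho (θ : Iso G H) (h : H.Represented) (a : C₀(H.V, ℂ)) :
    conjPerm θ.pathEquiv (G.rho (θ.pullV a)) = H.rho a :=
  (θ.isRho_conj ((θ.represented h).1 _)).unique (h.1 a)

theorem Iso.conj_psi (θ : Iso G H) (h : H.Represented) (ξ : C_c(H.Edge, ℂ)) :
    conjPerm θ.pathEquiv (G.psi (θ.pullEdge ξ)) = H.psi ξ :=
  (θ.isPsi_conj ((θ.represented h).2 _)).unique (h.2 ξ)

theorem Iso.conj_mem_toeplitz (θ : Iso G H) (h : H.Represented) {T : BddOp G.Hilb}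
    (hT : T ∈ G.Toeplitz) : conjPerm θ.pathEquiv T ∈ H.Toeplitz := by
  have hle : G.Toeplitz ≤ H.Toeplitz.comap (conjPerm θ.pathEquiv) := by
    refine NonUnitalStarSubalgebra.topologicalClosure_minimal _
      (NonUnitalStarAlgebra.adjoin_le ?_) ?_
    · rintro _ (⟨a, rfl⟩ | ⟨ξ, rfl⟩)
      · have e : a = θ.pullV (θ.symm.pullV a) := by
          ext x; exact congrArg a (θ.onV.symm_apply_apply x).symm
        rw [e]
        change conjPerm θ.pathEquiv (G.rho (θ.pullV (θ.symm.pullV a))) ∈ H.Toeplitz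
        rw [θ.conj_rho h]
        exact (H.rhoT (θ.symm.pullV a)).2
      · have e : ξ = θ.pullEdge (θ.symm.pullEdge ξ) := by
          ext x; exact congrArg ξ (θ.onEdge.symm_apply_apply x).symm
        rw [e]
        change conjPerm θ.pathEquiv (G.psi (θ.pullEdge (θ.symm.pullEdge ξ))) ∈ H.Toeplitz
        rw [θ.conj_psi h]
        exact (H.psiT (θ.symm.pullEdge ξ)).2
    · exact (NonUnitalStarSubalgebra.isClosed_topologicalClosure _).preimage
        (continuous_conjPerm θ.pathEquiv)
  exact hle hT

set_option synthInstance.maxHeartbeats 200000 in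
/-- The isomorphism of Toeplitz algebras induced by an isomorphism of quivers, which is
conjugation by the unitary permuting the paths. -/
noncomputable def Iso.toeplitzEquiv (θ : Iso G H) (h : H.Represented) : ToeplitzEquiv G H where
  toFun T := ⟨conjPerm θ.pathEquiv T, θ.conj_mem_toeplitz h T.2⟩
  invFun T := ⟨conjPerm θ.symm.pathEquiv T, θ.symm.conj_mem_toeplitz (θ.represented h) T.2⟩
  left_inv _ := Subtype.ext (conjPerm_symm_conjPerm θ.pathEquiv _)
  right_inv _ := Subtype.ext (conjPerm_symm_conjPerm θ.symm.pathEquiv _)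
  map_mul' S T := Subtype.ext (map_mul (conjPerm θ.pathEquiv) S.1 T.1)
  map_add' S T := Subtype.ext (map_add (conjPerm θ.pathEquiv) S.1 T.1)
  map_star' T := Subtype.ext (map_star (conjPerm θ.pathEquiv) T.1)
  map_smul' c T := Subtype.ext (map_smul (conjPerm θ.pathEquiv) c T.1)

theorem Iso.toeplitzEquiv_carries (θ : Iso G H) (h : H.Represented) :
    (θ.toeplitzEquiv h).Carries θ :=
  ⟨fun a => Subtype.ext (θ.conj_rho h a), fun ξ => Subtype.ext (θ.conj_psi h ξ)⟩

/-! ### The kernels of the quotient maps -/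

variable {ι : Type v} {κ : Type w}

theorem quotMap_eq_zero_iff (p : G.V → ι) (x : G.Toeplitz) :
    G.quotMap p x = 0 ↔ ∀ i, IsCompactOperator (restrictOp (G.fibre p i) x.1) := by
  rw [← Subtype.val_inj]
  change G.calkinRep p x = 0 ↔ _
  rw [funext_iff]
  exact forall_congr' fun i => toCalkin_eq_zero_iff _

theorem quotMap_surjective (p : G.V → ι) : Function.Surjective (G.quotMap p) := by
  rintro ⟨_, x, rfl⟩
  exact ⟨x, rfl⟩

set_option synthInstance.maxHeartbeats 200000 in
/-- An isomorphism of Toeplitz algebras descends to the Cuntz--Krieger algebras as soon as it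
matches the kernels of the two quotient maps. -/
theorem ToeplitzEquiv.descends_of_ker (Φ : ToeplitzEquiv G H) {p : G.V → ι} {q : H.V → κ}
    (h : ∀ x, G.quotMap p x = 0 ↔ H.quotMap q (Φ x) = 0) : Φ.Descends p q :=
  exists_starAlgEquiv_of_ker_eq (G.quotMap p)
    ((H.quotMap q).comp
      { toFun := Φ
        map_smul' := map_smul Φ
        map_zero' := map_zero Φ
        map_add' := map_add Φ
        map_mul' := map_mul Φ
        map_star' := map_star Φ }) (quotMap_surjective p)
    ((quotMap_surjective q).comp Φ.surjective) h

theorem Iso.quotMap_toeplitzEquiv_eq_zero_iff (θ : Iso G H) (h : H.Represented) {p : G.V → ι}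
    {q : H.V → κ} (σ : ι ≃ κ) (hσ : ∀ v, q (θ.onV v) = σ (p v)) (x : G.Toeplitz) :
    H.quotMap q (θ.toeplitzEquiv h x) = 0 ↔ G.quotMap p x = 0 := by
  rw [quotMap_eq_zero_iff, quotMap_eq_zero_iff, ← σ.forall_congr_right]
  refine forall_congr' fun i => isCompactOperator_restrictOp_conjPerm θ.pathEquiv ?_ x.1
  intro α
  change p α.source = i ↔ q (θ.onV α.source) = σ i
  rw [hσ, σ.injective.eq_iff]

theorem Iso.toeplitzEquiv_descends (θ : Iso G H) (h : H.Represented) {p : G.V → ι}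
    {q : H.V → κ} (σ : ι ≃ κ) (hσ : ∀ v, q (θ.onV v) = σ (p v)) :
    (θ.toeplitzEquiv h).Descends p q :=
  ToeplitzEquiv.descends_of_ker _ fun x =>
    (θ.quotMap_toeplitzEquiv_eq_zero_iff h σ hσ x).symm

/-- If the fibres of `p` are finite, then the part of an element of the Toeplitz algebra on
`ℓ²(G*_i)` is a finite direct sum of parts on the spaces `ℓ²(G* ω)`. -/
theorem quotMap_id_eq_zero_iff (p : G.V → ι) (hp : ∀ i, {v | p v = i}.Finite) (x : G.Toeplitz) :
    G.quotMap id x = 0 ↔ G.quotMap p x = 0 := by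
  classical
  rw [quotMap_eq_zero_iff, quotMap_eq_zero_iff]
  constructor
  · intro h i
    rw [isCompactOperator_restrictOp_iff]
    have hsum : projOp (G.fibre p i) = ∑ v ∈ (hp i).toFinset, projOp (G.fibre id v) := by
      refine EllTwo.op_ext fun α => ?_
      rw [sum_apply]
      simp only [projOp_basisVec]
      have e : ∀ v : G.V, (α ∈ G.fibre id v) = (α.source = v) := fun v => rfl
      simp only [e, Finset.sum_ite_eq, Set.Finite.mem_toFinset]
      rfl
    have hcomm := G.projOp_commute p i x.1 x.2
    rw [hcomm, mul_assoc, projOp_mul_projOp_of_subset subset_rfl, hsum, Finset.mul_sum]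
    have hc : ∀ v, IsCompactOperator (x.1 * projOp (G.fibre id v)) := by
      intro v
      have hv := (isCompactOperator_restrictOp_iff _ _).1 (h v)
      rwa [G.projOp_commute id v x.1 x.2, mul_assoc,
        projOp_mul_projOp_of_subset subset_rfl] at hv
    exact (compactIdeal G.Hilb).sum_mem fun v _ => hc v
  · intro h v
    rw [isCompactOperator_restrictOp_iff]
    have hv := (isCompactOperator_restrictOp_iff _ _).1 (h (p v))
    have hle : projOp (G.fibre p (p v)) * projOp (G.fibre id v) = projOp (G.fibre id v) :=
      projOp_mul_projOp_of_subset fun _ hα => congrArg p hα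
    have hle' : projOp (G.fibre id v) * projOp (G.fibre p (p v)) = projOp (G.fibre id v) := by
      have := congrArg star hle
      rwa [star_mul, star_projOp, star_projOp] at this
    have e : projOp (G.fibre id v) * x.1 * projOp (G.fibre id v) =
        projOp (G.fibre id v) * (projOp (G.fibre p (p v)) * x.1 * projOp (G.fibre p (p v))) *
          projOp (G.fibre id v) := by
      simp only [mul_assoc, hle]
      rw [← mul_assoc (projOp (G.fibre id v)) (projOp (G.fibre p (p v))), hle']
    rw [e]
    exact (hv.comp_clm (projOp (G.fibre id v))).clm_comp (projOp (G.fibre id v))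

/-- For an isomorphism that matches the kernel of `quotMap p` with that of `quotMap id`, finiteness
of the fibres of `q` allows `id` to be replaced by `q`. -/
theorem ToeplitzEquiv.Descends.of_finite_fibres {Φ : ToeplitzEquiv G H} {p : G.V → ι}
    (h : ∀ x, G.quotMap p x = 0 ↔ H.quotMap id (Φ x) = 0) {q : H.V → κ}
    (hq : ∀ i, {v | q v = i}.Finite) : Φ.Descends p q :=
  Φ.descends_of_ker fun x => (h x).trans (quotMap_id_eq_zero_iff q hq _)

end TopQuiver

/-! ### Existence of the operators `ρ(a)` and `ψ(ξ)` -/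

theorem basisVec_apply {X : Type w} [DecidableEq X] (x y : X) :
    (basisVec x : EllTwo X) y = if y = x then 1 else 0 := by
  have h : (basisVec x : EllTwo X) = lp.single 2 x (1 : ℂ) := by
    unfold basisVec; congr!
  rw [h, lp.single_apply, Pi.single_apply]

theorem hasSum_smul_basisVec {X : Type w} (f : EllTwo X) :
    HasSum (fun x => f x • basisVec x) f := by
  classical
  convert lp.hasSum_single (p := 2) (by simp) f using 2 with x
  unfold basisVec
  rw [← lp.single_smul, smul_eq_mul, mul_one]

theorem sum_norm_sq_le_norm_sq {X : Type w} (f : EllTwo X) (s : Finset X) :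
    ∑ x ∈ s, ‖f x‖ ^ 2 ≤ ‖f‖ ^ 2 := by
  have h := lp.sum_rpow_le_norm_rpow (p := 2) (by norm_num) f s
  simpa using h

/-- A weighted composition operator `g ↦ c · (g ∘ π)` is bounded on `ℓ²` if the weight `c` is
bounded and is nonzero at no more than `N` points of each fibre of `π`. -/
theorem exists_weightedComp {X : Type v} {Y : Type w} (π : Y → X) (c : Y → ℂ) (N : ℕ) (M : ℝ)
    (hM : ∀ y, ‖c y‖ ≤ M)
    (hN : ∀ x, ∃ F : Finset Y, F.card ≤ N ∧ ∀ y, π y = x → c y ≠ 0 → y ∈ F) :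
    ∃ T : EllTwo X →L[ℂ] EllTwo Y, ∀ g y, T g y = c y * g (π y) := by
  classical
  have key : ∀ (g : EllTwo X) (s : Finset Y),
      ∑ y ∈ s, ‖c y * g (π y)‖ ^ 2 ≤ N * M ^ 2 * ‖g‖ ^ 2 := by
    intro g s
    have h1 : ∀ x ∈ s.image π, ∑ y ∈ s with π y = x, ‖c y * g (π y)‖ ^ 2 ≤
        N * M ^ 2 * ‖g x‖ ^ 2 := by
      intro x _
      obtain ⟨F, hF, hF'⟩ := hN x
      calc ∑ y ∈ s with π y = x, ‖c y * g (π y)‖ ^ 2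
          = ∑ y ∈ {y ∈ s | π y = x} with c y ≠ 0, ‖c y * g (π y)‖ ^ 2 := by
            refine (Finset.sum_filter_of_ne (p := fun y => c y ≠ 0) fun y _ hy hc => hy ?_).symm
            simp [hc]
        _ ≤ ∑ y ∈ {y ∈ s | π y = x} with c y ≠ 0, M ^ 2 * ‖g x‖ ^ 2 := by
            refine Finset.sum_le_sum fun y hy => ?_
            simp only [Finset.mem_filter] at hy
            rw [norm_mul, mul_pow, hy.1.2]
            gcongr
            exact hM y
        _ = ((({y ∈ s | π y = x} : Finset Y).filter (fun y => c y ≠ 0)).card : ℝ) *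
              (M ^ 2 * ‖g x‖ ^ 2) := by rw [Finset.sum_const, nsmul_eq_mul]
        _ ≤ N * (M ^ 2 * ‖g x‖ ^ 2) := by
            gcongr
            refine (Finset.card_le_card fun y hy => ?_).trans hF
            simp only [Finset.mem_filter] at hy
            exact hF' y hy.1.2 hy.2
        _ = _ := by ring
    calc ∑ y ∈ s, ‖c y * g (π y)‖ ^ 2
        = ∑ x ∈ s.image π, ∑ y ∈ s with π y = x, ‖c y * g (π y)‖ ^ 2 :=
          (Finset.sum_fiberwise_of_maps_to (fun y hy => Finset.mem_image_of_mem π hy) _).symm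
      _ ≤ ∑ x ∈ s.image π, N * M ^ 2 * ‖g x‖ ^ 2 := Finset.sum_le_sum h1
      _ = N * M ^ 2 * ∑ x ∈ s.image π, ‖g x‖ ^ 2 := by rw [Finset.mul_sum]
      _ ≤ _ := by
          gcongr
          exact sum_norm_sq_le_norm_sq g _
  have hmem : ∀ g : EllTwo X, Memℓp (fun y => c y * g (π y)) 2 := fun g =>
    memℓp_gen' (C := N * M ^ 2 * ‖g‖ ^ 2) fun s => by simpa using key g s
  let T : EllTwo X →ₗ[ℂ] EllTwo Y :=
    { toFun := fun g => ⟨_, hmem g⟩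
      map_add' := fun g g' => by
        ext y
        change c y * (g (π y) + g' (π y)) = c y * g (π y) + c y * g' (π y)
        ring
      map_smul' := fun a g => by
        ext y
        change c y * (a * g (π y)) = a * (c y * g (π y))
        ring }
  refine ⟨T.mkContinuous (Real.sqrt (N * M ^ 2)) fun g => ?_, fun g y => rfl⟩
  refine lp.norm_le_of_forall_sum_le (p := 2) (by norm_num) (by positivity) fun s => ?_
  have e : (Real.sqrt (N * M ^ 2) * ‖g‖) ^ (2 : ENNReal).toReal = N * M ^ 2 * ‖g‖ ^ 2 := by
    rw [ENNReal.toReal_ofNat, Real.rpow_two, mul_pow, Real.sq_sqrt (by positivity)]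
  rw [e]
  simp only [ENNReal.toReal_ofNat, Real.rpow_two]
  exact key g s

namespace DirGraph

variable {E : DirGraph.{u}}

/-- The path without its first edge. -/
def Path.tail (α : E.Path) : E.Path where
  edges := α.edges.tail
  source := α.source
  isPath := by
    obtain ⟨_ | ⟨e, l⟩, v, h⟩ := α
    · trivial
    · exact h.2

/-- The weight of the first edge of a path; vertices have weight zero. -/
def Path.headWeight (ξ : E.Edge → ℂ) (α : E.Path) : ℂ := α.edges.head?.elim 0 ξ

theorem Path.exists_eq_cons {ξ : E.Edge → ℂ} {α : E.Path} (h : α.headWeight ξ ≠ 0) :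
    ∃ (β : E.Edge) (hβ : E.s β = α.tail.range), α = Path.cons β α.tail hβ ∧ ξ β ≠ 0 := by
  obtain ⟨_ | ⟨e, l⟩, v, hp⟩ := α
  · exact absurd rfl h
  · exact ⟨e, hp.1, rfl, h⟩

end DirGraph

namespace TopQuiver

variable {G : TopQuiver.{u}}

open DirGraph

theorem exists_isRho (a : C₀(G.V, ℂ)) : ∃ T, G.IsRho a T := by
  classical
  obtain ⟨T, hT⟩ := exists_weightedComp (id : G.toDirGraph.Path → G.toDirGraph.Path)
    (fun α => a α.range) 1 ‖a.toBCF‖ (fun α => a.toBCF.norm_coe_le_norm _)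
    (fun α => ⟨{α}, by simp, by simp⟩)
  refine ⟨T, fun α => ?_⟩
  ext β
  rw [hT]
  change _ = a α.range * _
  rw [id, basisVec_apply]
  split_ifs with h
  · rw [h]
  · simp

/-- A continuous compactly supported `ξ` acts by a bounded operator if every compact set of
edges contains, for some `N`, at most `N` edges with any given source. -/
theorem represented_of_compact
    (h : ∀ K : Set G.Edge, IsCompact K → ∃ N : ℕ, ∀ v : G.V, ∃ F : Finset G.Edge,
      F.card ≤ N ∧ ∀ β ∈ K, G.s β = v → β ∈ F) : G.Represented := by
  classical
  refine represented_iff.2 ⟨exists_isRho, fun ξ => ?_⟩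
  obtain ⟨N, hN⟩ := h (tsupport ξ) ξ.hasCompactSupport
  obtain ⟨M, hM⟩ := ξ.hasCompactSupport.exists_bound_of_continuous ξ.continuous
  have hbound : ∀ α : G.toDirGraph.Path, ‖α.headWeight ξ‖ ≤ max M 0 := by
    rintro ⟨_ | ⟨e, l⟩, v, hp⟩
    · exact (norm_zero (E := ℂ)).le.trans (le_max_right _ _)
    · exact (hM e).trans (le_max_left _ _)
  have hcount : ∀ α : G.toDirGraph.Path, ∃ F : Finset G.toDirGraph.Path, F.card ≤ N ∧
      ∀ γ, γ.tail = α → γ.headWeight ξ ≠ 0 → γ ∈ F := by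
    intro α
    obtain ⟨F, hF, hF'⟩ := hN α.range
    refine ⟨F.image fun β => if hβ : G.s β = α.range then Path.cons β α hβ else α,
      Finset.card_image_le.trans hF, ?_⟩
    rintro γ rfl h0
    obtain ⟨β, hβ, he, hξ⟩ := Path.exists_eq_cons h0
    refine Finset.mem_image.2 ⟨β, hF' β (subset_tsupport _ hξ) hβ, ?_⟩
    rw [dif_pos hβ]
    exact he.symm
  obtain ⟨T, hT⟩ := exists_weightedComp (Path.tail (E := G.toDirGraph)) (Path.headWeight ξ)
    N (max M 0) hbound hcount
  refine ⟨T, fun α => ?_⟩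
  let j : {β : G.Edge // G.s β = α.range} → G.toDirGraph.Path := fun β => Path.cons β.1 α β.2
  have hj : Function.Injective j := fun β β' hβ =>
    Subtype.ext (List.head_eq_of_cons_eq (congrArg Path.edges hβ))
  have h1 := hasSum_smul_basisVec (T (basisVec α))
  rw [← hj.hasSum_iff] at h1
  · convert h1 using 2 with β
    have e1 : (j β).tail = α := rfl
    have e2 : (j β).headWeight ξ = ξ β.1 := rfl
    rw [Function.comp_apply, hT, e1, e2, basisVec_apply, if_pos rfl, mul_one]
  · intro γ hγ
    rw [hT, basisVec_apply]
    split_ifs with hγ'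
    · by_cases h0 : γ.headWeight ξ = 0
      · simp [h0]
      · obtain ⟨β, hβ, he, _⟩ := Path.exists_eq_cons h0
        subst hγ'
        exact absurd ⟨⟨β, hβ⟩, he.symm⟩ hγ
    · simp

end TopQuiver

/-! ### The suspension as a cell complex -/

namespace DirGraph

variable {G : DirGraph.{u}}

theorem SuspV.mk_zero (e : G.Edge) : SuspV.mk e 0 = SuspV.ofVertex (G.r e) :=
  Quot.sound (SuspVRel.zero e)

theorem SuspV.mk_one (e : G.Edge) : SuspV.mk e 1 = SuspV.ofVertex (G.s e) :=
  Quot.sound (SuspVRel.one e)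

theorem SuspV.continuous_mk (e : G.Edge) : Continuous (SuspV.mk e : unitInterval → G.SuspV) :=
  let _ : TopologicalSpace G.V := ⊥
  (continuous_quot_mk (r := G.SuspVRel)).comp (continuous_inl.comp continuous_sigmaMk)

theorem SuspV.exists_rep (x : G.SuspV) :
    (∃ e t, x = SuspV.mk e t) ∨ ∃ v, x = SuspV.ofVertex v := by
  obtain ⟨⟨e, t⟩ | v⟩ := x
  · exact Or.inl ⟨e, t, rfl⟩
  · exact Or.inr ⟨v, rfl⟩

open Classical in
/-- The normal form of a point of the suspension: either an interior point of a unique edge,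
or a unique vertex. -/
noncomputable def SuspV.normalForm : G.SuspV → (G.Edge × unitInterval) ⊕ G.V :=
  Quot.lift
    (Sum.elim (fun x => if x.2 = 0 then Sum.inr (G.r x.1) else
      if x.2 = 1 then Sum.inr (G.s x.1) else Sum.inl (x.1, x.2)) Sum.inr)
    (by
      rintro _ _ (f | e) <;> simp)

theorem SuspV.ofVertex_injective :
    Function.Injective (SuspV.ofVertex : G.V → G.SuspV) := fun _ _ h =>
  Sum.inr_injective (congrArg SuspV.normalForm h)

theorem SuspV.normalForm_mk (e : G.Edge) {t : unitInterval} (h0 : t ≠ 0) (h1 : t ≠ 1) :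
    (SuspV.mk e t).normalForm = Sum.inl (e, t) := by
  change (if t = 0 then _ else if t = 1 then _ else _) = _
  rw [if_neg h0, if_neg h1]

/-- The open star of the vertex `v` in the suspension. -/
def SuspV.star (v : G.V) : Set G.SuspV :=
  {x | Quot.lift (Sum.elim (fun x => (G.r x.1 = v ∧ x.2 < 1) ∨ (G.s x.1 = v ∧ 0 < x.2))
    (fun w => w = v)) (by rintro _ _ (f | e) <;> simp) x}

theorem SuspV.isOpen_star (v : G.V) : IsOpen (SuspV.star v : Set G.SuspV) := by
  let _ : TopologicalSpace G.V := ⊥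
  have : DiscreteTopology G.V := ⟨rfl⟩
  have hq : Topology.IsQuotientMap (Quot.mk G.SuspVRel) := isQuotientMap_quot_mk
  have : IsOpen ((Quot.mk G.SuspVRel) ⁻¹' (SuspV.star v)) := by
    rw [isOpen_sum_iff, isOpen_sigma_iff]
    refine ⟨fun e => ?_, isOpen_discrete _⟩
    change IsOpen {t : unitInterval | (G.r e = v ∧ t < 1) ∨ (G.s e = v ∧ 0 < t)}
    exact (isOpen_const.inter isOpen_Iio).union (isOpen_const.inter isOpen_Ioi)
  exact hq.isOpen_preimage.1 this

/-- If `G` is locally finite, then a compact subset of the suspension is covered by finitely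
many cells. -/
theorem SuspV.exists_finset_of_isCompact (hG : G.LocallyFinite) {K : Set G.SuspV}
    (hK : IsCompact K) : ∃ (Z : Finset G.V) (P : Finset G.Edge), ∀ x ∈ K,
      (∃ v ∈ Z, x = SuspV.ofVertex v) ∨ ∃ e ∈ P, ∃ t, x = SuspV.mk e t := by
  classical
  obtain ⟨Z, hZ⟩ := hK.elim_finite_subcover SuspV.star SuspV.isOpen_star (fun x _ => by
    rw [Set.mem_iUnion]
    obtain ⟨e, t, rfl⟩ | ⟨v, rfl⟩ := SuspV.exists_rep x
    · by_cases ht : t < 1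
      · exact ⟨G.r e, Or.inl ⟨rfl, ht⟩⟩
      · exact ⟨G.s e, Or.inr ⟨rfl, lt_of_lt_of_le zero_lt_one (not_lt.1 ht)⟩⟩
    · exact ⟨v, rfl⟩)
  refine ⟨Z, Z.biUnion fun v => (hG v).1.toFinset ∪ (hG v).2.toFinset, fun x hx => ?_⟩
  obtain ⟨v, hv, hxv⟩ := Set.mem_iUnion₂.1 (hZ hx)
  obtain ⟨e, t, rfl⟩ | ⟨w, rfl⟩ := SuspV.exists_rep x
  · refine Or.inr ⟨e, Finset.mem_biUnion.2 ⟨v, hv, ?_⟩, t, rfl⟩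
    rcases hxv with h | h
    · simp [h.1]
    · simp [h.1]
  · refine Or.inl ⟨w, ?_, rfl⟩
    have hw : w = v := hxv
    exact hw ▸ hv

/-! ### Walks in the suspension -/

theorem fract_mem_unitInterval (t : ℝ) : Int.fract t ∈ unitInterval :=
  ⟨Int.fract_nonneg t, (Int.fract_lt_one t).le⟩

theorem fract_eq_of_coe_eq {x y : ℝ} (h : (x : UnitAddCircle) = y) :
    Int.fract x = Int.fract y := by
  have h3 : ((x - y : ℝ) : UnitAddCircle) = 0 := by
    rw [AddCircle.coe_sub, h, sub_self]
  obtain ⟨k, hk⟩ := (AddCircle.coe_eq_zero_iff 1).1 h3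
  exact Int.fract_eq_fract.2 ⟨k, by rw [← hk]; simp⟩

theorem floor_lt_of_fract_ne_zero {n : ℕ} {t : ℝ} (h0 : 0 ≤ t) (hn : t ≤ n)
    (h : Int.fract t ≠ 0) : ⌊t⌋₊ < n := by
  refine lt_of_le_of_ne (Nat.floor_le_of_le hn) fun he => h ?_
  have ht : t = n := le_antisymm hn (he ▸ Nat.floor_le h0)
  rw [ht, Int.fract_natCast]

theorem floor_lt_succ {n : ℕ} {t : ℝ} (hn : t ≤ n) : ⌊t⌋₊ < n + 1 :=
  Nat.lt_succ_of_le (Nat.floor_le_of_le hn)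

/-- The point reached at time `t ∈ [0, n]` by traversing edges `c 0, …, c (n - 1)` of `G` at
unit speed in the suspension, where `z` lists the vertices that are met. -/
noncomputable def walkPt (n : ℕ) (c : Fin n → G.Edge) (z : Fin (n + 1) → G.V) (t : ℝ) : G.SuspV :=
  if h : ⌊t⌋₊ < n then SuspV.mk (c ⟨⌊t⌋₊, h⟩) ⟨Int.fract t, fract_mem_unitInterval t⟩
  else SuspV.ofVertex (z (Fin.last n))

variable {n : ℕ} {c : Fin n → G.Edge} {z : Fin (n + 1) → G.V}

theorem walkPt_of_floor_lt {t : ℝ} (h : ⌊t⌋₊ < n) :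
    walkPt n c z t = SuspV.mk (c ⟨⌊t⌋₊, h⟩) ⟨Int.fract t, fract_mem_unitInterval t⟩ :=
  dif_pos h

theorem walkPt_of_fract_ne_zero {t : ℝ} (h0 : 0 ≤ t) (hn : t ≤ n) (h : Int.fract t ≠ 0) :
    walkPt n c z t = SuspV.mk (c ⟨⌊t⌋₊, floor_lt_of_fract_ne_zero h0 hn h⟩)
      ⟨Int.fract t, fract_mem_unitInterval t⟩ :=
  walkPt_of_floor_lt _

theorem walkPt_of_fract_eq_zero (hr : ∀ k, G.r (c k) = z k.castSucc) {t : ℝ}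
    (hn : t ≤ n) (h : Int.fract t = 0) :
    walkPt n c z t = SuspV.ofVertex (z ⟨⌊t⌋₊, floor_lt_succ hn⟩) := by
  unfold walkPt
  split_ifs with hlt
  · have e : (⟨Int.fract t, fract_mem_unitInterval t⟩ : unitInterval) = 0 := Subtype.ext h
    rw [e, SuspV.mk_zero, hr]
    rfl
  · congr 2
    exact Fin.ext (le_antisymm (not_lt.1 hlt) (Nat.floor_le_of_le hn))

theorem continuousOn_walkPt (hr : ∀ k, G.r (c k) = z k.castSucc)
    (hs : ∀ k, G.s (c k) = z k.succ) : ContinuousOn (walkPt n c z) (Set.Icc 0 n) := by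
  suffices h : ∀ m : ℕ, m ≤ n → ContinuousOn (walkPt n c z) (Set.Icc 0 m) from h n le_rfl
  intro m
  induction m with
  | zero =>
    intro _
    simp
  | succ m ih =>
    intro hm
    have hu : Set.Icc (0 : ℝ) ((m + 1 : ℕ) : ℝ) = Set.Icc 0 (m : ℝ) ∪ Set.Icc (m : ℝ) (m + 1) := by
      rw [Set.Icc_union_Icc_eq_Icc (by positivity) (by linarith)]
      push_cast
      rfl
    rw [hu]
    refine (ih (by omega)).union_of_isClosed ?_ isClosed_Icc isClosed_Icc
    have hcont : Continuous fun t : ℝ =>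
        SuspV.mk (c ⟨m, hm⟩) (Set.projIcc (0 : ℝ) 1 zero_le_one (t - m)) :=
      (SuspV.continuous_mk _).comp (continuous_projIcc.comp (by fun_prop))
    refine hcont.continuousOn.congr fun t ht => ?_
    obtain ⟨h1, h2⟩ := ht
    have h0 : 0 ≤ t := le_trans (by positivity) h1
    rcases h2.lt_or_eq with h2 | h2
    · have hf : ⌊t⌋₊ = m := (Nat.floor_eq_iff h0).2 ⟨h1, h2⟩
      have hlt : ⌊t⌋₊ < n := by omega
      rw [walkPt, dif_pos hlt]
      have e : Int.fract t = t - m := by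
        rw [← hf, natCast_floor_eq_intCast_floor h0]; rfl
      congr 1
      · congr 1; exact Fin.ext hf
      · rw [Set.projIcc_of_mem _ ⟨by linarith, by linarith⟩]
        exact Subtype.ext e
    · have hmn : t ≤ n := by
        rw [h2]; exact_mod_cast hm
      have hf : ⌊t⌋₊ = m + 1 := by
        rw [h2]; exact_mod_cast Nat.floor_natCast (m + 1)
      rw [walkPt_of_fract_eq_zero hr hmn (by rw [h2]; exact_mod_cast Int.fract_natCast (m + 1))]
      have e : Set.projIcc (0 : ℝ) 1 zero_le_one (t - m) = 1 :=
        Set.projIcc_of_right_le _ (by linarith)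
      beta_reduce
      rw [e, SuspV.mk_one, hs]
      congr 2
      exact Fin.ext hf

/-- During the first unit of time the first edge is traversed. -/
theorem walkPt_of_mem_unitInterval (hr : ∀ k, G.r (c k) = z k.castSucc)
    (hs : ∀ k, G.s (c k) = z k.succ) (hn : 0 < n) (t : unitInterval) :
    walkPt n c z t = SuspV.mk (c ⟨0, hn⟩) t := by
  rcases t.2.2.lt_or_eq with ht | ht
  · have hf : ⌊(t : ℝ)⌋₊ = 0 := Nat.floor_eq_zero.2 ht
    rw [walkPt_of_floor_lt (hf.trans_lt hn)]
    congr 1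
    · exact congrArg c (Fin.ext hf)
    · exact Subtype.ext (Int.fract_eq_self.2 ⟨t.2.1, ht⟩)
  · obtain rfl : t = 1 := Subtype.ext ht
    have h1 : ((1 : unitInterval) : ℝ) ≤ n := Nat.one_le_cast.2 hn
    rw [walkPt_of_fract_eq_zero hr h1 Int.fract_one, SuspV.mk_one, hs]
    exact congrArg (fun k => SuspV.ofVertex (z k)) (Fin.ext Nat.floor_one)

theorem toCircle_walkPt (hr : ∀ k, G.r (c k) = z k.castSucc) {t : ℝ} (h0 : 0 ≤ t)
    (hn : t ≤ n) : (walkPt n c z t).toCircle = (t : UnitAddCircle) := by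
  have hfl : ((⌊t⌋ : ℝ) : UnitAddCircle) = 0 := (AddCircle.coe_eq_zero_iff 1).2 ⟨⌊t⌋, by simp⟩
  have ht : (t : UnitAddCircle) = (Int.fract t : ℝ) := by
    conv_lhs => rw [← Int.fract_add_floor t, AddCircle.coe_add, hfl, add_zero]
  by_cases h : Int.fract t = 0
  · rw [walkPt_of_fract_eq_zero hr hn h, ht, h]
    rfl
  · rw [walkPt_of_fract_ne_zero h0 hn h, ht]
    rfl

/-- Two walks are at the same point if and only if they are at the same vertex, or at the same
position on the same edge. -/
theorem walkPt_eq_iff {n' : ℕ} {c' : Fin n' → G.Edge} {z' : Fin (n' + 1) → G.V}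
    (hr : ∀ k, G.r (c k) = z k.castSucc) (hr' : ∀ k, G.r (c' k) = z' k.castSucc) {t t' : ℝ}
    (h0 : 0 ≤ t) (hn : t ≤ n) (h0' : 0 ≤ t') (hn' : t' ≤ n') :
    walkPt n c z t = walkPt n' c' z' t' ↔ Int.fract t = Int.fract t' ∧
      (Int.fract t = 0 → z ⟨⌊t⌋₊, floor_lt_succ hn⟩ = z' ⟨⌊t'⌋₊, floor_lt_succ hn'⟩) ∧
      ∀ (h : Int.fract t ≠ 0) (h' : Int.fract t' ≠ 0),
        c ⟨⌊t⌋₊, floor_lt_of_fract_ne_zero h0 hn h⟩ =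
          c' ⟨⌊t'⌋₊, floor_lt_of_fract_ne_zero h0' hn' h'⟩ := by
  have hne : ∀ s : ℝ, Int.fract s ≠ 0 →
      (⟨Int.fract s, fract_mem_unitInterval s⟩ : unitInterval) ≠ 0 ∧
      (⟨Int.fract s, fract_mem_unitInterval s⟩ : unitInterval) ≠ 1 := fun s hs =>
    ⟨fun h => hs (congrArg Subtype.val h),
      fun h => (Int.fract_lt_one s).ne (congrArg Subtype.val h)⟩
  by_cases h : Int.fract t = 0 <;> by_cases h' : Int.fract t' = 0
  · rw [walkPt_of_fract_eq_zero hr hn h, walkPt_of_fract_eq_zero hr' hn' h',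
      SuspV.ofVertex_injective.eq_iff]
    simp [h, h']
  · rw [walkPt_of_fract_eq_zero hr hn h, walkPt_of_fract_ne_zero h0' hn' h']
    refine ⟨fun e => ?_, fun e => absurd (e.1.symm.trans h) h'⟩
    have := congrArg SuspV.normalForm e
    rw [SuspV.normalForm_mk _ (hne t' h').1 (hne t' h').2] at this
    exact absurd this Sum.inr_ne_inl
  · rw [walkPt_of_fract_ne_zero h0 hn h, walkPt_of_fract_eq_zero hr' hn' h']
    refine ⟨fun e => ?_, fun e => absurd (e.1.trans h') h⟩
    have := congrArg SuspV.normalForm e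
    rw [SuspV.normalForm_mk _ (hne t h).1 (hne t h).2] at this
    exact absurd this Sum.inl_ne_inr
  · rw [walkPt_of_fract_ne_zero h0 hn h, walkPt_of_fract_ne_zero h0' hn' h']
    constructor
    · intro e
      have := congrArg SuspV.normalForm e
      rw [SuspV.normalForm_mk _ (hne t h).1 (hne t h).2,
        SuspV.normalForm_mk _ (hne t' h').1 (hne t' h').2] at this
      have := Sum.inl_injective this
      exact ⟨congrArg (fun p => (p.2 : ℝ)) this, fun h2 => absurd h2 h,
        fun _ _ => congrArg Prod.fst this⟩
    · rintro ⟨e1, -, e2⟩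
      rw [e2 h h']
      congr 1
      exact Subtype.ext e1

end DirGraph

/-- A quotient map identifies its target with the quotient by any setoid that has the same
classes. -/
theorem exists_homeomorph_of_isQuotientMap {X : Type u} {Y : Type v} [TopologicalSpace X]
    [TopologicalSpace Y] (s : Setoid X) (f : X → Y) (hf : Topology.IsQuotientMap f)
    (h : ∀ x y, s x y ↔ f x = f y) :
    ∃ e : Quotient s ≃ₜ Y, ∀ x, e (Quotient.mk s x) = f x := by
  obtain rfl : s = Setoid.ker f := Setoid.ext h
  exact ⟨Topology.IsQuotientMap.homeomorph (f := ⟨f, hf.continuous⟩) hf, fun _ => rfl⟩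

/-! ### Paths, line graphs and fractional powers -/

namespace DirGraph

variable {E : DirGraph.{u}}

/-- The `k`-th edge of a path. -/
def Path.edgeAt (μ : E.Path) (k : Fin μ.length) : E.Edge := μ.edges[k.1]'k.2

theorem Path.vertexAt_eq_range (μ : E.Path) (k : Fin μ.length) :
    μ.vertexAt k = E.r (μ.edgeAt k) := by
  unfold vertexAt edgeAt
  rw [List.drop_eq_getElem_cons k.2]
  rfl

theorem IsPath.source_getElem {l : List E.Edge} {v : E.V} (h : E.IsPath l v) (k : ℕ)
    (hk : k < l.length) : E.s l[k] = E.rangeOf (l.drop (k + 1)) v := by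
  induction l generalizing k with
  | nil => exact absurd hk (Nat.not_lt_zero k)
  | cons e l ih =>
    cases k with
    | zero => exact h.1
    | succ k => exact ih h.2 k (Nat.lt_of_succ_lt_succ hk)

theorem Path.source_edgeAt (μ : E.Path) (k : Fin μ.length) :
    E.s (μ.edgeAt k) = μ.vertexAt (k + 1) :=
  μ.isPath.source_getElem k k.2

theorem Path.seg_self (μ : E.Path) (k : ℕ) : μ.seg k k = ([], μ.vertexAt k) := by
  simp [seg]

theorem Path.seg_succ (μ : E.Path) (k : Fin μ.length) :
    μ.seg k (k + 1) = ([μ.edgeAt k], E.s (μ.edgeAt k)) := by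
  unfold seg
  rw [List.drop_eq_getElem_cons k.2, source_edgeAt, Nat.add_sub_cancel_left]
  rfl

theorem Path.seg_succ_succ (μ : E.Path) (k : ℕ) (hk : k + 1 < μ.length) :
    μ.seg k (k + 2) = ([μ.edgeAt ⟨k, by omega⟩, μ.edgeAt ⟨k + 1, hk⟩],
      E.s (μ.edgeAt ⟨k + 1, hk⟩)) := by
  have h1 : k < μ.edges.length := lt_trans (Nat.lt_succ_self k) hk
  have h2 : k + 1 < μ.edges.length := hk
  unfold seg
  rw [List.drop_eq_getElem_cons h1, List.drop_eq_getElem_cons h2, source_edgeAt,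
    Nat.add_sub_cancel_left]
  rfl

variable (E) in
/-- The line graph: its vertices are the edges of `E`, and its edges are the paths `ef` of
length two, with `r(ef) = e` and `s(ef) = f`. -/
def lineGraph : DirGraph.{u} where
  V := E.Edge
  Edge := E.TwoPath
  r p := p.1.1
  s p := p.1.2

theorem LocallyFinite.lineGraph (h : E.LocallyFinite) : E.lineGraph.LocallyFinite := by
  intro e
  refine ⟨?_, ?_⟩
  · refine Set.Finite.of_finite_image (f := fun p : E.TwoPath => p.1.1)
      ((h (E.r e)).1.subset ?_) ?_
    · rintro _ ⟨p, rfl, rfl⟩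
      exact p.2
    · rintro p hp q hq hpq
      exact Subtype.ext (Prod.ext hpq (hp.trans hq.symm))
  · refine Set.Finite.of_finite_image (f := fun p : E.TwoPath => p.1.2)
      ((h (E.s e)).2.subset ?_) ?_
    · rintro _ ⟨p, rfl, rfl⟩
      exact p.2.symm
    · rintro p hp q hq hpq
      exact Subtype.ext (Prod.ext (hp.trans hq.symm) hpq)

theorem LocallyFinite.op (h : E.LocallyFinite) : E.op.LocallyFinite :=
  fun v => ⟨(h v).2, (h v).1⟩

variable (E) in
/-- The edge space of the suspension of `E` is the vertex space of the suspension of the line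
graph of `E`. -/
def suspEdgeHomeomorph : E.lineGraph.SuspV ≃ₜ E.SuspEdge where
  toFun := Quot.map id (by
    rintro _ _ (p | p)
    · exact SuspEdgeRel.zero p
    · exact SuspEdgeRel.one p)
  invFun := Quot.map id (by
    rintro _ _ (p | p)
    · exact SuspVRel.zero (E := E.lineGraph) p
    · exact SuspVRel.one (E := E.lineGraph) p)
  left_inv := by rintro ⟨x⟩; rfl
  right_inv := by rintro ⟨x⟩; rfl
  continuous_toFun :=
    letI : TopologicalSpace E.Edge := ⊥
    letI : TopologicalSpace E.lineGraph.V := ⊥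
    continuous_quot_lift (r := E.lineGraph.SuspVRel) _ (continuous_quot_mk (r := E.SuspEdgeRel))
  continuous_invFun :=
    letI : TopologicalSpace E.Edge := ⊥
    letI : TopologicalSpace E.lineGraph.V := ⊥
    continuous_quot_lift (r := E.SuspEdgeRel) _ (continuous_quot_mk (r := E.lineGraph.SuspVRel))

/-- The suspension of a locally finite graph is a represented quiver: the number of edges with
a given source in a compact set is bounded because such a set meets finitely many cells, and
an edge in a given cell is determined by its source up to the end points of the cell. -/
theorem LocallyFinite.represented_suspension (h : E.LocallyFinite) :
    E.suspension.Represented := by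
  classical
  refine TopQuiver.represented_of_compact fun K hK => ?_
  obtain ⟨Z, P, hZP⟩ := SuspV.exists_finset_of_isCompact h.lineGraph
    (hK.image (E.suspEdgeHomeomorph).symm.continuous)
  refine ⟨Z.card + (P.card + P.card), fun v => ?_⟩
  -- The source `v` determines the position `x` modulo `1` on the cell that contains the edge; the
  -- position `1` is listed separately because it has the fractional part of the position `0`.
  obtain ⟨x, hx⟩ := QuotientAddGroup.mk_surjective (SuspV.toCircle (E := E) v)
  let x₀ : unitInterval := ⟨Int.fract x, fract_mem_unitInterval x⟩
  let j := E.suspEdgeHomeomorph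
  refine ⟨Z.image (fun z => j (SuspV.ofVertex z)) ∪
    (P.image (fun p => j (SuspV.mk p x₀)) ∪ P.image (fun p => j (SuspV.mk p 1))), ?_, ?_⟩
  · refine (Finset.card_union_le _ _).trans (add_le_add Finset.card_image_le ?_)
    exact (Finset.card_union_le _ _).trans
      (add_le_add Finset.card_image_le Finset.card_image_le)
  · intro β hβ hs
    obtain ⟨z, hz, hβz⟩ | ⟨p, hp, t, hβt⟩ := hZP _ (Set.mem_image_of_mem _ hβ)
    · exact Finset.mem_union_left _ (Finset.mem_image.2
        ⟨z, hz, by rw [← hβz]; exact j.apply_symm_apply β⟩)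
    · have e : β = j (SuspV.mk p t) := by rw [← hβt]; exact (j.apply_symm_apply β).symm
      refine Finset.mem_union_right _ ?_
      rcases t.2.2.lt_or_eq with ht | ht
      · refine Finset.mem_union_left _ (Finset.mem_image.2 ⟨p, hp, ?_⟩)
        rw [e]
        congr 2
        have h1 : ((t : ℝ) : UnitAddCircle) = (x : UnitAddCircle) := by
          rw [e] at hs
          have := congrArg (SuspV.toCircle (E := E)) hs
          exact this.trans hx.symm
        refine Subtype.ext ?_
        change Int.fract x = _
        rw [← fract_eq_of_coe_eq h1, Int.fract_eq_self]
        exact ⟨t.2.1, ht⟩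
      · refine Finset.mem_union_right _ (Finset.mem_image.2 ⟨p, hp, ?_⟩)
        rw [e]
        congr 2
        exact Subtype.ext ht.symm

/-! ### The vertex space of the fractional powers -/

/-- The point of the suspension described by `(μ, t)`. -/
noncomputable def vertexPt (x : E.FracVPre) : E.SuspV :=
  walkPt x.1.length x.1.edgeAt (fun k => x.1.vertexAt k) x.2.1

theorem Path.range_edgeAt (μ : E.Path) (k : Fin μ.length) :
    E.r (μ.edgeAt k) = μ.vertexAt k.castSucc :=
  (μ.vertexAt_eq_range k).symm

theorem continuous_vertexPt : Continuous (vertexPt : E.FracVPre → E.SuspV) := by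
  refine continuous_sigma fun μ => ?_
  exact (continuousOn_walkPt (z := fun k : Fin (μ.length + 1) => μ.vertexAt k)
    μ.range_edgeAt μ.source_edgeAt).comp_continuous continuous_subtype_val fun t => t.2

theorem vertexPt_vertex (v : E.V) (h) :
    vertexPt (⟨⟨[], v, trivial⟩, 0, h⟩ : E.FracVPre) = SuspV.ofVertex v := by
  refine (walkPt_of_fract_eq_zero (fun k => k.elim0) h.2 Int.fract_zero).trans ?_
  change SuspV.ofVertex (E.rangeOf (List.drop ⌊(0 : ℝ)⌋₊ []) v) = _
  rw [List.drop_nil]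
  rfl

theorem vertexPt_single (e : E.Edge) (t : unitInterval) (h) :
    vertexPt (⟨Path.single e, t, h⟩ : E.FracVPre) = SuspV.mk e t :=
  walkPt_of_mem_unitInterval (Path.single e).range_edgeAt (Path.single e).source_edgeAt
    Nat.one_pos t

/-- The pairs `([e], t)` and `(v, 0)` form a copy of the space that defines the suspension, which
is why all the pairs `(μ, t)` induce the same topology. -/
theorem isQuotientMap_vertexPt :
    Topology.IsQuotientMap (vertexPt : E.FracVPre → E.SuspV) := by
  let _ : TopologicalSpace E.V := ⊥
  have : DiscreteTopology E.V := ⟨rfl⟩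
  have h1 : ∀ (e : E.Edge) (t : unitInterval), 0 ≤ (t : ℝ) ∧ (t : ℝ) ≤ (Path.single e).length :=
    fun e t => ⟨t.2.1, t.2.2.trans_eq Nat.cast_one.symm⟩
  let g : ((Σ _ : E.Edge, unitInterval) ⊕ E.V) → E.FracVPre :=
    Sum.elim (fun x => ⟨Path.single x.1, x.2, h1 x.1 x.2⟩)
      (fun v => ⟨⟨[], v, trivial⟩, 0, le_rfl, Nat.cast_nonneg _⟩)
  have hg : Continuous g := by
    refine Continuous.sumElim (continuous_sigma fun e => ?_) continuous_of_discreteTopology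
    have hc : Continuous fun t : unitInterval =>
        (⟨t, h1 e t⟩ : {t : ℝ // 0 ≤ t ∧ t ≤ (Path.single e).length}) := by fun_prop
    exact (continuous_sigmaMk (σ := fun μ : E.Path => {t : ℝ // 0 ≤ t ∧ t ≤ μ.length})
      (i := Path.single e)).comp hc
  refine Topology.IsQuotientMap.of_comp hg continuous_vertexPt ?_
  have : vertexPt ∘ g = Quot.mk E.SuspVRel := by
    funext x
    obtain ⟨e, t⟩ | v := x
    · exact vertexPt_single e t _
    · exact vertexPt_vertex v _
  rw [this]
  exact isQuotientMap_quot_mk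

theorem ceil_eq_floor_of_fract_eq_zero {t : ℝ} (h0 : 0 ≤ t) (h : Int.fract t = 0) :
    ⌈t⌉₊ = ⌊t⌋₊ := by
  have e : (⌊t⌋₊ : ℝ) = t := by
    rw [natCast_floor_eq_intCast_floor h0]
    have := Int.fract_add_floor t
    linarith
  conv_lhs => rw [← e, Nat.ceil_natCast]

theorem ceil_eq_floor_add_one_of_fract_ne_zero {t : ℝ} (h0 : 0 ≤ t) (h : Int.fract t ≠ 0) :
    ⌈t⌉₊ = ⌊t⌋₊ + 1 := by
  refine (Nat.ceil_eq_iff (by omega)).2 ⟨?_, by exact_mod_cast (Nat.lt_floor_add_one t).le⟩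
  refine lt_of_le_of_ne (Nat.floor_le h0) fun he => h ?_
  have h2 : ((⌊t⌋₊ : ℕ) : ℝ) = t := he
  rw [← h2, Int.fract_natCast]

theorem fracVSetoid_iff (x y : E.FracVPre) : E.fracVSetoid x y ↔ vertexPt x = vertexPt y := by
  obtain ⟨μ, t, h0, hn⟩ := x
  obtain ⟨ν, t', h0', hn'⟩ := y
  unfold vertexPt
  rw [walkPt_eq_iff μ.range_edgeAt ν.range_edgeAt h0 hn h0' hn']
  change (Int.fract t, μ.seg ⌊t⌋₊ ⌈t⌉₊) = (Int.fract t', ν.seg ⌊t'⌋₊ ⌈t'⌉₊) ↔ _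
  rw [Prod.mk.injEq]
  refine and_congr_right fun hf => ?_
  by_cases h : Int.fract t = 0
  · have h' : Int.fract t' = 0 := hf ▸ h
    rw [ceil_eq_floor_of_fract_eq_zero h0 h, ceil_eq_floor_of_fract_eq_zero h0' h',
      Path.seg_self, Path.seg_self]
    simp [h]
  · have h' : Int.fract t' ≠ 0 := hf ▸ h
    have e1 := μ.seg_succ ⟨_, floor_lt_of_fract_ne_zero h0 hn h⟩
    have e2 := ν.seg_succ ⟨_, floor_lt_of_fract_ne_zero h0' hn' h'⟩
    rw [ceil_eq_floor_add_one_of_fract_ne_zero h0 h,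
      ceil_eq_floor_add_one_of_fract_ne_zero h0' h', e1, e2]
    simp only [h, h', Prod.mk.injEq, List.cons.injEq, and_true, not_false_eq_true, forall_true_left,
      ne_eq, IsEmpty.forall_iff, true_and]
    exact ⟨fun e => e.1, fun e => ⟨e, by rw [e]⟩⟩

/-! ### The edge space of the fractional power with parameter `1` -/

theorem one_le_length (x : E.FracEdgePre 1) : 1 ≤ x.1.length := by
  have h := x.2.2.2.2
  have h0 := x.2.2.1.1
  have : ((1 : ℕ) : ℝ) ≤ x.1.length := by push_cast; linarith
  exact_mod_cast this

/-- The `k`-th segment of length two of a path. -/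
def Path.pairAt (μ : E.Path) (k : Fin (μ.length - 1)) : E.lineGraph.Edge :=
  ⟨(μ.edgeAt ⟨k, by omega⟩, μ.edgeAt ⟨k + 1, by omega⟩), by
    rw [source_edgeAt, ← vertexAt_eq_range]⟩

/-- The point of the edge space of the suspension described by `(μ, t)`, as a point of the
suspension of the line graph. -/
noncomputable def edgePt (x : E.FracEdgePre 1) : E.lineGraph.SuspV :=
  walkPt (x.1.length - 1) x.1.pairAt
    (fun k => x.1.edgeAt ⟨k, by have := one_le_length x; omega⟩) x.2.1

theorem le_length_sub_one (x : E.FracEdgePre 1) : x.2.1 ≤ (x.1.length - 1 : ℕ) := by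
  rw [Nat.cast_sub (one_le_length x)]
  have h := x.2.2.2.2
  push_cast
  linarith

theorem continuous_edgePt : Continuous (edgePt : E.FracEdgePre 1 → E.lineGraph.SuspV) := by
  refine continuous_sigma fun μ => ?_
  by_cases hμ : 1 ≤ μ.length
  · exact (continuousOn_walkPt (c := μ.pairAt)
      (z := fun k : Fin (μ.length - 1 + 1) => μ.edgeAt ⟨k, by omega⟩)
      (fun _ => rfl) (fun _ => rfl)).comp_continuous continuous_subtype_val
        fun t => ⟨t.2.1.1, le_length_sub_one ⟨μ, t⟩⟩
  · have : IsEmpty {t : ℝ // (0 ≤ t ∧ t ≤ μ.length) ∧ 0 ≤ t + 1 ∧ t + 1 ≤ μ.length} :=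
      ⟨fun t => hμ (one_le_length ⟨μ, t⟩)⟩
    exact continuous_of_const fun t => isEmptyElim t

theorem edgePt_single (e : E.Edge) (h) :
    edgePt (⟨Path.single e, 0, h⟩ : E.FracEdgePre 1) = SuspV.ofVertex (E := E.lineGraph) e := by
  refine (walkPt_of_fract_eq_zero (fun k => k.elim0) (le_length_sub_one ⟨Path.single e, 0, h⟩)
    Int.fract_zero).trans ?_
  congr 1
  have : (⟨⌊(0 : ℝ)⌋₊, by rw [Nat.floor_zero]; exact Nat.one_pos⟩ : Fin (Path.single e).length) =
    ⟨0, Nat.one_pos⟩ := Fin.ext Nat.floor_zero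
  change (Path.single e).edgeAt ⟨⌊(0 : ℝ)⌋₊, _⟩ = e
  rw [this]
  rfl

theorem edgePt_pair (p : E.TwoPath) (t : unitInterval) (h) :
    edgePt (⟨Path.pair p.1.1 p.1.2 p.2, t, h⟩ : E.FracEdgePre 1) =
      SuspV.mk (E := E.lineGraph) p t :=
  walkPt_of_mem_unitInterval (c := (Path.pair p.1.1 p.1.2 p.2).pairAt)
    (fun _ => rfl) (fun _ => rfl) Nat.one_pos t

theorem isQuotientMap_edgePt :
    Topology.IsQuotientMap (edgePt : E.FracEdgePre 1 → E.lineGraph.SuspV) := by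
  let _ : TopologicalSpace E.Edge := ⊥
  have : DiscreteTopology E.Edge := ⟨rfl⟩
  have h1 : ∀ e : E.Edge, (0 ≤ (0 : ℝ) ∧ (0 : ℝ) ≤ (Path.single e).length) ∧
      0 ≤ (0 : ℝ) + 1 ∧ (0 : ℝ) + 1 ≤ (Path.single e).length := by
    intro e
    have : (Path.single e).length = 1 := rfl
    rw [this]
    norm_num
  have h2 : ∀ (p : E.TwoPath) (t : unitInterval),
      (0 ≤ (t : ℝ) ∧ (t : ℝ) ≤ (Path.pair p.1.1 p.1.2 p.2).length) ∧
      0 ≤ (t : ℝ) + 1 ∧ (t : ℝ) + 1 ≤ (Path.pair p.1.1 p.1.2 p.2).length := by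
    intro p t
    have : (Path.pair p.1.1 p.1.2 p.2).length = 2 := rfl
    rw [this]
    have := t.2.1
    have := t.2.2
    push_cast
    refine ⟨⟨?_, ?_⟩, ?_, ?_⟩ <;> linarith
  let g : ((Σ _ : E.TwoPath, unitInterval) ⊕ E.Edge) → E.FracEdgePre 1 :=
    Sum.elim (fun x => ⟨Path.pair x.1.1.1 x.1.1.2 x.1.2, x.2, h2 x.1 x.2⟩)
      (fun e => ⟨Path.single e, 0, h1 e⟩)
  have hg : Continuous g := by
    refine Continuous.sumElim (continuous_sigma fun p => ?_) continuous_of_discreteTopology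
    have hc : Continuous fun t : unitInterval =>
        (⟨t, h2 p t⟩ : {t : ℝ // (0 ≤ t ∧ t ≤ (Path.pair p.1.1 p.1.2 p.2).length) ∧
          0 ≤ t + 1 ∧ t + 1 ≤ (Path.pair p.1.1 p.1.2 p.2).length}) := by fun_prop
    exact (continuous_sigmaMk (σ := fun μ : E.Path =>
      {t : ℝ // (0 ≤ t ∧ t ≤ μ.length) ∧ 0 ≤ t + 1 ∧ t + 1 ≤ μ.length})
      (i := Path.pair p.1.1 p.1.2 p.2)).comp hc
  refine Topology.IsQuotientMap.of_comp hg continuous_edgePt ?_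
  have : edgePt ∘ g = Quot.mk E.lineGraph.SuspVRel := by
    funext x
    obtain ⟨p, t⟩ | e := x
    · exact edgePt_pair p t _
    · exact edgePt_single e _
  rw [this]
  exact isQuotientMap_quot_mk

theorem fracEdgeSetoid_one_iff (x y : E.FracEdgePre 1) :
    E.fracEdgeSetoid 1 x y ↔ edgePt x = edgePt y := by
  have hx := le_length_sub_one x
  have hy := le_length_sub_one y
  have lx := one_le_length x
  have ly := one_le_length y
  refine Iff.trans ?_
    (walkPt_eq_iff (fun _ => rfl) (fun _ => rfl) x.2.2.1.1 hx y.2.2.1.1 hy).symm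
  obtain ⟨μ, t, ⟨h0, hn⟩, h1, h2⟩ := x
  obtain ⟨ν, t', ⟨h0', hn'⟩, h1', h2'⟩ := y
  dsimp only at hx hy lx ly
  change (Int.fract t, if (0 : ℝ) ≤ 1 then μ.seg ⌊t⌋₊ ⌈t + 1⌉₊ else _) =
    (Int.fract t', if (0 : ℝ) ≤ 1 then ν.seg ⌊t'⌋₊ ⌈t' + 1⌉₊ else _) ↔ _
  rw [if_pos zero_le_one, if_pos zero_le_one, Nat.ceil_add_one h0, Nat.ceil_add_one h0',
    Prod.mk.injEq]
  refine and_congr_right fun hf => ?_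
  by_cases h : Int.fract t = 0
  · have h' : Int.fract t' = 0 := hf ▸ h
    have b1 : ⌊t⌋₊ < μ.length := by have := floor_lt_succ hx; omega
    have b2 : ⌊t'⌋₊ < ν.length := by have := floor_lt_succ hy; omega
    have e1 := μ.seg_succ ⟨⌊t⌋₊, b1⟩
    have e2 := ν.seg_succ ⟨⌊t'⌋₊, b2⟩
    rw [ceil_eq_floor_of_fract_eq_zero h0 h, ceil_eq_floor_of_fract_eq_zero h0' h', e1, e2]
    simp only [h, Prod.mk.injEq, List.cons.injEq, and_true, forall_true_left,
      ne_eq, IsEmpty.forall_iff, not_true_eq_false]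
    exact ⟨fun e => e.1, fun e => ⟨e, congrArg E.s e⟩⟩
  · have h' : Int.fract t' ≠ 0 := hf ▸ h
    have b1 : ⌊t⌋₊ + 1 < μ.length := by have := floor_lt_of_fract_ne_zero h0 hx h; omega
    have b2 : ⌊t'⌋₊ + 1 < ν.length := by have := floor_lt_of_fract_ne_zero h0' hy h'; omega
    rw [ceil_eq_floor_add_one_of_fract_ne_zero h0 h,
      ceil_eq_floor_add_one_of_fract_ne_zero h0' h', μ.seg_succ_succ _ b1, ν.seg_succ_succ _ b2]
    simp only [h, h', Prod.mk.injEq, List.cons.injEq, and_true, not_false_eq_true, forall_true_left,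
      ne_eq, IsEmpty.forall_iff, true_and]
    refine ⟨fun e => Subtype.ext (Prod.ext e.1.1 e.1.2), fun e => ?_⟩
    have e1 := congrArg (fun p : E.TwoPath => p.1.1) e
    have e2 := congrArg (fun p : E.TwoPath => p.1.2) e
    exact ⟨⟨e1, e2⟩, congrArg E.s e2⟩

end DirGraph

/-! ### Isomorphisms between fractional powers and suspensions -/

namespace TopQuiver

/-- The opposite of a topological quiver. -/
def op (G : TopQuiver.{u}) : TopQuiver.{u} where
  V := G.V
  Edge := G.Edge
  r := G.s
  s := G.r

/-- An isomorphism of quivers is an isomorphism of their opposites. -/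
def Iso.op {G H : TopQuiver.{u}} (θ : Iso G H) : Iso G.op H.op where
  onV := θ.onV
  onEdge := θ.onEdge
  r_comm := θ.s_comm
  s_comm := θ.r_comm

end TopQuiver

namespace DirGraph

variable {E : DirGraph.{u}}

theorem range_suspEdgeHomeomorph_edgePt (x : E.FracEdgePre 1) :
    SuspEdge.range (E.suspEdgeHomeomorph (edgePt x)) = vertexPt ⟨x.1, x.2.1, x.2.2.1⟩ := by
  have hx := le_length_sub_one x
  have h0 : 0 ≤ x.2.1 := x.2.2.1.1
  have hn : x.2.1 ≤ x.1.length := x.2.2.1.2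
  have hlen := one_le_length x
  by_cases h : Int.fract x.2.1 = 0
  · have e1 : edgePt x = _ := walkPt_of_fract_eq_zero (fun _ => rfl) hx h
    have e2 : vertexPt ⟨x.1, x.2.1, x.2.2.1⟩ = _ :=
      walkPt_of_fract_eq_zero x.1.range_edgeAt hn h
    rw [e1, e2]
    exact congrArg SuspV.ofVertex (x.1.vertexAt_eq_range ⟨⌊x.2.1⌋₊, by
      have := floor_lt_succ hx; omega⟩).symm
  · have e1 : edgePt x = _ := walkPt_of_fract_ne_zero h0 hx h
    have e2 : vertexPt ⟨x.1, x.2.1, x.2.2.1⟩ = _ := walkPt_of_fract_ne_zero h0 hn h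
    rw [e1, e2]
    rfl

theorem source_suspEdgeHomeomorph_edgePt (x : E.FracEdgePre 1) :
    SuspEdge.source (E.suspEdgeHomeomorph (edgePt x)) =
      vertexPt ⟨x.1, x.2.1 + 1, x.2.2.2⟩ := by
  have hx := le_length_sub_one x
  have h0 : 0 ≤ x.2.1 := x.2.2.1.1
  have h1 : 0 ≤ x.2.1 + 1 := x.2.2.2.1
  have hn : x.2.1 + 1 ≤ x.1.length := x.2.2.2.2
  have hlen := one_le_length x
  have hfr : Int.fract (x.2.1 + 1) = Int.fract x.2.1 := Int.fract_add_one _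
  have hfl : ⌊x.2.1 + 1⌋₊ = ⌊x.2.1⌋₊ + 1 := Nat.floor_add_one h0
  by_cases h : Int.fract x.2.1 = 0
  · have e1 : edgePt x = _ := walkPt_of_fract_eq_zero (fun _ => rfl) hx h
    have e2 : vertexPt ⟨x.1, x.2.1 + 1, x.2.2.2⟩ = _ :=
      walkPt_of_fract_eq_zero x.1.range_edgeAt hn (hfr.trans h)
    rw [e1, e2]
    refine congrArg SuspV.ofVertex ?_
    change E.s (x.1.edgeAt ⟨⌊x.2.1⌋₊, _⟩) = x.1.vertexAt ⌊x.2.1 + 1⌋₊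
    rw [hfl]
    exact x.1.source_edgeAt _
  · have h' : Int.fract (x.2.1 + 1) ≠ 0 := fun he => h (hfr.symm.trans he)
    have e1 : edgePt x = _ := walkPt_of_fract_ne_zero h0 hx h
    have e2 : vertexPt ⟨x.1, x.2.1 + 1, x.2.2.2⟩ = _ := walkPt_of_fract_ne_zero h1 hn h'
    rw [e1, e2]
    change SuspV.mk (x.1.edgeAt ⟨⌊x.2.1⌋₊ + 1, _⟩) _ = SuspV.mk (x.1.edgeAt ⟨⌊x.2.1 + 1⌋₊, _⟩) _
    congr 1
    · exact congrArg x.1.edgeAt (Fin.ext hfl.symm)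
    · exact Subtype.ext hfr.symm

variable (E) in
/-- The points described by the pairs `(μ, t)` define an isomorphism of the fractional power with
parameter `1` onto the suspension. -/
theorem exists_iso_fractional_one : ∃ θ : TopQuiver.Iso (E.fractional 1) E.suspension,
    (∀ x : E.FracVPre, θ.onV (FracV.mk x.1 x.2.1 x.2.2) = vertexPt x) ∧
    ∀ x : E.FracEdgePre 1, θ.onEdge (FracEdge.mk x.1 x.2.1 x.2.2) =
      E.suspEdgeHomeomorph (edgePt x) := by
  obtain ⟨eV, hV⟩ := exists_homeomorph_of_isQuotientMap E.fracVSetoid _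
    isQuotientMap_vertexPt fracVSetoid_iff
  obtain ⟨eE, hE⟩ := exists_homeomorph_of_isQuotientMap (E.fracEdgeSetoid 1) _
    isQuotientMap_edgePt fracEdgeSetoid_one_iff
  refine ⟨{ onV := eV
            onEdge := eE.trans E.suspEdgeHomeomorph
            r_comm := ?_
            s_comm := ?_ }, hV, fun x => congrArg E.suspEdgeHomeomorph (hE x)⟩
  · rintro ⟨x⟩
    refine (hV _).trans ((range_suspEdgeHomeomorph_edgePt x).symm.trans ?_)
    exact congrArg (fun y => SuspEdge.range (E.suspEdgeHomeomorph y)) (hE x).symm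
  · rintro ⟨x⟩
    refine (hV _).trans ((source_suspEdgeHomeomorph_edgePt x).symm.trans ?_)
    exact congrArg (fun y => SuspEdge.source (E.suspEdgeHomeomorph y)) (hE x).symm

/-! ### Reversal -/

/-- The map `[e, t] ↦ [e, 1 - t]` from the suspension of `E` to that of the opposite graph. -/
def SuspV.flip : E.SuspV → E.op.SuspV :=
  Quot.lift (Sum.elim (fun x => SuspV.mk (E := E.op) x.1 (unitInterval.symm x.2))
    (SuspV.ofVertex (E := E.op)))
    (by
      rintro _ _ (e | e)
      · exact (congrArg (SuspV.mk (E := E.op) e) unitInterval.symm_zero).trans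
          (SuspV.mk_one (G := E.op) e)
      · exact (congrArg (SuspV.mk (E := E.op) e) unitInterval.symm_one).trans
          (SuspV.mk_zero (G := E.op) e))

theorem SuspV.flip_flip (x : E.SuspV) : SuspV.flip (E := E.op) (SuspV.flip x) = x := by
  obtain ⟨e, t⟩ | v := x
  · change SuspV.mk e (unitInterval.symm (unitInterval.symm t)) = SuspV.mk e t
    rw [unitInterval.symm_symm]
  · rfl

theorem SuspV.continuous_flip : Continuous (SuspV.flip : E.SuspV → E.op.SuspV) := by
  let _ : TopologicalSpace E.V := ⊥
  have : DiscreteTopology E.V := ⟨rfl⟩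
  exact continuous_quot_lift (r := E.SuspVRel) _ (Continuous.sumElim
    (continuous_sigma fun e => (SuspV.continuous_mk (G := E.op) e).comp
      unitInterval.continuous_symm) continuous_of_discreteTopology)

theorem SuspV.toCircle_flip (x : E.SuspV) :
    SuspV.toCircle (E := E.op) (SuspV.flip x) = -x.toCircle := by
  obtain ⟨e, t⟩ | v := x
  · change ((1 - t : ℝ) : UnitAddCircle) = -((t : ℝ) : UnitAddCircle)
    rw [AddCircle.coe_sub, AddCircle.coe_period, zero_sub]
  · exact neg_zero.symm

/-- The map `[ef, t] ↦ [fe, 1 - t]` between the edge spaces of the suspensions of `E` and of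
the opposite graph. -/
def SuspEdge.flip : E.SuspEdge → E.op.SuspEdge :=
  Quot.lift (Sum.elim
    (fun x => SuspEdge.mk (E := E.op) x.1.1.2 x.1.1.1 x.1.2.symm (unitInterval.symm x.2))
    (fun e => Quot.mk E.op.SuspEdgeRel (Sum.inr e)))
    (by
      rintro _ _ (p | p)
      · exact (congrArg (SuspEdge.mk (E := E.op) p.1.2 p.1.1 p.2.symm)
          unitInterval.symm_zero).trans
          (Quot.sound (SuspEdgeRel.one (E := E.op) ⟨(p.1.2, p.1.1), p.2.symm⟩))
      · exact (congrArg (SuspEdge.mk (E := E.op) p.1.2 p.1.1 p.2.symm)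
          unitInterval.symm_one).trans
          (Quot.sound (SuspEdgeRel.zero (E := E.op) ⟨(p.1.2, p.1.1), p.2.symm⟩)))

theorem SuspEdge.flip_flip (x : E.SuspEdge) :
    SuspEdge.flip (E := E.op) (SuspEdge.flip x) = x := by
  obtain ⟨p, t⟩ | e := x
  · change SuspEdge.mk p.1.1 p.1.2 p.2 (unitInterval.symm (unitInterval.symm t)) =
      SuspEdge.mk p.1.1 p.1.2 p.2 t
    rw [unitInterval.symm_symm]
  · rfl

theorem SuspEdge.continuous_mk (E : DirGraph.{u}) (e f : E.Edge) (h : E.s e = E.r f) :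
    Continuous (SuspEdge.mk e f h : unitInterval → E.SuspEdge) :=
  let _ : TopologicalSpace E.Edge := ⊥
  (continuous_quot_mk (r := E.SuspEdgeRel)).comp (continuous_inl.comp
    (continuous_sigmaMk (σ := fun _ : E.TwoPath => unitInterval) (i := ⟨(e, f), h⟩)))

theorem SuspEdge.continuous_flip : Continuous (SuspEdge.flip : E.SuspEdge → E.op.SuspEdge) := by
  let _ : TopologicalSpace E.Edge := ⊥
  have : DiscreteTopology E.Edge := ⟨rfl⟩
  exact continuous_quot_lift (r := E.SuspEdgeRel) _ (Continuous.sumElim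
    (continuous_sigma fun p => (SuspEdge.continuous_mk E.op p.1.2 p.1.1 p.2.symm).comp
      unitInterval.continuous_symm) continuous_of_discreteTopology)

variable (E) in
/-- The suspension of the opposite graph is the opposite of the suspension. -/
def suspensionOpIso : TopQuiver.Iso E.suspension.op E.op.suspension where
  onV :=
    { toFun := SuspV.flip (E := E)
      invFun := SuspV.flip (E := E.op)
      left_inv := SuspV.flip_flip (E := E)
      right_inv := SuspV.flip_flip (E := E.op)
      continuous_toFun := SuspV.continuous_flip (E := E)
      continuous_invFun := SuspV.continuous_flip (E := E.op) }
  onEdge :=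
    { toFun := SuspEdge.flip (E := E)
      invFun := SuspEdge.flip (E := E.op)
      left_inv := SuspEdge.flip_flip (E := E)
      right_inv := SuspEdge.flip_flip (E := E.op)
      continuous_toFun := SuspEdge.continuous_flip (E := E)
      continuous_invFun := SuspEdge.continuous_flip (E := E.op) }
  r_comm x := by obtain ⟨p, t⟩ | e := x <;> rfl
  s_comm x := by obtain ⟨p, t⟩ | e := x <;> rfl

/-- The shift `(μ, t) ↦ (μ, t - 1)`. -/
noncomputable def shiftPre : E.FracEdgePre (-1) ≃ₜ E.FracEdgePre 1 where
  toFun x := ⟨x.1, x.2.1 + -1, x.2.2.2, by rw [neg_add_cancel_right]; exact x.2.2.1⟩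
  invFun x := ⟨x.1, x.2.1 + 1, x.2.2.2, by rw [add_neg_cancel_right]; exact x.2.2.1⟩
  left_inv := by
    rintro ⟨μ, t, h⟩
    simp only [neg_add_cancel_right]
  right_inv := by
    rintro ⟨μ, t, h⟩
    simp only [add_neg_cancel_right]
  continuous_toFun := continuous_sigma fun μ =>
    (continuous_sigmaMk (σ := fun μ : E.Path => {t : ℝ // (0 ≤ t ∧ t ≤ μ.length) ∧
      0 ≤ t + 1 ∧ t + 1 ≤ μ.length}) (i := μ)).comp
        (continuous_induced_rng.2 (continuous_subtype_val.add continuous_const))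
  continuous_invFun := continuous_sigma fun μ =>
    (continuous_sigmaMk (σ := fun μ : E.Path => {t : ℝ // (0 ≤ t ∧ t ≤ μ.length) ∧
      0 ≤ t + -1 ∧ t + -1 ≤ μ.length}) (i := μ)).comp
        (continuous_induced_rng.2 (continuous_subtype_val.add continuous_const))

theorem fracEdgeSetoid_shiftPre (x y : E.FracEdgePre (-1)) :
    E.fracEdgeSetoid (-1) x y ↔ E.fracEdgeSetoid 1 (shiftPre x) (shiftPre y) := by
  obtain ⟨μ, t, h⟩ := x
  obtain ⟨ν, t', h'⟩ := y
  change (Int.fract t, if (0 : ℝ) ≤ -1 then _ else μ.seg ⌊t + -1⌋₊ ⌈t⌉₊) =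
      (Int.fract t', if (0 : ℝ) ≤ -1 then _ else ν.seg ⌊t' + -1⌋₊ ⌈t'⌉₊) ↔
    (Int.fract (t + -1), if (0 : ℝ) ≤ 1 then μ.seg ⌊t + -1⌋₊ ⌈t + -1 + 1⌉₊ else _) =
      (Int.fract (t' + -1), if (0 : ℝ) ≤ 1 then ν.seg ⌊t' + -1⌋₊ ⌈t' + -1 + 1⌉₊ else _)
  have hneg : ¬ (0 : ℝ) ≤ -1 := by norm_num
  rw [if_neg hneg, if_neg hneg, if_pos zero_le_one, if_pos zero_le_one, neg_add_cancel_right,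
    neg_add_cancel_right, ← sub_eq_add_neg, ← sub_eq_add_neg, Int.fract_sub_one,
    Int.fract_sub_one]

variable (E) in
/-- Changing the sign of the parameter reverses the direction of the edges. -/
noncomputable def fractionalNegOneIso :
    TopQuiver.Iso (E.fractional (-1)) (E.fractional 1).op where
  onV := Homeomorph.refl E.FracV
  onEdge := Homeomorph.Quotient.congr shiftPre fracEdgeSetoid_shiftPre
  r_comm := by
    rintro ⟨μ, t, h⟩
    change FracV.mk μ t _ = FracV.mk μ (t + -1 + 1) _
    simp only [neg_add_cancel_right]
  s_comm := by
    rintro ⟨μ, t, h⟩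
    rfl

/-! ### Finite graphs -/

theorem LocallyFinite.finite_edge (h : E.LocallyFinite) [Finite E.V] : Finite E.Edge := by
  have : (Set.univ : Set E.Edge) = ⋃ v, {e | E.s e = v} := by
    ext e; simp
  exact Set.finite_univ_iff.1 (this ▸ Set.finite_iUnion fun v => (h v).1)

theorem LocallyFinite.finite_toCircle_fibre (h : E.LocallyFinite) [Finite E.V]
    (c : UnitAddCircle) : {x : E.SuspV | x.toCircle = c}.Finite := by
  have := h.finite_edge
  obtain ⟨x, rfl⟩ := QuotientAddGroup.mk_surjective c
  refine ((Set.finite_range (SuspV.ofVertex (E := E))).union (Set.finite_range fun e : E.Edge =>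
    SuspV.mk e ⟨Int.fract x, fract_mem_unitInterval x⟩)).subset fun y hy => ?_
  obtain ⟨e, t, rfl⟩ | ⟨v, rfl⟩ := SuspV.exists_rep y
  · rcases t.2.2.lt_or_eq with ht | ht
    · refine Or.inr ⟨e, congrArg (SuspV.mk e) (Subtype.ext ?_)⟩
      change Int.fract x = _
      rw [← fract_eq_of_coe_eq (show ((t : ℝ) : UnitAddCircle) = x from hy)]
      exact Int.fract_eq_self.2 ⟨t.2.1, ht⟩
    · refine Or.inl ⟨E.s e, ?_⟩
      rw [← SuspV.mk_one]
      congr 1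
      exact Subtype.ext ht.symm
  · exact Or.inl ⟨v, rfl⟩

theorem toCircle_vertexPt (x : E.FracVPre) :
    (vertexPt x).toCircle = FracV.toCircle (FracV.mk x.1 x.2.1 x.2.2) :=
  toCircle_walkPt x.1.range_edgeAt x.2.2.1 x.2.2.2

/-! ### The fractional powers with parameters `1` and `-1` -/

/-- An isomorphism onto a suspension that is compatible with the maps to the circle, up to a
bijection of the circle, induces all the isomorphisms of algebras. -/
theorem exists_toeplitzEquiv_of_iso {F : DirGraph.{u}} (hF : F.LocallyFinite) {l : ℝ}
    (θ : TopQuiver.Iso (E.fractional l) F.suspension) (σ : UnitAddCircle ≃ UnitAddCircle)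
    (hσ : ∀ v : E.FracV, SuspV.toCircle (E := F) (θ.onV v) = σ v.toCircle) :
    ∃ Φ : TopQuiver.ToeplitzEquiv (E.fractional l) F.suspension, Φ.Carries θ ∧
      Φ.Descends id id ∧ Φ.Descends FracV.toCircle SuspV.toCircle ∧
      (Finite F.V → Φ.Descends id SuspV.toCircle) := by
  have hrep := hF.represented_suspension
  refine ⟨θ.toeplitzEquiv hrep, θ.toeplitzEquiv_carries hrep,
    θ.toeplitzEquiv_descends hrep θ.onV.toEquiv fun _ => rfl,
    θ.toeplitzEquiv_descends hrep σ hσ, fun _ => ?_⟩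
  exact TopQuiver.ToeplitzEquiv.Descends.of_finite_fibres
    (fun x => (θ.quotMap_toeplitzEquiv_eq_zero_iff hrep θ.onV.toEquiv (fun _ => rfl) x).symm)
    hF.finite_toCircle_fibre

theorem LocallyFinite.fractional_one (hE : E.LocallyFinite) :
    (E.fractional 1).Represented ∧ ∃ θ : TopQuiver.Iso (E.fractional 1) E.suspension,
      (∀ (e : E.Edge) (t : unitInterval) h,
        θ.onV (FracV.mk (Path.single e) t h) = SuspV.mk e t) ∧
      (∀ (e f : E.Edge) (hef : E.s e = E.r f) (t : unitInterval) h,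
        θ.onEdge (FracEdge.mk (Path.pair e f hef) t h) = SuspEdge.mk e f hef t) ∧
      ∃ Φ : TopQuiver.ToeplitzEquiv (E.fractional 1) E.suspension,
        Φ.Carries θ ∧ Φ.Descends id id ∧ Φ.Descends FracV.toCircle SuspV.toCircle ∧
        (Finite E.V → Φ.Descends id SuspV.toCircle) := by
  obtain ⟨θ, hV, hE'⟩ := E.exists_iso_fractional_one
  refine ⟨θ.represented hE.represented_suspension, θ, fun e t h => ?_, fun e f hef t h => ?_,
    exists_toeplitzEquiv_of_iso hE θ (Equiv.refl _) ?_⟩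
  · exact (hV ⟨_, t, h⟩).trans (vertexPt_single e t h)
  · exact (hE' ⟨_, t, h⟩).trans
      (congrArg E.suspEdgeHomeomorph (edgePt_pair ⟨(e, f), hef⟩ t h))
  · rintro ⟨x⟩
    exact (congrArg SuspV.toCircle (hV x)).trans (toCircle_vertexPt x)

theorem LocallyFinite.fractional_neg_one (hE : E.LocallyFinite) :
    (E.fractional (-1)).Represented ∧
    ∃ θ : TopQuiver.Iso (E.fractional (-1)) E.op.suspension,
      (∀ (e : E.Edge) (t : unitInterval) h,
        θ.onV (FracV.mk (Path.single e) t h) =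
          SuspV.mk (E := E.op) e (unitInterval.symm t)) ∧
      (∀ (e f : E.Edge) (hef : E.s e = E.r f) (t : unitInterval) h,
        θ.onEdge (FracEdge.mk (Path.pair e f hef) (1 + t) h) =
          SuspEdge.mk (E := E.op) f e hef.symm (unitInterval.symm t)) ∧
      ∃ Φ : TopQuiver.ToeplitzEquiv (E.fractional (-1)) E.op.suspension,
        Φ.Carries θ ∧ Φ.Descends id id ∧ Φ.Descends FracV.toCircle SuspV.toCircle ∧
        (Finite E.V → Φ.Descends id SuspV.toCircle) := by
  obtain ⟨θ₁, hV, hE'⟩ := E.exists_iso_fractional_one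
  let θ : TopQuiver.Iso (E.fractional (-1)) E.op.suspension :=
    (E.fractionalNegOneIso.trans θ₁.op).trans E.suspensionOpIso
  have hθV : ∀ x : E.FracVPre, θ.onV (FracV.mk x.1 x.2.1 x.2.2) = SuspV.flip (vertexPt x) :=
    fun x => congrArg SuspV.flip (hV x)
  refine ⟨θ.represented hE.op.represented_suspension, θ, fun e t h => ?_,
    fun e f hef t h => ?_, exists_toeplitzEquiv_of_iso hE.op θ (Equiv.neg _) ?_⟩
  · exact (hθV ⟨_, t, h⟩).trans (congrArg SuspV.flip (vertexPt_single e t h))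
  · have h1 := hE' (shiftPre ⟨Path.pair e f hef, 1 + t, h⟩)
    have h2 : shiftPre ⟨Path.pair e f hef, 1 + t, h⟩ =
        (⟨Path.pair e f hef, t, by simpa using h.2, by simpa [add_comm] using h.1⟩ :
          E.FracEdgePre 1) := by
      change (⟨_, ⟨1 + (t : ℝ) + -1, _⟩⟩ : E.FracEdgePre 1) = _
      simp only [add_neg_cancel_comm]
    refine (congrArg SuspEdge.flip h1).trans ?_
    rw [h2]
    exact congrArg (fun y => SuspEdge.flip (E.suspEdgeHomeomorph y))
      (edgePt_pair ⟨(e, f), hef⟩ t _)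
  · rintro ⟨x⟩
    refine (congrArg (SuspV.toCircle (E := E.op)) (hθV x)).trans ?_
    rw [SuspV.toCircle_flip, toCircle_vertexPt]
    rfl

end DirGraph

section

open Filter Topology

/-! ### The classical Toeplitz algebra -/

/-- Induction in the `*`-algebra generated by one element, by left multiplication. -/
theorem adjoin_singleton_induction {A : Type u} [Ring A] [StarRing A] [Algebra ℂ A]
    [StarModule ℂ A] (a : A) {p : A → Prop} (one : p 1)
    (add : ∀ x y, p x → p y → p (x + y)) (smul : ∀ (c : ℂ) x, p x → p (c • x))
    (mul_left : ∀ x, p x → p (a * x)) (star_mul_left : ∀ x, p x → p (star a * x)) {x : A}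
    (hx : x ∈ StarAlgebra.adjoin ℂ {a}) : p x := by
  have hx' : x ∈ Submodule.span ℂ (Submonoid.closure ({a} ∪ star {a} : Set A) : Set A) := by
    rw [← Algebra.adjoin_eq_span]
    exact hx
  clear hx
  induction hx' using Submodule.span_induction with
  | mem y hy =>
    induction hy using Submonoid.closure_induction_left with
    | one => exact one
    | mul_left z hz y _ ih =>
      rcases hz with rfl | hz
      · exact mul_left _ ih
      · have : z = star a := by rw [← Set.mem_singleton_iff.1 hz, star_star]
        exact this ▸ star_mul_left _ ih
  | zero => simpa using smul 0 1 one
  | add x y _ _ hx hy => exact add _ _ hx hy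
  | smul c x _ hx => exact smul _ _ hx

/-- The inclusion of the Toeplitz algebra into `B(ℓ²(ℕ))`. -/
noncomputable def toeplitzIncl : ToeplitzAlg →⋆ₐ[ℂ] BddOp (EllTwo ℕ) :=
  (StarAlgebra.elemental ℂ unilateralShift).subtype

theorem toeplitzIncl_shiftT : toeplitzIncl shiftT = unilateralShift := rfl

theorem norm_toeplitzIncl (b : ToeplitzAlg) : ‖toeplitzIncl b‖ = ‖b‖ := rfl

theorem isometry_toeplitzIncl : Isometry toeplitzIncl := isometry_subtype_coe

theorem isClosed_range_toeplitzIncl : IsClosed (Set.range toeplitzIncl) := by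
  have : Set.range toeplitzIncl = StarAlgebra.elemental ℂ unilateralShift :=
    Subtype.range_coe
  rw [this]
  exact StarAlgebra.elemental.isClosed ℂ _

/-- Closed properties of elements of the Toeplitz algebra may be proved by induction. -/
theorem ToeplitzAlg.induction {p : ToeplitzAlg → Prop} (closed : IsClosed {b | p b})
    (one : p 1) (add : ∀ x y, p x → p y → p (x + y)) (smul : ∀ (c : ℂ) x, p x → p (c • x))
    (mul_left : ∀ x, p x → p (shiftT * x)) (star_mul_left : ∀ x, p x → p (star shiftT * x))
    (b : ToeplitzAlg) : p b := by
  have h1 : ∀ x ∈ StarAlgebra.adjoin ℂ {unilateralShift}, ∃ y, toeplitzIncl y = x ∧ p y := by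
    intro x hx
    refine adjoin_singleton_induction (p := fun x => ∃ y, toeplitzIncl y = x ∧ p y)
      unilateralShift ⟨1, map_one _, one⟩ ?_ ?_ ?_ ?_ hx
    · rintro _ _ ⟨x, rfl, hx⟩ ⟨y, rfl, hy⟩
      exact ⟨x + y, map_add _ _ _, add _ _ hx hy⟩
    · rintro c _ ⟨x, rfl, hx⟩
      exact ⟨c • x, map_smul _ _ _, smul _ _ hx⟩
    · rintro _ ⟨x, rfl, hx⟩
      exact ⟨shiftT * x, map_mul _ _ _, mul_left _ hx⟩
    · rintro _ ⟨x, rfl, hx⟩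
      exact ⟨star shiftT * x, by rw [map_mul, map_star]; rfl, star_mul_left _ hx⟩
  have hb : toeplitzIncl b ∈
      closure (StarAlgebra.adjoin ℂ {unilateralShift} : Set (BddOp (EllTwo ℕ))) := b.2
  obtain ⟨x, hx, hxb⟩ := mem_closure_iff_seq_limit.1 hb
  choose y hy hpy using fun n => h1 (x n) (hx n)
  have hyb : Tendsto y atTop (𝓝 b) :=
    isometry_toeplitzIncl.isEmbedding.tendsto_nhds_iff.2 (by simpa [Function.comp_def, hy] using hxb)
  exact closed.mem_of_tendsto hyb (Eventually.of_forall hpy)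

/-- Closed properties of continuous functions on the circle may be proved by induction. -/
theorem circle_induction {p : C(Circle, ℂ) → Prop} (closed : IsClosed {φ | p φ})
    (one : p 1) (add : ∀ x y, p x → p y → p (x + y)) (smul : ∀ (c : ℂ) x, p x → p (c • x))
    (mul_left : ∀ x, p x → p (circleCoord * x))
    (star_mul_left : ∀ x, p x → p (star circleCoord * x)) (φ : C(Circle, ℂ)) : p φ := by
  have htop := ContinuousMap.starSubalgebra_topologicalClosure_eq_top_of_separatesPoints
    (StarAlgebra.adjoin ℂ {circleCoord}) (fun z w hzw =>
      ⟨circleCoord, ⟨circleCoord, StarAlgebra.self_mem_adjoin_singleton ℂ _, rfl⟩,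
        fun h => hzw (Circle.ext h)⟩)
  have hφ : φ ∈ closure (StarAlgebra.adjoin ℂ {circleCoord} : Set C(Circle, ℂ)) := by
    have : φ ∈ (StarAlgebra.adjoin ℂ {circleCoord}).topologicalClosure := htop ▸ trivial
    exact this
  exact closure_minimal (fun x hx =>
    adjoin_singleton_induction circleCoord one add smul mul_left star_mul_left hx) closed hφ

theorem adjoint_shift_comp_shift (x : EllTwo ℕ) :
    ContinuousLinearMap.adjoint unilateralShift (unilateralShift x) = x :=
  congrArg (fun T => T x) (adjoint_pushIsometry_comp Nat.succ Nat.succ_injective)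

@[simp]
theorem unilateralShift_basisVec (n : ℕ) : unilateralShift (basisVec n) = basisVec (n + 1) :=
  pushIsometry_basisVec Nat.succ Nat.succ_injective n

theorem adjoint_pushIsometry_basisVec {X : Type v} {Y : Type w} (f : X → Y)
    (hf : Function.Injective f) (x : X) :
    ContinuousLinearMap.adjoint (pushIsometry f hf).toContinuousLinearMap (basisVec (f x)) =
      basisVec x := by
  rw [← pushIsometry_basisVec f hf]
  exact congrArg (fun T => T (basisVec x)) (adjoint_pushIsometry_comp f hf)

theorem adjoint_pushIsometry_basisVec_of_ne {X : Type v} {Y : Type w} (f : X → Y)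
    (hf : Function.Injective f) (y : Y) (hy : ∀ x, f x ≠ y) :
    ContinuousLinearMap.adjoint (pushIsometry f hf).toContinuousLinearMap (basisVec y) = 0 := by
  refine ext_inner_right ℂ fun g => ?_
  rw [ContinuousLinearMap.adjoint_inner_left, inner_zero_left]
  have : (innerSL ℂ (basisVec y)) ∘L (pushIsometry f hf).toContinuousLinearMap = 0 := by
    refine EllTwo.op_ext fun x => ?_
    have := (orthonormal_basisVec Y).2 (hy x).symm
    change inner ℂ (basisVec y) (pushIsometry f hf (basisVec x)) = 0
    rwa [pushIsometry_basisVec]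
  exact congrArg (fun T => T g) this

/-! ### The symbol map -/

/-- The unit vectors `(n + 1)^{-1/2} ∑_{j ≤ n} z^{-j} h_j`, which are asymptotically
eigenvectors of the shift with eigenvalue `z`. -/
noncomputable def approxEigvec (z : Circle) (n : ℕ) : EllTwo ℕ :=
  ((Real.sqrt (n + 1))⁻¹ : ℂ) • ∑ j ∈ Finset.range (n + 1), ((z : ℂ)⁻¹ ^ j) • basisVec j

theorem norm_approxEigvec (z : Circle) (n : ℕ) : ‖approxEigvec z n‖ = 1 := by
  have hz : ‖(z : ℂ)‖ = 1 := Circle.norm_coe z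
  unfold approxEigvec
  set v : EllTwo ℕ := ∑ j ∈ Finset.range (n + 1), ((z : ℂ)⁻¹ ^ j) • basisVec j with hv
  have h : ‖v‖ ^ 2 = n + 1 := by
    have h1 := (orthonormal_basisVec ℕ).inner_sum (fun j => (z : ℂ)⁻¹ ^ j)
      (fun j => (z : ℂ)⁻¹ ^ j) (Finset.range (n + 1))
    have h2 : ∀ j : ℕ, (starRingEnd ℂ) ((z : ℂ)⁻¹ ^ j) * (z : ℂ)⁻¹ ^ j = 1 := fun j => by
      rw [Complex.conj_mul', norm_pow, norm_inv, hz]; simp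
    rw [← hv, inner_self_eq_norm_sq_to_K] at h1
    simp only [h2, Finset.sum_const, Finset.card_range, nsmul_eq_mul, mul_one] at h1
    have h3 : ((‖v‖ ^ 2 : ℝ) : ℂ) = ((n + 1 : ℝ) : ℂ) := by
      rw [Complex.ofReal_pow]
      refine Eq.trans h1 ?_
      push_cast
      rfl
    exact Complex.ofReal_injective h3
  have hpos : (0 : ℝ) < n + 1 := by positivity
  rw [norm_smul, norm_inv, Complex.norm_real, Real.norm_of_nonneg (Real.sqrt_nonneg _),
    ← Real.sqrt_sq (norm_nonneg v), h]
  exact inv_mul_cancel₀ (Real.sqrt_pos.2 hpos).ne'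

theorem tendsto_inv_sqrt : Tendsto (fun n : ℕ => (Real.sqrt (n + 1))⁻¹) atTop (𝓝 0) :=
  tendsto_inv_atTop_zero.comp (Real.tendsto_sqrt_atTop.comp
    (tendsto_atTop_add_const_right _ _ tendsto_natCast_atTop_atTop))

theorem shift_approxEigvec_sub (z : Circle) (n : ℕ) :
    unilateralShift (approxEigvec z n) - (z : ℂ) • approxEigvec z n =
      ((Real.sqrt (n + 1))⁻¹ : ℂ) •
        (((z : ℂ)⁻¹ ^ n) • basisVec (n + 1) - (z : ℂ) • basisVec 0) := by
  rw [approxEigvec, map_smul, smul_comm, ← smul_sub]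
  congr 1
  have hz : (z : ℂ) ≠ 0 := z.coe_ne_zero
  induction n with
  | zero => simp
  | succ n ih =>
    rw [Finset.sum_range_succ, map_add, smul_add, add_sub_add_comm, ih, map_smul,
      unilateralShift_basisVec, smul_smul, pow_succ', ← mul_assoc, mul_inv_cancel₀ hz, one_mul]
    abel

/-- `T` has the asymptotic eigenvalue `c` on the approximate eigenvectors of the shift. -/
def HasSymbolAt (T : BddOp (EllTwo ℕ)) (z : Circle) (c : ℂ) : Prop :=
  Tendsto (fun n => T (approxEigvec z n) - c • approxEigvec z n) atTop (𝓝 0)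

namespace HasSymbolAt

variable {S T : BddOp (EllTwo ℕ)} {z : Circle} {c d : ℂ}

theorem shift (z : Circle) : HasSymbolAt unilateralShift z z := by
  refine squeeze_zero_norm (a := fun n : ℕ => (Real.sqrt (n + 1))⁻¹ * 2) (fun n => ?_)
    (by simpa using tendsto_inv_sqrt.mul_const 2)
  rw [shift_approxEigvec_sub, norm_smul, norm_inv, Complex.norm_real,
    Real.norm_of_nonneg (Real.sqrt_nonneg _)]
  gcongr
  refine (norm_sub_le _ _).trans ?_
  have h1 : ∀ j, ‖(basisVec j : EllTwo ℕ)‖ = 1 := (orthonormal_basisVec ℕ).1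
  have hz : ‖(z : ℂ)‖ = 1 := Circle.norm_coe z
  rw [norm_smul, norm_smul, h1, h1, norm_pow, norm_inv, hz]
  norm_num

theorem one : HasSymbolAt 1 z 1 := by
  simp [HasSymbolAt]

theorem add (hS : HasSymbolAt S z c) (hT : HasSymbolAt T z d) :
    HasSymbolAt (S + T) z (c + d) := by
  have h := Tendsto.add hS hT
  rw [add_zero] at h
  refine h.congr fun n => ?_
  rw [add_apply, add_smul]
  abel

theorem smul (a : ℂ) (hS : HasSymbolAt S z c) : HasSymbolAt (a • S) z (a * c) := by
  have h := Tendsto.const_smul hS a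
  rw [smul_zero] at h
  refine h.congr fun n => ?_
  rw [smul_sub, smul_smul]
  rfl

theorem mul (hS : HasSymbolAt S z c) (hT : HasSymbolAt T z d) :
    HasSymbolAt (S * T) z (c * d) := by
  have h := ((S.continuous.tendsto 0).comp hT).add (Tendsto.const_smul hS d)
  rw [map_zero, smul_zero, add_zero] at h
  refine h.congr fun n => ?_
  rw [Function.comp_apply, map_sub, map_smul, smul_sub, smul_smul, mul_comm d c]
  change _ = S (T _) - _
  abel

theorem star_shift (z : Circle) : HasSymbolAt (star unilateralShift) z (star (z : ℂ)) := by
  have h := Tendsto.const_smul (((star unilateralShift).continuous.tendsto 0).comp (shift z))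
    (-star (z : ℂ))
  rw [map_zero, smul_zero] at h
  refine h.congr fun n => ?_
  have e : star (z : ℂ) * (z : ℂ) = 1 := by
    change (starRingEnd ℂ) (z : ℂ) * (z : ℂ) = 1
    have hz : ‖(z : ℂ)‖ = 1 := Circle.norm_coe z
    rw [Complex.conj_mul', hz]; simp
  rw [Function.comp_apply, map_sub, map_smul, ContinuousLinearMap.star_eq_adjoint,
    adjoint_shift_comp_shift, smul_sub, smul_smul, neg_mul, e]
  simp only [neg_smul, one_smul]
  abel

theorem norm_sub_le (hS : HasSymbolAt S z c) (hT : HasSymbolAt T z d) :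
    ‖c - d‖ ≤ ‖S - T‖ := by
  have h : Tendsto (fun n => ‖(S - T) (approxEigvec z n) - (S (approxEigvec z n) -
      c • approxEigvec z n) + (T (approxEigvec z n) - d • approxEigvec z n)‖) atTop
      (𝓝 ‖c - d‖) := by
    refine tendsto_const_nhds.congr fun n => ?_
    have e : (S - T) (approxEigvec z n) - (S (approxEigvec z n) - c • approxEigvec z n) +
        (T (approxEigvec z n) - d • approxEigvec z n) = (c - d) • approxEigvec z n := by
      rw [sub_apply, sub_smul]; abel
    rw [e, norm_smul, norm_approxEigvec, mul_one]
  have h2 : Tendsto (fun n => ‖S - T‖ + ‖S (approxEigvec z n) - c • approxEigvec z n‖ +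
      ‖T (approxEigvec z n) - d • approxEigvec z n‖) atTop (𝓝 (‖S - T‖ + 0 + 0)) :=
    (tendsto_const_nhds.add (tendsto_zero_iff_norm_tendsto_zero.1 hS)).add
      (tendsto_zero_iff_norm_tendsto_zero.1 hT)
  rw [add_zero, add_zero] at h2
  refine le_of_tendsto_of_tendsto' h h2 fun n => ?_
  refine (norm_add_le _ _).trans (add_le_add_left ((_root_.norm_sub_le _ _).trans
    (add_le_add_left ?_ _)) _)
  simpa [norm_approxEigvec] using (S - T).le_opNorm (approxEigvec z n)

theorem unique (hS : HasSymbolAt S z c) (hS' : HasSymbolAt S z d) : c = d := by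
  have := hS.norm_sub_le hS'
  rwa [sub_self, norm_zero, norm_le_zero_iff, sub_eq_zero] at this

theorem of_tendsto {Tn : ℕ → BddOp (EllTwo ℕ)} {cn : ℕ → ℂ} (h : ∀ n, HasSymbolAt (Tn n) z (cn n))
    (hT : Tendsto Tn atTop (𝓝 T)) (hc : Tendsto cn atTop (𝓝 c)) : HasSymbolAt T z c := by
  rw [HasSymbolAt, Metric.tendsto_atTop]
  intro ε hε
  obtain ⟨m, hm1, hm2⟩ := ((Metric.tendsto_nhds.1 hT (ε / 3) (by positivity)).and
    (Metric.tendsto_nhds.1 hc (ε / 3) (by positivity))).exists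
  obtain ⟨N, hN⟩ := Metric.tendsto_atTop.1 (h m) (ε / 3) (by positivity)
  refine ⟨N, fun n hn => ?_⟩
  have h3 := hN n hn
  rw [dist_zero_right] at h3 ⊢
  rw [dist_comm, dist_eq_norm] at hm1 hm2
  have e : T (approxEigvec z n) - c • approxEigvec z n =
      (T - Tn m) (approxEigvec z n) - (c - cn m) • approxEigvec z n +
        (Tn m (approxEigvec z n) - cn m • approxEigvec z n) := by
    rw [sub_apply, sub_smul]; abel
  have h4 : ‖(T - Tn m) (approxEigvec z n)‖ ≤ ‖T - Tn m‖ := by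
    simpa [norm_approxEigvec] using (T - Tn m).le_opNorm (approxEigvec z n)
  have h5 : ‖(c - cn m) • approxEigvec z n‖ = ‖c - cn m‖ := by
    rw [norm_smul, norm_approxEigvec, mul_one]
  have h6 := norm_add_le ((T - Tn m) (approxEigvec z n) - (c - cn m) • approxEigvec z n)
    (Tn m (approxEigvec z n) - cn m • approxEigvec z n)
  have h7 := _root_.norm_sub_le ((T - Tn m) (approxEigvec z n)) ((c - cn m) • approxEigvec z n)
  rw [e]
  linarith

end HasSymbolAt

/-- The symbols of the elements of the Toeplitz algebra are continuous, as those of the generators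
are and as the uniform norm of the symbol is dominated by the norm of the operator. -/
theorem exists_symbol (b : ToeplitzAlg) :
    ∃ φ : C(Circle, ℂ), ∀ z, HasSymbolAt (toeplitzIncl b) z (φ z) := by
  induction b using ToeplitzAlg.induction with
  | closed =>
    refine IsSeqClosed.isClosed fun x b hx hb => ?_
    choose φ hφ using hx
    have hdist : ∀ m n, dist (φ m) (φ n) ≤ dist (x m) (x n) := fun m n => by
      refine (ContinuousMap.dist_le dist_nonneg).2 fun z => ?_
      rw [dist_eq_norm, dist_eq_norm, ← norm_toeplitzIncl, map_sub]
      exact (hφ m z).norm_sub_le (hφ n z)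
    have hcau : CauchySeq φ := by
      refine Metric.cauchySeq_iff.2 fun ε hε => ?_
      obtain ⟨N, hN⟩ := Metric.cauchySeq_iff.1 hb.cauchySeq ε hε
      exact ⟨N, fun m hm n hn => (hdist m n).trans_lt (hN m hm n hn)⟩
    obtain ⟨ψ, hψ⟩ := cauchySeq_tendsto_of_complete hcau
    exact ⟨ψ, fun z => HasSymbolAt.of_tendsto (fun n => hφ n z)
      ((isometry_toeplitzIncl.continuous.tendsto b).comp hb)
      (((continuous_eval_const z).tendsto ψ).comp hψ)⟩
  | one => exact ⟨1, fun z => by rw [map_one]; exact HasSymbolAt.one⟩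
  | add x y hx hy =>
    obtain ⟨φ, hφ⟩ := hx
    obtain ⟨ψ, hψ⟩ := hy
    exact ⟨φ + ψ, fun z => by rw [map_add]; exact (hφ z).add (hψ z)⟩
  | smul c x hx =>
    obtain ⟨φ, hφ⟩ := hx
    exact ⟨c • φ, fun z => by rw [map_smul]; exact (hφ z).smul c⟩
  | mul_left x hx =>
    obtain ⟨φ, hφ⟩ := hx
    exact ⟨circleCoord * φ, fun z => by
      rw [map_mul]; exact (HasSymbolAt.shift z).mul (hφ z)⟩
  | star_mul_left x hx =>
    obtain ⟨φ, hφ⟩ := hx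
    exact ⟨star circleCoord * φ, fun z => by
      rw [map_mul, map_star]; exact (HasSymbolAt.star_shift z).mul (hφ z)⟩

/-- The symbol of an element of the Toeplitz algebra. -/
noncomputable def symbolFun (b : ToeplitzAlg) : C(Circle, ℂ) := (exists_symbol b).choose

theorem hasSymbolAt_symbolFun (b : ToeplitzAlg) (z : Circle) :
    HasSymbolAt (toeplitzIncl b) z (symbolFun b z) :=
  (exists_symbol b).choose_spec z

theorem symbolFun_eq {b : ToeplitzAlg} {φ : C(Circle, ℂ)}
    (h : ∀ z, HasSymbolAt (toeplitzIncl b) z (φ z)) : symbolFun b = φ :=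
  ContinuousMap.ext fun z => (hasSymbolAt_symbolFun b z).unique (h z)

theorem symbolFun_add (a b : ToeplitzAlg) : symbolFun (a + b) = symbolFun a + symbolFun b :=
  symbolFun_eq fun z => by
    rw [map_add]; exact (hasSymbolAt_symbolFun a z).add (hasSymbolAt_symbolFun b z)

theorem symbolFun_mul (a b : ToeplitzAlg) : symbolFun (a * b) = symbolFun a * symbolFun b :=
  symbolFun_eq fun z => by
    rw [map_mul]; exact (hasSymbolAt_symbolFun a z).mul (hasSymbolAt_symbolFun b z)

theorem symbolFun_smul (c : ℂ) (b : ToeplitzAlg) : symbolFun (c • b) = c • symbolFun b :=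
  symbolFun_eq fun z => by
    rw [map_smul]; exact (hasSymbolAt_symbolFun b z).smul c

theorem symbolFun_one : symbolFun 1 = 1 :=
  symbolFun_eq fun z => by rw [map_one]; exact HasSymbolAt.one

theorem symbolFun_shiftT : symbolFun shiftT = circleCoord :=
  symbolFun_eq HasSymbolAt.shift

theorem symbolFun_star_shiftT : symbolFun (star shiftT) = star circleCoord :=
  symbolFun_eq fun z => by rw [map_star]; exact HasSymbolAt.star_shift z

theorem lipschitzWith_symbolFun : LipschitzWith 1 symbolFun :=
  LipschitzWith.of_dist_le_mul fun a b => by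
    rw [NNReal.coe_one, one_mul]
    refine (ContinuousMap.dist_le dist_nonneg).2 fun z => ?_
    rw [dist_eq_norm, dist_eq_norm, ← norm_toeplitzIncl, map_sub]
    exact (hasSymbolAt_symbolFun a z).norm_sub_le (hasSymbolAt_symbolFun b z)

theorem symbolFun_star (b : ToeplitzAlg) : symbolFun (star b) = star (symbolFun b) := by
  have hc := lipschitzWith_symbolFun.continuous
  induction b using ToeplitzAlg.induction with
  | closed => exact isClosed_eq (hc.comp continuous_star) hc.star
  | one => rw [star_one, symbolFun_one, star_one]
  | add x y hx hy => rw [star_add, symbolFun_add, symbolFun_add, hx, hy, star_add]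
  | smul c x hx => rw [star_smul, symbolFun_smul, symbolFun_smul, hx, star_smul]
  | mul_left x hx =>
    rw [star_mul, symbolFun_mul, symbolFun_mul, hx, symbolFun_shiftT, symbolFun_star_shiftT,
      star_mul]
  | star_mul_left x hx =>
    rw [star_mul, symbolFun_mul, symbolFun_mul, hx, star_star, symbolFun_shiftT,
      symbolFun_star_shiftT, star_mul, star_star]

/-- The symbol map of the Toeplitz algebra. -/
noncomputable def symbolHom : ToeplitzAlg →⋆ₐ[ℂ] C(Circle, ℂ) where
  toFun := symbolFun
  map_one' := symbolFun_one
  map_mul' := symbolFun_mul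
  map_zero' := by simpa using symbolFun_smul 0 0
  map_add' := symbolFun_add
  commutes' c := by
    rw [Algebra.algebraMap_eq_smul_one, Algebra.algebraMap_eq_smul_one, symbolFun_smul,
      symbolFun_one]
  map_star' := symbolFun_star

theorem symbolHom_shiftT : symbolHom shiftT = circleCoord := symbolFun_shiftT

theorem continuous_symbolHom : Continuous symbolHom := lipschitzWith_symbolFun.continuous

theorem hasSymbolAt_symbolHom (b : ToeplitzAlg) (z : Circle) :
    HasSymbolAt (toeplitzIncl b) z (symbolHom b z) := hasSymbolAt_symbolFun b z

/-! ### Toeplitz operators -/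

/-- The bilateral shift on `ℓ²(ℤ)`. -/
noncomputable def bilateralShift : BddOp (EllTwo ℤ) := permOp (Equiv.addRight (1 : ℤ))

@[simp]
theorem bilateralShift_basisVec (k : ℤ) : bilateralShift (basisVec k) = basisVec (k + 1) :=
  permOp_basisVec _ k

theorem bilateralShift_mem_unitary : bilateralShift ∈ unitary (BddOp (EllTwo ℤ)) := by
  rw [Unitary.mem_iff]
  constructor
  · rw [ContinuousLinearMap.star_eq_adjoint, bilateralShift, adjoint_permOp]
    exact permOp_symm_comp _
  · rw [ContinuousLinearMap.star_eq_adjoint, bilateralShift, adjoint_permOp]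
    exact permOp_symm_comp (Equiv.addRight (1 : ℤ)).symm

theorem isStarNormal_bilateralShift : IsStarNormal bilateralShift :=
  ⟨by
    have h := Unitary.mem_iff.1 bilateralShift_mem_unitary
    rw [commute_iff_eq, h.1, h.2]⟩

/-- The representation of `C(𝕋)` on `ℓ²(ℤ)` that maps the coordinate to the bilateral shift,
given by the functional calculus of this unitary. -/
noncomputable def circleRep : C(Circle, ℂ) →⋆ₐ[ℂ] BddOp (EllTwo ℤ) :=
  (cfcHom (R := ℂ) (a := bilateralShift)
    isStarNormal_bilateralShift).comp
    (ContinuousMap.compStarAlgHom' ℂ ℂ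
      ⟨fun x : spectrum ℂ bilateralShift => (⟨x.1, by
        have h := Unitary.spectrum_subset_circle (𝕜 := ℂ)
          ⟨bilateralShift, bilateralShift_mem_unitary⟩ x.2
        exact h⟩ : Circle), by fun_prop⟩)

theorem circleRep_circleCoord : circleRep circleCoord = bilateralShift :=
  cfcHom_id (R := ℂ) isStarNormal_bilateralShift

/-- The inclusion `ℓ²(ℕ) → ℓ²(ℤ)`. -/
noncomputable def natIncl : EllTwo ℕ →L[ℂ] EllTwo ℤ :=
  (pushIsometry (fun n : ℕ => (n : ℤ)) Nat.cast_injective).toContinuousLinearMap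

@[simp]
theorem natIncl_basisVec (n : ℕ) : natIncl (basisVec n) = basisVec (n : ℤ) :=
  pushIsometry_basisVec _ Nat.cast_injective n

theorem bilateralShift_comp_natIncl :
    bilateralShift ∘L natIncl = natIncl ∘L unilateralShift :=
  EllTwo.op_ext fun n => by simp

/-- The Toeplitz operator with continuous symbol `φ`: the compression of `φ(U)` to `ℓ²(ℕ)`,
for the bilateral shift `U`. -/
noncomputable def toeplitzOp : C(Circle, ℂ) →L[ℂ] BddOp (EllTwo ℕ) :=
  LinearMap.mkContinuous
    { toFun := fun φ => ContinuousLinearMap.adjoint natIncl ∘L circleRep φ ∘L natIncl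
      map_add' := fun φ ψ => by ext1 x; simp
      map_smul' := fun c φ => by ext1 x; simp }
    (‖ContinuousLinearMap.adjoint natIncl‖ * ‖natIncl‖) fun φ => by
      refine (ContinuousLinearMap.opNorm_comp_le _ _).trans ?_
      rw [mul_assoc]
      refine mul_le_mul_of_nonneg_left ?_ (norm_nonneg _)
      refine (ContinuousLinearMap.opNorm_comp_le _ _).trans ?_
      rw [mul_comm]
      exact mul_le_mul_of_nonneg_left (NonUnitalStarAlgHom.norm_apply_le circleRep φ)
        (norm_nonneg _)

theorem toeplitzOp_apply (φ : C(Circle, ℂ)) :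
    toeplitzOp φ = ContinuousLinearMap.adjoint natIncl ∘L circleRep φ ∘L natIncl := rfl

theorem toeplitzOp_one : toeplitzOp 1 = 1 := by
  rw [toeplitzOp_apply, map_one]
  exact adjoint_pushIsometry_comp _ _

theorem toeplitzOp_mul_coord (φ : C(Circle, ℂ)) :
    toeplitzOp (φ * circleCoord) = toeplitzOp φ * unilateralShift := by
  rw [toeplitzOp_apply, toeplitzOp_apply, map_mul, circleRep_circleCoord,
    ContinuousLinearMap.mul_def, ContinuousLinearMap.mul_def, ContinuousLinearMap.comp_assoc,
    bilateralShift_comp_natIncl]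
  rfl

theorem toeplitzOp_star_coord_mul (φ : C(Circle, ℂ)) :
    toeplitzOp (star circleCoord * φ) = star unilateralShift * toeplitzOp φ := by
  have h := congrArg ContinuousLinearMap.adjoint bilateralShift_comp_natIncl
  rw [ContinuousLinearMap.adjoint_comp, ContinuousLinearMap.adjoint_comp] at h
  rw [toeplitzOp_apply, toeplitzOp_apply, map_mul, map_star, circleRep_circleCoord,
    ContinuousLinearMap.mul_def, ContinuousLinearMap.mul_def, ContinuousLinearMap.star_eq_adjoint,
    ContinuousLinearMap.star_eq_adjoint, ← ContinuousLinearMap.comp_assoc,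
    ← ContinuousLinearMap.comp_assoc, h]
  rfl

/-- The compression to `ℓ²(ℕ)` fails to be multiplicative for left multiplication by the shift
only by an operator of rank one. -/
theorem adjoint_natIncl_comp_bilateralShift :
    ContinuousLinearMap.adjoint natIncl ∘L bilateralShift -
        unilateralShift ∘L ContinuousLinearMap.adjoint natIncl =
      (innerSL ℂ (basisVec (-1 : ℤ))).smulRight (basisVec 0 : EllTwo ℕ) := by
  have hpos : ∀ n : ℕ, ContinuousLinearMap.adjoint natIncl (basisVec (n : ℤ)) = basisVec n :=
    adjoint_pushIsometry_basisVec (fun n : ℕ => (n : ℤ)) Nat.cast_injective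
  have hneg : ∀ k : ℤ, k < 0 → ContinuousLinearMap.adjoint natIncl (basisVec k) = 0 :=
    fun k hk => adjoint_pushIsometry_basisVec_of_ne (fun n : ℕ => (n : ℤ)) Nat.cast_injective k
      fun n hn => by omega
  have hortho := orthonormal_iff_ite.1 (orthonormal_basisVec ℤ)
  refine EllTwo.op_ext fun k => ?_
  simp only [sub_apply, ContinuousLinearMap.comp_apply, bilateralShift_basisVec,
    ContinuousLinearMap.smulRight_apply, innerSL_apply_apply, hortho]
  rcases lt_or_ge k 0 with hk | hk
  · rw [hneg k hk, map_zero, sub_zero]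
    by_cases h1 : -1 = k
    · subst h1
      rw [if_pos rfl, one_smul]
      exact hpos 0
    · rw [if_neg h1, zero_smul]
      exact hneg _ (by omega)
  · lift k to ℕ using hk
    have h1 : (-1 : ℤ) ≠ k := by omega
    have h2 : (k : ℤ) + 1 = ((k + 1 : ℕ) : ℤ) := by push_cast; rfl
    rw [if_neg h1, zero_smul, h2, hpos, hpos, unilateralShift_basisVec, sub_self]

theorem isCompactOperator_toeplitzOp_coord_mul_sub (φ : C(Circle, ℂ)) :
    IsCompactOperator (unilateralShift * toeplitzOp φ - toeplitzOp (circleCoord * φ)) := by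
  have h1 : IsCompactOperator
      ((innerSL ℂ (basisVec (-1 : ℤ))).smulRight (basisVec 0 : EllTwo ℕ)) :=
    (isCompactOperator_of_locallyCompactSpace_dom (innerSL ℂ (basisVec (-1 : ℤ)))).clm_comp
      ((ContinuousLinearMap.id ℂ ℂ).smulRight (basisVec 0 : EllTwo ℕ))
  rw [← adjoint_natIncl_comp_bilateralShift] at h1
  have e : unilateralShift * toeplitzOp φ - toeplitzOp (circleCoord * φ) =
      -((ContinuousLinearMap.adjoint natIncl ∘L bilateralShift -
        unilateralShift ∘L ContinuousLinearMap.adjoint natIncl) ∘L (circleRep φ ∘L natIncl)) := by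
    ext1 x
    rw [toeplitzOp_apply, toeplitzOp_apply, map_mul, circleRep_circleCoord]
    simp [ContinuousLinearMap.mul_def]
  rw [e]
  exact (h1.comp_clm (circleRep φ ∘L natIncl)).neg

/-- Modulo the compact operators, an element of the Toeplitz algebra is the Toeplitz operator
of its symbol. -/
theorem isCompactOperator_sub_toeplitzOp (b : ToeplitzAlg) :
    IsCompactOperator (toeplitzIncl b - toeplitzOp (symbolHom b)) := by
  induction b using ToeplitzAlg.induction with
  | closed =>
    exact isClosed_setOfPred_isCompactOperator.preimage
      (isometry_toeplitzIncl.continuous.sub (toeplitzOp.continuous.comp continuous_symbolHom))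
  | one =>
    rw [map_one, map_one, toeplitzOp_one, sub_self]
    exact isCompactOperator_zero
  | add x y hx hy =>
    rw [map_add, map_add, map_add, add_sub_add_comm]
    exact hx.add hy
  | smul c x hx =>
    rw [map_smul, map_smul, map_smul, ← smul_sub]
    exact hx.smul c
  | mul_left x hx =>
    have e : toeplitzIncl (shiftT * x) - toeplitzOp (symbolHom (shiftT * x)) =
        unilateralShift * (toeplitzIncl x - toeplitzOp (symbolHom x)) +
          (unilateralShift * toeplitzOp (symbolHom x) -
            toeplitzOp (circleCoord * symbolHom x)) := by
      rw [map_mul, map_mul, symbolHom_shiftT, toeplitzIncl_shiftT, mul_sub]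
      abel
    rw [e]
    exact (hx.clm_comp unilateralShift).add (isCompactOperator_toeplitzOp_coord_mul_sub _)
  | star_mul_left x hx =>
    rw [map_mul, map_mul, map_star, map_star, symbolHom_shiftT, toeplitzIncl_shiftT,
      toeplitzOp_star_coord_mul, ← mul_sub]
    exact hx.clm_comp (star unilateralShift)

theorem toeplitzOp_mem (φ : C(Circle, ℂ)) : ∃ b, toeplitzIncl b = toeplitzOp φ := by
  induction φ using circle_induction with
  | closed => exact isClosed_range_toeplitzIncl.preimage toeplitzOp.continuous
  | one => exact ⟨1, by rw [map_one, toeplitzOp_one]⟩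
  | add φ ψ hφ hψ =>
    obtain ⟨a, ha⟩ := hφ
    obtain ⟨b, hb⟩ := hψ
    exact ⟨a + b, by rw [map_add, map_add, ha, hb]⟩
  | smul c φ hφ =>
    obtain ⟨a, ha⟩ := hφ
    exact ⟨c • a, by rw [map_smul, map_smul, ha]⟩
  | mul_left φ hφ =>
    obtain ⟨a, ha⟩ := hφ
    exact ⟨a * shiftT, by rw [map_mul, mul_comm, toeplitzOp_mul_coord, ha, toeplitzIncl_shiftT]⟩
  | star_mul_left φ hφ =>
    obtain ⟨a, ha⟩ := hφ
    exact ⟨star shiftT * a, by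
      rw [map_mul, toeplitzOp_star_coord_mul, ha, map_star, toeplitzIncl_shiftT]⟩

/-- The Toeplitz operator with symbol `φ` as an element of the Toeplitz algebra. -/
noncomputable def toeplitzLift (φ : C(Circle, ℂ)) : ToeplitzAlg := (toeplitzOp_mem φ).choose

theorem toeplitzIncl_toeplitzLift (φ : C(Circle, ℂ)) :
    toeplitzIncl (toeplitzLift φ) = toeplitzOp φ := (toeplitzOp_mem φ).choose_spec

/-- The section `φ ↦ T_φ` of the symbol map given by the Toeplitz operators. -/
noncomputable def toeplitzSection : C(Circle, ℂ) →L[ℂ] ToeplitzAlg :=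
  LinearMap.mkContinuous
    { toFun := toeplitzLift
      map_add' := fun φ ψ => isometry_toeplitzIncl.injective (by
        simp only [map_add, toeplitzIncl_toeplitzLift])
      map_smul' := fun c φ => isometry_toeplitzIncl.injective (by
        simp only [map_smul, toeplitzIncl_toeplitzLift, RingHom.id_apply]) }
    ‖toeplitzOp‖ fun φ => by
      rw [← norm_toeplitzIncl, LinearMap.coe_mk, AddHom.coe_mk, toeplitzIncl_toeplitzLift]
      exact toeplitzOp.le_opNorm φ

theorem toeplitzIncl_toeplitzSection (φ : C(Circle, ℂ)) :
    toeplitzIncl (toeplitzSection φ) = toeplitzOp φ := toeplitzIncl_toeplitzLift φ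

theorem symbolHom_toeplitzSection (φ : C(Circle, ℂ)) : symbolHom (toeplitzSection φ) = φ := by
  have h1 : toeplitzSection 1 = 1 := isometry_toeplitzIncl.injective (by
    rw [toeplitzIncl_toeplitzSection, toeplitzOp_one, map_one])
  have h2 : ∀ φ, toeplitzSection (φ * circleCoord) = toeplitzSection φ * shiftT := fun φ =>
    isometry_toeplitzIncl.injective (by
      rw [toeplitzIncl_toeplitzSection, toeplitzOp_mul_coord, map_mul,
        toeplitzIncl_toeplitzSection, toeplitzIncl_shiftT])
  have h3 : ∀ φ, toeplitzSection (star circleCoord * φ) = star shiftT * toeplitzSection φ :=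
    fun φ => isometry_toeplitzIncl.injective (by
      rw [toeplitzIncl_toeplitzSection, toeplitzOp_star_coord_mul, map_mul, map_star,
        toeplitzIncl_toeplitzSection, toeplitzIncl_shiftT])
  induction φ using circle_induction with
  | closed => exact isClosed_eq (continuous_symbolHom.comp toeplitzSection.continuous) continuous_id
  | one => rw [h1, map_one]
  | add φ ψ hφ hψ => rw [map_add, map_add, hφ, hψ]
  | smul c φ hφ => rw [map_smul, map_smul, hφ]
  | mul_left φ hφ => rw [mul_comm, h2, map_mul, hφ, symbolHom_shiftT]
  | star_mul_left φ hφ => rw [h3, map_mul, hφ, map_star, symbolHom_shiftT]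

theorem tendsto_inner_basisVec_approxEigvec (z : Circle) (j : ℕ) :
    Tendsto (fun n => inner ℂ (basisVec j) (approxEigvec z n)) atTop (𝓝 0) := by
  have hortho := orthonormal_iff_ite.1 (orthonormal_basisVec ℕ)
  refine squeeze_zero_norm (fun n => ?_) tendsto_inv_sqrt
  rw [approxEigvec, inner_smul_right, norm_mul, norm_inv, Complex.norm_real,
    Real.norm_of_nonneg (Real.sqrt_nonneg _), inner_sum]
  refine mul_le_of_le_one_right (by positivity) ?_
  simp only [inner_smul_right, hortho, mul_ite, mul_one, mul_zero, Finset.sum_ite_eq]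
  have hz : ‖(z : ℂ)‖ = 1 := Circle.norm_coe z
  split_ifs
  · rw [norm_pow, norm_inv, hz]; simp
  · simp

/-- The kernel of the symbol map consists of the compact operators in the Toeplitz algebra: the
approximate eigenvectors converge weakly to zero, so a compact operator has symbol zero. -/
theorem isCompactOperator_toeplitzIncl_iff (b : ToeplitzAlg) :
    IsCompactOperator (toeplitzIncl b) ↔ symbolHom b = 0 := by
  constructor
  · intro hb
    ext z
    have hs := hasSymbolAt_symbolHom b z
    set c := symbolHom b z
    obtain ⟨K, hK, hK'⟩ := (isCompactOperator_iff_image_closedBall_subset_compact (𝕜₁ := ℂ)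
      (toeplitzIncl b : EllTwo ℕ →ₗ[ℂ] EllTwo ℕ) zero_lt_one).1 hb
    obtain ⟨y, -, f, hf, hy⟩ := hK.tendsto_subseq (x := fun n => toeplitzIncl b (approxEigvec z n))
      fun n => hK' ⟨_, by simp [norm_approxEigvec], rfl⟩
    have h1 : Tendsto (fun n => c • approxEigvec z (f n)) atTop (𝓝 y) := by
      have := hy.sub (hs.comp hf.tendsto_atTop)
      rw [sub_zero] at this
      refine this.congr fun n => ?_
      simp
    have h2 : ∀ j : ℕ, inner ℂ (basisVec j) y = 0 := fun j => by
      have h3 := (tendsto_inner_basisVec_approxEigvec z j).comp hf.tendsto_atTop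
      have h4 := h3.const_mul c
      rw [mul_zero] at h4
      have h5 := ((innerSL ℂ (basisVec j)).continuous.tendsto y).comp h1
      refine tendsto_nhds_unique h5 (h4.congr fun n => ?_)
      simp [inner_smul_right]
    have h3 : y = 0 := by
      have h : innerSL ℂ y = 0 := EllTwo.op_ext fun j => by
        rw [innerSL_apply_apply, ← inner_conj_symm, h2]
        simp
      have := congrArg (fun T => T y) h
      simpa using this
    have h4 := h1.norm
    rw [h3, norm_zero] at h4
    have h5 : Tendsto (fun n : ℕ => ‖c • approxEigvec z (f n)‖) atTop (𝓝 ‖c‖) := by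
      refine tendsto_const_nhds.congr fun n => ?_
      rw [norm_smul, norm_approxEigvec, mul_one]
    exact norm_eq_zero.1 (tendsto_nhds_unique h5 h4)
  · intro hb
    have := isCompactOperator_sub_toeplitzOp b
    rwa [hb, map_zero, sub_zero] at this

/-! ### The tensor products `C₀(X) ⊗ A` -/

section Tensor

variable {X : Type u} [TopologicalSpace X] {A : Type v} [CStarAlgebra A] {B : Type w}
  [CStarAlgebra B]

theorem elemTensor_apply (a : C₀(X, ℂ)) (b : A) (x : X) : elemTensor a b x = a x • b := rfl

theorem elemTensor_mem (a : C₀(X, ℂ)) (b : A) : elemTensor a b ∈ C0Tensor X A :=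
  subset_closure (NonUnitalStarAlgebra.subset_adjoin ℂ _ ⟨a, b, rfl⟩)

theorem isClosed_C0Tensor : IsClosed (C0Tensor X A : Set C₀(X, A)) :=
  NonUnitalStarSubalgebra.isClosed_topologicalClosure _

theorem elemTensor_mul (a a' : C₀(X, ℂ)) (b b' : A) :
    elemTensor a b * elemTensor a' b' = elemTensor (a * a') (b * b') := by
  ext x
  exact smul_mul_smul_comm _ _ _ _

theorem star_elemTensor (a : C₀(X, ℂ)) (b : A) :
    star (elemTensor a b) = elemTensor (star a) (star b) := by
  ext x
  exact star_smul _ _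

theorem norm_elemTensor_le (a : C₀(X, ℂ)) (b : A) : ‖elemTensor a b‖ ≤ ‖a‖ * ‖b‖ := by
  change ‖(elemTensor a b).toBCF‖ ≤ _
  refine (BoundedContinuousFunction.norm_le (by positivity)).2 fun x => ?_
  change ‖a x • b‖ ≤ _
  rw [norm_smul]
  gcongr
  exact a.toBCF.norm_coe_le_norm x

/-- The elementary tensors span a dense subspace, since they are closed under products and
adjoints. -/
theorem mem_closure_span_of_mem_C0Tensor {f : C₀(X, A)} (hf : f ∈ C0Tensor X A) :
    f ∈ closure (Submodule.span ℂ {f | ∃ (a : C₀(X, ℂ)) (b : A), f = elemTensor a b} :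
      Set C₀(X, A)) := by
  refine closure_mono (fun x hx => ?_) hf
  rw [SetLike.mem_coe] at hx ⊢
  induction hx using NonUnitalStarAlgebra.adjoin_induction with
  | mem x hx => exact Submodule.subset_span hx
  | add x y _ _ hx hy => exact add_mem hx hy
  | zero => exact zero_mem _
  | smul c x _ hx => exact Submodule.smul_mem _ c hx
  | mul x y hx' hy' hx hy =>
    clear hx' hy'
    induction hx using Submodule.span_induction with
    | mem x hx =>
      obtain ⟨a, b, rfl⟩ := hx
      induction hy using Submodule.span_induction with
      | mem y hy =>
        obtain ⟨a', b', rfl⟩ := hy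
        exact Submodule.subset_span ⟨_, _, elemTensor_mul _ _ _ _⟩
      | zero => rw [mul_zero]; exact zero_mem _
      | add y y' _ _ hy hy' => rw [mul_add]; exact add_mem hy hy'
      | smul c y _ hy => rw [mul_smul_comm]; exact Submodule.smul_mem _ c hy
    | zero => rw [zero_mul]; exact zero_mem _
    | add x x' _ _ hx hx' => rw [add_mul]; exact add_mem hx hx'
    | smul c x _ hx => rw [smul_mul_assoc]; exact Submodule.smul_mem _ c hx
  | star x hx' hx =>
    clear hx'
    induction hx using Submodule.span_induction with
    | mem x hx =>
      obtain ⟨a, b, rfl⟩ := hx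
      exact Submodule.subset_span ⟨_, _, star_elemTensor _ _⟩
    | zero => rw [star_zero]; exact zero_mem _
    | add x x' _ _ hx hx' => rw [star_add]; exact add_mem hx hx'
    | smul c x _ hx => rw [star_smul]; exact Submodule.smul_mem _ _ hx

theorem ZeroAtInftyContinuousMap.norm_apply_le_norm (f : C₀(X, A)) (x : X) : ‖f x‖ ≤ ‖f‖ :=
  f.toBCF.norm_coe_le_norm x

theorem ZeroAtInftyContinuousMap.norm_le_of_forall {f : C₀(X, A)} {r : ℝ} (hr : 0 ≤ r) (h : ∀ x, ‖f x‖ ≤ r) : ‖f‖ ≤ r :=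
  (BoundedContinuousFunction.norm_le (f := f.toBCF) hr).2 h

/-- The composition of `L` with a function vanishing at infinity. -/
noncomputable def compC0 (L : A →L[ℂ] B) (f : C₀(X, A)) : C₀(X, B) where
  toFun x := L (f x)
  continuous_toFun := L.continuous.comp f.continuous
  zero_at_infty' := by
    have h := (L.continuous.tendsto 0).comp f.zero_at_infty'
    rwa [map_zero] at h

/-- The map `id ⊗ L` of functions vanishing at infinity, for a bounded linear map `L`. -/
noncomputable def mapC0 (L : A →L[ℂ] B) : C₀(X, A) →L[ℂ] C₀(X, B) :=
  LinearMap.mkContinuous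
    { toFun := compC0 L
      map_add' := fun f g => ZeroAtInftyContinuousMap.ext fun x => map_add L (f x) (g x)
      map_smul' := fun c f => ZeroAtInftyContinuousMap.ext fun x => map_smul L c (f x) }
    ‖L‖ fun f => ZeroAtInftyContinuousMap.norm_le_of_forall (by positivity) fun x => (L.le_opNorm _).trans
        (mul_le_mul_of_nonneg_left (ZeroAtInftyContinuousMap.norm_apply_le_norm f x) (norm_nonneg _))

theorem mapC0_mem (L : A →L[ℂ] B) {f : C₀(X, A)} (hf : f ∈ C0Tensor X A) :
    mapC0 L f ∈ C0Tensor X B := by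
  refine closure_minimal (s := (Submodule.span ℂ {f | ∃ (a : C₀(X, ℂ)) (b : A),
    f = elemTensor a b} : Set C₀(X, A))) (t := mapC0 L ⁻¹' (C0Tensor X B)) ?_
    (isClosed_C0Tensor.preimage (mapC0 L).continuous) (mem_closure_span_of_mem_C0Tensor hf)
  intro f hf
  induction hf using Submodule.span_induction with
  | mem f hf =>
    obtain ⟨a, b, rfl⟩ := hf
    have e : mapC0 L (elemTensor a b) = elemTensor a (L b) := by
      ext x; exact map_smul L _ _
    rw [Set.mem_preimage, e]
    exact elemTensor_mem _ _
  | zero => rw [Set.mem_preimage, map_zero]; exact zero_mem (C0Tensor X B)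
  | add x y _ _ hx hy =>
    rw [Set.mem_preimage, map_add]; exact add_mem (S := NonUnitalStarSubalgebra ℂ C₀(X, B)) hx hy
  | smul c x _ hx =>
    rw [Set.mem_preimage, map_smul]; exact SMulMemClass.smul_mem (s := C0Tensor X B) c hx

/-- A function vanishing at infinity is approximated by its products with compactly supported
real cut-off functions; neither the Hausdorff property nor local compactness is needed since the
cut-off is a function of the absolute value. -/
theorem exists_cutoff (a : C₀(X, ℂ)) {ε : ℝ} (hε : 0 < ε) :
    ∃ χ : C(X, ℂ), HasCompactSupport χ ∧ (∀ x, star (χ x) = χ x) ∧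
      ∀ x, ‖a x - χ x * a x‖ ≤ ε := by
  -- `g` vanishes on `[0, ε / 2]` and is `1` on `[ε, ∞)`.
  let g : ℝ → ℝ := fun t => max 0 (min 1 (2 * t / ε - 1))
  have hg : Continuous g := by fun_prop
  refine ⟨⟨fun x => (g ‖a x‖ : ℂ), by fun_prop⟩, ?_, fun x => Complex.conj_ofReal _, fun x => ?_⟩
  · have h1 : ∀ᶠ x in cocompact X, ‖a x‖ < ε / 2 := by
      have := a.zero_at_infty'.norm
      rw [norm_zero] at this
      exact this.eventually (gt_mem_nhds (by positivity))
    obtain ⟨K, hK, hK'⟩ := mem_cocompact.1 h1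
    have hcl : IsClosed {x | ε / 2 ≤ ‖a x‖} :=
      isClosed_le continuous_const a.continuous.norm
    have hcomp : IsCompact {x | ε / 2 ≤ ‖a x‖} := hK.of_isClosed_subset hcl fun x hx => by
      by_contra hxK
      exact absurd (show ‖a x‖ < ε / 2 from hK' hxK) (not_lt.2 hx)
    refine hcomp.of_isClosed_subset (isClosed_tsupport _) (closure_minimal (fun x hx => ?_) hcl)
    by_contra hlt
    refine hx ?_
    have hlt : ‖a x‖ < ε / 2 := not_le.1 hlt
    have h2 : 2 * ‖a x‖ / ε - 1 ≤ 0 := by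
      rw [sub_nonpos, div_le_one hε]; linarith
    change ((g ‖a x‖ : ℝ) : ℂ) = 0
    rw [Complex.ofReal_eq_zero]
    exact max_eq_left ((min_le_right _ _).trans h2)
  · change ‖a x - (g ‖a x‖ : ℂ) * a x‖ ≤ ε
    have e : a x - (g ‖a x‖ : ℂ) * a x = ((1 - g ‖a x‖ : ℝ) : ℂ) * a x := by
      push_cast; ring
    have h0 : 0 ≤ g ‖a x‖ := le_max_left _ _
    have h1 : g ‖a x‖ ≤ 1 := max_le zero_le_one (min_le_left _ _)
    rw [e, norm_mul, Complex.norm_real, Real.norm_of_nonneg (by linarith)]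
    rcases le_or_gt ‖a x‖ ε with h | h
    · exact (mul_le_of_le_one_left (norm_nonneg _) (by linarith)).trans h
    · have h2 : g ‖a x‖ = 1 := by
        have : 1 ≤ 2 * ‖a x‖ / ε - 1 := by
          rw [le_sub_iff_add_le, le_div_iff₀ hε]; linarith
        change max 0 (min 1 _) = 1
        rw [min_eq_left this]
        exact max_eq_right zero_le_one
      rw [h2, sub_self, zero_mul]
      exact hε.le

/-- The symbol map as a bounded linear map. -/
noncomputable def symbolCLM : ToeplitzAlg →L[ℂ] C(Circle, ℂ) where
  toFun := symbolHom
  map_add' := map_add symbolHom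
  map_smul' := map_smul symbolHom
  cont := continuous_symbolHom

/-- The homomorphism `id ⊗ τ` for the symbol map `τ`. -/
noncomputable def tensorSymbol : C0Tensor X ToeplitzAlg →⋆ₙₐ[ℂ] C0Tensor X C(Circle, ℂ) where
  toFun f := ⟨mapC0 symbolCLM f.1, mapC0_mem symbolCLM f.2⟩
  map_smul' c f := Subtype.ext (map_smul (mapC0 symbolCLM) c f.1)
  map_zero' := Subtype.ext (map_zero (mapC0 symbolCLM))
  map_add' f g := Subtype.ext (map_add (mapC0 symbolCLM) f.1 g.1)
  map_mul' f g := Subtype.ext (ZeroAtInftyContinuousMap.ext fun x =>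
    map_mul symbolHom (f.1 x) (g.1 x))
  map_star' f := Subtype.ext (ZeroAtInftyContinuousMap.ext fun x => map_star symbolHom (f.1 x))

theorem tensorSymbol_surjective :
    Function.Surjective (tensorSymbol : C0Tensor X ToeplitzAlg → C0Tensor X C(Circle, ℂ)) :=
  fun f => ⟨⟨mapC0 toeplitzSection f.1, mapC0_mem toeplitzSection f.2⟩, Subtype.ext
    (ZeroAtInftyContinuousMap.ext fun x => symbolHom_toeplitzSection (f.1 x))⟩

end Tensor

/-! ### Quivers with one loop at each vertex -/

/-- A map that preserves the distances in a closed subset of a complete space has a closed image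
of this subset. -/
theorem isClosed_image_of_dist_eq {α : Type v} {β : Type w} [MetricSpace α] [CompleteSpace α]
    [MetricSpace β] {f : α → β} {s : Set α} (hs : IsClosed s)
    (h : ∀ x ∈ s, ∀ y ∈ s, dist (f x) (f y) = dist x y) : IsClosed (f '' s) := by
  have : CompleteSpace s := hs.completeSpace_coe
  have hi : Isometry (s.domRestrict f) := Isometry.of_dist_eq fun x y => h x x.2 y y.2
  rw [← Set.range_domRestrict]
  exact hi.isClosedEmbedding.isClosed_range

namespace TopQuiver

variable {G : TopQuiver.{u}}

/-- The edges of `G` are loops, one at each vertex, with `θ` mapping an edge to its vertex. -/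
structure IsLoopQuiver (θ : G.Edge ≃ₜ G.V) : Prop where
  r_eq : ∀ x, G.r x = θ x
  s_eq : ∀ x, G.s x = θ x

namespace IsLoopQuiver

variable {θ : G.Edge ≃ₜ G.V} (hθ : IsLoopQuiver θ)

theorem represented (hθ : IsLoopQuiver θ) : G.Represented :=
  represented_of_compact fun _ _ => ⟨1, fun v => ⟨{θ.symm v}, (Finset.card_singleton _).le,
    fun β _ hβ => Finset.mem_singleton.2 (θ.eq_symm_apply.2 ((hθ.s_eq β).symm.trans hβ))⟩⟩

theorem rangeOf_replicate (hθ : IsLoopQuiver θ) (ω : G.V) (n : ℕ) :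
    G.rangeOf (List.replicate n (θ.symm ω)) ω = ω := by
  cases n with
  | zero => rfl
  | succ n => exact (hθ.r_eq _).trans (θ.apply_symm_apply ω)

/-- The path of length `n` that runs through the loop at `ω`. -/
def loopPath (hθ : IsLoopQuiver θ) (ω : G.V) (n : ℕ) : G.toDirGraph.Path where
  edges := List.replicate n (θ.symm ω)
  source := ω
  isPath := by
    induction n with
    | zero => trivial
    | succ n ih =>
      exact ⟨(hθ.s_eq _).trans ((θ.apply_symm_apply ω).trans (hθ.rangeOf_replicate ω n).symm), ih⟩

theorem range_loopPath (hθ : IsLoopQuiver θ) (ω : G.V) (n : ℕ) : (hθ.loopPath ω n).range = ω :=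
  hθ.rangeOf_replicate ω n

theorem loopPath_injective (hθ : IsLoopQuiver θ) (ω : G.V) :
    Function.Injective (hθ.loopPath ω) := fun m n h => by
  have h1 := congrArg DirGraph.Path.length h
  rwa [DirGraph.Path.length, DirGraph.Path.length, loopPath, loopPath, List.length_replicate,
    List.length_replicate] at h1

theorem eq_replicate (hθ : IsLoopQuiver θ) (l : List G.Edge) (v : G.V) (h : G.IsPath l v) :
    l = List.replicate l.length (θ.symm v) := by
  induction l with
  | nil => rfl
  | cons e l ih =>
    have h1 := ih h.2
    have h2 : θ e = v := by
      rw [← hθ.s_eq, h.1, h1, hθ.rangeOf_replicate]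
    rw [List.length_cons, List.replicate_succ, ← h1, ← h2, θ.symm_apply_apply]

theorem exists_eq_loopPath (hθ : IsLoopQuiver θ) (α : G.toDirGraph.Path) :
    ∃ n, α = hθ.loopPath α.source n := by
  obtain ⟨l, v, h⟩ := α
  exact ⟨l.length, by simp only [loopPath, ← hθ.eq_replicate l v h]⟩

/-- The isometry of `ℓ²(ℕ)` onto the subspace of `ℓ²(G*)` spanned by the paths at `ω`. -/
noncomputable def loopIsometry (hθ : IsLoopQuiver θ) (ω : G.V) : EllTwo ℕ →L[ℂ] G.Hilb :=
  (pushIsometry (hθ.loopPath ω) (hθ.loopPath_injective ω)).toContinuousLinearMap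

@[simp]
theorem loopIsometry_basisVec (hθ : IsLoopQuiver θ) (ω : G.V) (n : ℕ) :
    hθ.loopIsometry ω (basisVec n) = basisVec (hθ.loopPath ω n) :=
  pushIsometry_basisVec _ (hθ.loopPath_injective ω) n

theorem adjoint_loopIsometry_basisVec (hθ : IsLoopQuiver θ) (ω : G.V) (n : ℕ) :
    ContinuousLinearMap.adjoint (hθ.loopIsometry ω) (basisVec (hθ.loopPath ω n)) = basisVec n :=
  adjoint_pushIsometry_basisVec _ (hθ.loopPath_injective ω) n

theorem adjoint_loopIsometry_basisVec_of_ne (hθ : IsLoopQuiver θ) {ω : G.V}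
    {α : G.toDirGraph.Path} (h : α.source ≠ ω) :
    ContinuousLinearMap.adjoint (hθ.loopIsometry ω) (basisVec α) = 0 :=
  adjoint_pushIsometry_basisVec_of_ne _ (hθ.loopPath_injective ω) α fun _ he => h (congrArg DirGraph.Path.source he).symm

theorem adjoint_loopIsometry_comp (hθ : IsLoopQuiver θ) (ω : G.V) :
    ContinuousLinearMap.adjoint (hθ.loopIsometry ω) ∘L hθ.loopIsometry ω =
      ContinuousLinearMap.id ℂ (EllTwo ℕ) :=
  adjoint_pushIsometry_comp _ (hθ.loopPath_injective ω)

theorem op_ext (hθ : IsLoopQuiver θ) {H : Type v} [NormedAddCommGroup H] [NormedSpace ℂ H]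
    {S T : G.Hilb →L[ℂ] H} (h : ∀ ω, S ∘L hθ.loopIsometry ω = T ∘L hθ.loopIsometry ω) :
    S = T := by
  refine EllTwo.op_ext fun α => ?_
  obtain ⟨n, hn⟩ := hθ.exists_eq_loopPath α
  rw [hn, ← loopIsometry_basisVec]
  exact congrArg (fun R => R (basisVec n)) (h α.source)

theorem adjoint_loopIsometry_comp_of_ne (hθ : IsLoopQuiver θ) {ω ω' : G.V} (h : ω' ≠ ω) :
    ContinuousLinearMap.adjoint (hθ.loopIsometry ω) ∘L hθ.loopIsometry ω' = 0 :=
  EllTwo.op_ext fun n => by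
    rw [ContinuousLinearMap.comp_apply, loopIsometry_basisVec]
    exact hθ.adjoint_loopIsometry_basisVec_of_ne h

theorem projOp_fibre (hθ : IsLoopQuiver θ) (ω : G.V) :
    projOp (G.fibre id ω) =
      hθ.loopIsometry ω ∘L ContinuousLinearMap.adjoint (hθ.loopIsometry ω) := by
  classical
  refine EllTwo.op_ext fun α => ?_
  rw [projOp_basisVec, ContinuousLinearMap.comp_apply]
  split_ifs with h
  · obtain ⟨n, hn⟩ := hθ.exists_eq_loopPath α
    have h' : α.source = ω := h
    rw [h'] at hn
    rw [hn, adjoint_loopIsometry_basisVec, loopIsometry_basisVec]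
  · rw [hθ.adjoint_loopIsometry_basisVec_of_ne h, map_zero]

/-- The operator `x` is the direct sum, over the vertices `ω`, of the copies of the Toeplitz
operators `f ω` on the subspaces spanned by the paths at `ω`. -/
def Decomposes (hθ : IsLoopQuiver θ) (x : BddOp G.Hilb) (f : C₀(G.V, ToeplitzAlg)) : Prop :=
  ∀ ω, x ∘L hθ.loopIsometry ω = hθ.loopIsometry ω ∘L toeplitzIncl (f ω)

/-- The subspaces spanned by the paths at different vertices are orthogonal and span `ℓ²(G*)`, so
that they reduce `x`. -/
theorem Decomposes.adjoint_comp {hθ : IsLoopQuiver θ} {x : BddOp G.Hilb}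
    {f : C₀(G.V, ToeplitzAlg)} (h : hθ.Decomposes x f) (ω : G.V) :
    ContinuousLinearMap.adjoint (hθ.loopIsometry ω) ∘L x =
      toeplitzIncl (f ω) ∘L ContinuousLinearMap.adjoint (hθ.loopIsometry ω) := by
  refine hθ.op_ext fun ω' => ?_
  rw [ContinuousLinearMap.comp_assoc, h ω', ContinuousLinearMap.comp_assoc,
    ← ContinuousLinearMap.comp_assoc]
  by_cases hω : ω' = ω
  · subst hω
    rw [adjoint_loopIsometry_comp, ContinuousLinearMap.id_comp, ContinuousLinearMap.comp_id]
  · rw [hθ.adjoint_loopIsometry_comp_of_ne hω, ContinuousLinearMap.zero_comp,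
      ContinuousLinearMap.comp_zero]

namespace Decomposes

variable {hθ : IsLoopQuiver θ} {x y : BddOp G.Hilb} {f g : C₀(G.V, ToeplitzAlg)}

theorem add (hf : hθ.Decomposes x f) (hg : hθ.Decomposes y g) :
    hθ.Decomposes (x + y) (f + g) := fun ω => by
  change _ = _ ∘L toeplitzIncl (f ω + g ω)
  rw [map_add, ContinuousLinearMap.add_comp, ContinuousLinearMap.comp_add, hf ω, hg ω]

theorem zero : hθ.Decomposes 0 0 := fun ω => by
  change _ = _ ∘L toeplitzIncl 0
  rw [map_zero, ContinuousLinearMap.zero_comp, ContinuousLinearMap.comp_zero]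

theorem mul (hf : hθ.Decomposes x f) (hg : hθ.Decomposes y g) :
    hθ.Decomposes (x * y) (f * g) := fun ω => by
  change (x ∘L y) ∘L _ = _ ∘L toeplitzIncl (f ω * g ω)
  rw [map_mul, ContinuousLinearMap.comp_assoc, hg ω, ← ContinuousLinearMap.comp_assoc, hf ω]
  rfl

theorem smul (c : ℂ) (hf : hθ.Decomposes x f) : hθ.Decomposes (c • x) (c • f) := fun ω => by
  change _ = _ ∘L toeplitzIncl (c • f ω)
  rw [map_smul, ContinuousLinearMap.smul_comp, ContinuousLinearMap.comp_smul, hf ω]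

theorem star (hf : hθ.Decomposes x f) : hθ.Decomposes (star x) (star f) := fun ω => by
  change ContinuousLinearMap.adjoint x ∘L _ = _ ∘L toeplitzIncl (Star.star (f ω))
  rw [map_star]
  have h := congrArg ContinuousLinearMap.adjoint (hf.adjoint_comp ω)
  rwa [ContinuousLinearMap.adjoint_comp, ContinuousLinearMap.adjoint_comp,
    ContinuousLinearMap.adjoint_adjoint] at h

end Decomposes

/-- The decomposable operators together with their components. -/
noncomputable def decomposable (hθ : IsLoopQuiver θ) :
    NonUnitalStarSubalgebra ℂ (BddOp G.Hilb × C₀(G.V, ToeplitzAlg)) where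
  carrier := {p | hθ.Decomposes p.1 p.2}
  add_mem' := Decomposes.add
  zero_mem' := Decomposes.zero
  mul_mem' := Decomposes.mul
  smul_mem' c _ := Decomposes.smul c
  star_mem' := Decomposes.star

theorem isClosed_decomposable (hθ : IsLoopQuiver θ) :
    IsClosed (hθ.decomposable : Set (BddOp G.Hilb × C₀(G.V, ToeplitzAlg))) := by
  have : (hθ.decomposable : Set (BddOp G.Hilb × C₀(G.V, ToeplitzAlg))) =
      ⋂ ω, {p | p.1 ∘L hθ.loopIsometry ω = hθ.loopIsometry ω ∘L toeplitzIncl (p.2 ω)} := by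
    ext p
    rw [Set.mem_iInter]
    rfl
  rw [this]
  refine isClosed_iInter fun ω => isClosed_eq (continuous_fst.clm_comp continuous_const) ?_
  have he : Continuous fun f : C₀(G.V, ToeplitzAlg) => f ω :=
    (LipschitzWith.of_dist_le_mul (K := 1) fun f g => by
      rw [NNReal.coe_one, one_mul, dist_eq_norm, dist_eq_norm]
      exact ZeroAtInftyContinuousMap.norm_apply_le_norm (f - g) ω).continuous
  exact continuous_const.clm_comp
    (isometry_toeplitzIncl.continuous.comp (he.comp continuous_snd))

theorem Decomposes.unique_right {hθ : IsLoopQuiver θ} {x : BddOp G.Hilb}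
    {f g : C₀(G.V, ToeplitzAlg)} (hf : hθ.Decomposes x f) (hg : hθ.Decomposes x g) : f = g := by
  ext ω
  refine isometry_toeplitzIncl.injective (ContinuousLinearMap.ext fun v => ?_)
  refine (pushIsometry (hθ.loopPath ω) (hθ.loopPath_injective ω)).injective ?_
  exact congrArg (fun T => T v) ((hf ω).symm.trans (hg ω))

theorem Decomposes.unique_left {hθ : IsLoopQuiver θ} {x y : BddOp G.Hilb}
    {f : C₀(G.V, ToeplitzAlg)} (hx : hθ.Decomposes x f) (hy : hθ.Decomposes y f) : x = y :=
  hθ.op_ext fun ω => (hx ω).trans (hy ω).symm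

/-- An operator has the same norm as its components, as both coordinates are injective
`*`-homomorphisms on the `C*`-algebra of decomposable operators. -/
theorem Decomposes.norm_eq {hθ : IsLoopQuiver θ} {x : BddOp G.Hilb} {f : C₀(G.V, ToeplitzAlg)}
    (h : hθ.Decomposes x f) : ‖x‖ = ‖f‖ := by
  have := hθ.isClosed_decomposable
  let φ : hθ.decomposable →⋆ₙₐ[ℂ] BddOp G.Hilb :=
    (NonUnitalStarAlgHom.fst ℂ _ _).comp (NonUnitalStarSubalgebraClass.subtype hθ.decomposable)
  let ψ : hθ.decomposable →⋆ₙₐ[ℂ] C₀(G.V, ToeplitzAlg) :=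
    (NonUnitalStarAlgHom.snd ℂ _ _).comp (NonUnitalStarSubalgebraClass.subtype hθ.decomposable)
  have h1 := NonUnitalStarAlgHom.norm_map φ (fun p q hpq => Subtype.ext (Prod.ext hpq
    (Decomposes.unique_right p.2 (by rw [show p.1.1 = q.1.1 from hpq]; exact q.2)))) ⟨(x, f), h⟩
  have h2 := NonUnitalStarAlgHom.norm_map ψ (fun p q hpq => Subtype.ext (Prod.ext
    (Decomposes.unique_left p.2 (by rw [show p.1.2 = q.1.2 from hpq]; exact q.2)) hpq)) ⟨(x, f), h⟩
  exact h1.trans h2.symm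

theorem decomposes_rho (hθ : IsLoopQuiver θ) (a : C₀(G.V, ℂ)) :
    hθ.Decomposes (G.rho a) (elemTensor a 1) := fun ω => EllTwo.op_ext fun n => by
  rw [ContinuousLinearMap.comp_apply, loopIsometry_basisVec, hθ.represented.1 a,
    range_loopPath, ContinuousLinearMap.comp_apply, elemTensor_apply, map_smul, map_one]
  exact ((map_smul (hθ.loopIsometry ω) (a ω) (basisVec n)).trans
    (by rw [loopIsometry_basisVec])).symm

/-- The function `ξ ∘ θ⁻¹` on the vertices. -/
noncomputable def coeff (θ : G.Edge ≃ₜ G.V) (ξ : C_c(G.Edge, ℂ)) : C₀(G.V, ℂ) where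
  toFun := ξ ∘ θ.symm
  continuous_toFun := ξ.continuous.comp θ.symm.continuous
  zero_at_infty' := (ξ.hasCompactSupport.comp_homeomorph θ.symm).is_zero_at_infty

theorem decomposes_psi (hθ : IsLoopQuiver θ) (ξ : C_c(G.Edge, ℂ)) :
    hθ.Decomposes (G.psi ξ) (elemTensor (coeff θ ξ) shiftT) := fun ω => EllTwo.op_ext fun n => by
  have h := hθ.represented.2 ξ (hθ.loopPath ω n)
  have hs : G.s (θ.symm ω) = (hθ.loopPath ω n).range := by
    rw [hθ.s_eq, θ.apply_symm_apply, range_loopPath]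
  have h' := h.unique (hasSum_single ⟨θ.symm ω, hs⟩ fun β hβ => by
    refine absurd (Subtype.ext (θ.eq_symm_apply.2 ?_)) hβ
    exact (hθ.s_eq _).symm.trans (β.2.trans (hθ.range_loopPath ω n)))
  rw [ContinuousLinearMap.comp_apply, loopIsometry_basisVec, h', ContinuousLinearMap.comp_apply,
    elemTensor_apply, map_smul, toeplitzIncl_shiftT]
  refine ((map_smul (hθ.loopIsometry ω) _ _).trans ?_).symm
  refine (congrArg (fun v => coeff θ ξ ω • hθ.loopIsometry ω v)
    (unilateralShift_basisVec n)).trans ?_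
  rw [loopIsometry_basisVec]
  rfl

theorem isClosed_setOf_decomposes_left (hθ : IsLoopQuiver θ) {s : Set C₀(G.V, ToeplitzAlg)}
    (hs : IsClosed s) : IsClosed {x | ∃ f ∈ s, hθ.Decomposes x f} := by
  have := isClosed_image_of_dist_eq (f := Prod.fst)
    (hθ.isClosed_decomposable.inter (hs.preimage continuous_snd)) (fun p hp q hq => by
      have h : hθ.Decomposes _ _ := sub_mem hp.1 hq.1
      rw [dist_eq_norm, Prod.dist_eq, dist_eq_norm, dist_eq_norm]
      exact (max_eq_left h.norm_eq.ge).symm)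
  refine Eq.subst (Set.ext fun x => ?_) this
  constructor
  · rintro ⟨⟨x, f⟩, ⟨h, hf⟩, rfl⟩
    exact ⟨f, hf, h⟩
  · rintro ⟨f, hf, h⟩
    exact ⟨(x, f), ⟨h, hf⟩, rfl⟩

theorem isClosed_setOf_decomposes_right (hθ : IsLoopQuiver θ) {s : Set (BddOp G.Hilb)}
    (hs : IsClosed s) : IsClosed {f | ∃ x ∈ s, hθ.Decomposes x f} := by
  have := isClosed_image_of_dist_eq (f := Prod.snd)
    (hθ.isClosed_decomposable.inter (hs.preimage continuous_fst)) (fun p hp q hq => by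
      have h : hθ.Decomposes _ _ := sub_mem hp.1 hq.1
      rw [dist_eq_norm, Prod.dist_eq, dist_eq_norm, dist_eq_norm]
      exact (max_eq_right h.norm_eq.le).symm)
  refine Eq.subst (Set.ext fun f => ?_) this
  constructor
  · rintro ⟨⟨x, f⟩, ⟨h, hx⟩, rfl⟩
    exact ⟨x, hx, h⟩
  · rintro ⟨x, hx, h⟩
    exact ⟨(x, f), ⟨h, hx⟩, rfl⟩

theorem exists_decomposes_of_mem_toeplitz (hθ : IsLoopQuiver θ) {x : BddOp G.Hilb}
    (hx : x ∈ G.Toeplitz) : ∃ f ∈ C0Tensor G.V ToeplitzAlg, hθ.Decomposes x f := by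
  refine closure_minimal (fun x hx => ?_)
    (hθ.isClosed_setOf_decomposes_left isClosed_C0Tensor) hx
  rw [SetLike.mem_coe] at hx
  induction hx using NonUnitalStarAlgebra.adjoin_induction with
  | mem x hx =>
    obtain ⟨a, rfl⟩ | ⟨ξ, rfl⟩ := hx
    · exact ⟨_, elemTensor_mem _ _, hθ.decomposes_rho a⟩
    · exact ⟨_, elemTensor_mem _ _, hθ.decomposes_psi ξ⟩
  | add x y _ _ hx hy =>
    obtain ⟨⟨f, hf, h⟩, ⟨g, hg, h'⟩⟩ := hx, hy
    exact ⟨f + g, add_mem hf hg, h.add h'⟩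
  | zero => exact ⟨0, zero_mem _, Decomposes.zero⟩
  | smul c x _ hx =>
    obtain ⟨f, hf, h⟩ := hx
    exact ⟨c • f, SMulMemClass.smul_mem c hf, h.smul c⟩
  | mul x y _ _ hx hy =>
    obtain ⟨⟨f, hf, h⟩, ⟨g, hg, h'⟩⟩ := hx, hy
    exact ⟨f * g, mul_mem hf hg, h.mul h'⟩
  | star x _ hx =>
    obtain ⟨f, hf, h⟩ := hx
    exact ⟨star f, star_mem hf, h.star⟩

/-- The components of elements of the Toeplitz algebra of `G`. -/
def components (hθ : IsLoopQuiver θ) : NonUnitalStarSubalgebra ℂ C₀(G.V, ToeplitzAlg) where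
  carrier := {f | ∃ x ∈ G.Toeplitz, hθ.Decomposes x f}
  add_mem' := by
    rintro f g ⟨x, hx, h⟩ ⟨y, hy, h'⟩
    exact ⟨x + y, add_mem hx hy, h.add h'⟩
  zero_mem' := ⟨0, zero_mem _, Decomposes.zero⟩
  mul_mem' := by
    rintro f g ⟨x, hx, h⟩ ⟨y, hy, h'⟩
    exact ⟨x * y, mul_mem hx hy, h.mul h'⟩
  smul_mem' := by
    rintro c f ⟨x, hx, h⟩
    exact ⟨c • x, SMulMemClass.smul_mem c hx, h.smul c⟩
  star_mem' := by
    rintro f ⟨x, hx, h⟩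
    exact ⟨star x, star_mem hx, h.star⟩

theorem isClosed_components (hθ : IsLoopQuiver θ) :
    IsClosed (hθ.components : Set C₀(G.V, ToeplitzAlg)) :=
  hθ.isClosed_setOf_decomposes_right (NonUnitalStarSubalgebra.isClosed_topologicalClosure _)

/-- Multiplication of a component by `1 ⊗ b` is the limit of multiplications by `χ ⊗ b` with
cut-off functions `χ`. -/
theorem elemTensor_mul_mem_components (hθ : IsLoopQuiver θ) {b : ToeplitzAlg}
    (hb : ∀ χ : C(G.V, ℂ), HasCompactSupport χ → (∀ x, star (χ x) = χ x) →
      ∃ f ∈ hθ.components, ∀ x, f x = χ x • b) (a : C₀(G.V, ℂ)) {c : ToeplitzAlg}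
    (hc : elemTensor a c ∈ hθ.components) : elemTensor a (b * c) ∈ hθ.components := by
  refine hθ.isClosed_components.closure_subset (Metric.mem_closure_iff.2 fun ε hε => ?_)
  obtain ⟨χ, h1, h2, h3⟩ := exists_cutoff a (ε := ε / 2 / (‖b * c‖ + 1)) (by positivity)
  obtain ⟨f, hf, hf'⟩ := hb χ h1 h2
  refine ⟨f * elemTensor a c, mul_mem hf hc, ?_⟩
  rw [dist_eq_norm]
  refine (ZeroAtInftyContinuousMap.norm_le_of_forall (half_pos hε).le fun x => ?_).trans_lt (half_lt_self hε)
  have e : (elemTensor a (b * c) - f * elemTensor a c) x = (a x - χ x * a x) • (b * c) := by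
    change a x • (b * c) - f x * (a x • c) = _
    rw [hf', smul_mul_smul_comm, sub_smul]
  rw [e, norm_smul]
  refine (mul_le_mul (h3 x) (le_add_of_nonneg_right zero_le_one) (norm_nonneg _)
    (by positivity)).trans_eq ?_
  field_simp

/-- Every elementary tensor is the component function of an element of the Toeplitz algebra of `G`.
The set of all admissible `b` contains `1`, on account of the operators `ρ(a)`, and it is closed
under multiplication by `S` and `S*`, on account of the operators `ψ(ξ)`. -/
theorem elemTensor_mem_components (hθ : IsLoopQuiver θ) (a : C₀(G.V, ℂ)) (b : ToeplitzAlg) :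
    elemTensor a b ∈ hθ.components := by
  have key : ∀ χ : C(G.V, ℂ), HasCompactSupport χ → ∃ ξ : C_c(G.Edge, ℂ),
      ∀ x, coeff θ ξ x = χ x := fun χ hχ =>
    ⟨{ toFun := χ ∘ θ
       continuous_toFun := χ.continuous.comp θ.continuous
       hasCompactSupport' := hχ.comp_homeomorph θ }, fun x => congrArg χ (θ.apply_symm_apply x)⟩
  have hS : ∀ ξ, elemTensor (coeff θ ξ) shiftT ∈ hθ.components :=
    fun ξ => ⟨_, (G.psiT ξ).2, hθ.decomposes_psi ξ⟩
  induction b using ToeplitzAlg.induction with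
  | closed =>
    refine hθ.isClosed_components.preimage (f := fun b => elemTensor a b) ?_
    refine (LipschitzWith.of_dist_le_mul (K := ‖a‖₊) fun b c => ?_).continuous
    have e : elemTensor a b - elemTensor a c = elemTensor a (b - c) := by
      ext x
      exact (smul_sub (a x) b c).symm
    rw [dist_eq_norm, dist_eq_norm, e]
    exact norm_elemTensor_le a (b - c)
  | one => exact ⟨_, (G.rhoT a).2, hθ.decomposes_rho a⟩
  | add b c hb hc =>
    have e : elemTensor a (b + c) = elemTensor a b + elemTensor a c := by
      ext x
      exact smul_add (a x) b c
    rw [e]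
    exact add_mem hb hc
  | smul z b hb =>
    have e : elemTensor a (z • b) = z • elemTensor a b := by
      ext x
      exact smul_comm (a x) z b
    rw [e]
    exact SMulMemClass.smul_mem z hb
  | mul_left b hb =>
    refine hθ.elemTensor_mul_mem_components (fun χ hχ _ => ?_) a hb
    obtain ⟨ξ, hξ⟩ := key χ hχ
    exact ⟨_, hS ξ, fun x => by rw [elemTensor_apply, hξ]⟩
  | star_mul_left b hb =>
    refine hθ.elemTensor_mul_mem_components (fun χ hχ hχ' => ?_) a hb
    obtain ⟨ξ, hξ⟩ := key χ hχ
    refine ⟨_, star_mem (hS ξ), fun x => ?_⟩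
    change star (coeff θ ξ x • shiftT) = _
    rw [star_smul, hξ, hχ']

theorem exists_toeplitz_of_mem_C0Tensor (hθ : IsLoopQuiver θ) {f : C₀(G.V, ToeplitzAlg)}
    (hf : f ∈ C0Tensor G.V ToeplitzAlg) : ∃ x ∈ G.Toeplitz, hθ.Decomposes x f := by
  refine NonUnitalStarSubalgebra.topologicalClosure_minimal (t := hθ.components) _
    (NonUnitalStarAlgebra.adjoin_le ?_) hθ.isClosed_components hf
  rintro _ ⟨a, b, rfl⟩
  exact hθ.elemTensor_mem_components a b

set_option synthInstance.maxHeartbeats 200000 in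
/-- The passage from an operator to its components is an isomorphism. -/
theorem exists_tensorEquiv (hθ : IsLoopQuiver θ) : ∃ Φ : G.ToeplitzTensorEquiv ToeplitzAlg,
    ∀ x, hθ.Decomposes x.1 (Φ x).1 := by
  choose F hF hF' using fun x : G.Toeplitz => hθ.exists_decomposes_of_mem_toeplitz x.2
  choose K hK hK' using fun f : C0Tensor G.V ToeplitzAlg => hθ.exists_toeplitz_of_mem_C0Tensor f.2
  refine ⟨{ toFun := fun x => ⟨F x, hF x⟩
            invFun := fun f => ⟨K f, hK f⟩
            left_inv := fun x => Subtype.ext ((hK' ⟨F x, hF x⟩).unique_left (hF' x))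
            right_inv := fun f => Subtype.ext ((hF' ⟨K f, hK f⟩).unique_right (hK' f))
            map_mul' := fun x y => Subtype.ext ((hF' (x * y)).unique_right ((hF' x).mul (hF' y)))
            map_add' := fun x y => Subtype.ext ((hF' (x + y)).unique_right ((hF' x).add (hF' y)))
            map_star' := fun x => Subtype.ext ((hF' (star x)).unique_right (hF' x).star)
            map_smul' := fun c x => Subtype.ext ((hF' (c • x)).unique_right ((hF' x).smul c)) }, hF'⟩

/-- The part of `x` on the paths with source `ω` is compact if and only if the Toeplitz operator
`f ω` is, that is, if and only if its symbol vanishes. -/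
theorem Decomposes.isCompactOperator_restrictOp_iff {hθ : IsLoopQuiver θ} {x : BddOp G.Hilb}
    {f : C₀(G.V, ToeplitzAlg)} (h : hθ.Decomposes x f) (ω : G.V) :
    IsCompactOperator (restrictOp (G.fibre id ω) x) ↔ symbolHom (f ω) = 0 := by
  have e : projOp (G.fibre id ω) * x * projOp (G.fibre id ω) = hθ.loopIsometry ω ∘L
      toeplitzIncl (f ω) ∘L ContinuousLinearMap.adjoint (hθ.loopIsometry ω) := by
    rw [hθ.projOp_fibre]
    change (_ ∘L x) ∘L _ = _
    rw [ContinuousLinearMap.comp_assoc, ContinuousLinearMap.comp_assoc,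
      ← ContinuousLinearMap.comp_assoc x, h ω, ContinuousLinearMap.comp_assoc,
      ← ContinuousLinearMap.comp_assoc (ContinuousLinearMap.adjoint _), adjoint_loopIsometry_comp,
      ContinuousLinearMap.id_comp]
  rw [_root_.isCompactOperator_restrictOp_iff, e, ← isCompactOperator_toeplitzIncl_iff]
  constructor
  · intro hc
    have e' : toeplitzIncl (f ω) = ContinuousLinearMap.adjoint (hθ.loopIsometry ω) ∘L
        (hθ.loopIsometry ω ∘L toeplitzIncl (f ω) ∘L
          ContinuousLinearMap.adjoint (hθ.loopIsometry ω)) ∘L hθ.loopIsometry ω := by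
      rw [ContinuousLinearMap.comp_assoc, ContinuousLinearMap.comp_assoc,
        adjoint_loopIsometry_comp, ContinuousLinearMap.comp_id, ← ContinuousLinearMap.comp_assoc,
        adjoint_loopIsometry_comp, ContinuousLinearMap.id_comp]
    rw [e']
    exact (hc.comp_clm (hθ.loopIsometry ω)).clm_comp
      (ContinuousLinearMap.adjoint (hθ.loopIsometry ω))
  · intro hc
    exact (hc.comp_clm (ContinuousLinearMap.adjoint (hθ.loopIsometry ω))).clm_comp
      (hθ.loopIsometry ω)

end IsLoopQuiver

end TopQuiver

end

/-! ### The fractional power with parameter `0` -/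

namespace TopQuiver.IsLoopQuiver

variable {G : TopQuiver.{u}} {θ : G.Edge ≃ₜ G.V}

set_option synthInstance.maxHeartbeats 200000 in
/-- The isomorphism descends because an element of the Toeplitz algebra of `G` is compact on the
paths at every vertex if and only if the symbols of all its components vanish. -/
theorem exists_descendsTo (hθ : IsLoopQuiver θ) : ∃ Φ : G.ToeplitzTensorEquiv ToeplitzAlg,
    Φ.Carries θ ∧ ∃ Φ' : G.CuntzKriegerTensorEquiv C(Circle, ℂ), Φ.DescendsTo symbolHom Φ' := by
  obtain ⟨Φ, hΦ⟩ := hθ.exists_tensorEquiv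
  refine ⟨Φ, ⟨fun a => (hΦ _).unique_right (hθ.decomposes_rho a), fun ξ ω => ?_⟩, ?_⟩
  · rw [(hΦ (G.psiT ξ)).unique_right (hθ.decomposes_psi ξ)]
    rfl
  · obtain ⟨Φ', h⟩ := exists_starAlgEquiv_of_ker_eq (G.quotMap id)
      (tensorSymbol.comp
        { toFun := Φ
          map_smul' := map_smul Φ
          map_zero' := map_zero Φ
          map_add' := map_add Φ
          map_mul' := map_mul Φ
          map_star' := map_star Φ }) (quotMap_surjective id)
      (tensorSymbol_surjective.comp Φ.surjective) fun x => by
        rw [quotMap_eq_zero_iff]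
        refine (forall_congr' fun ω => (hΦ x).isCompactOperator_restrictOp_iff ω).trans ?_
        rw [Subtype.ext_iff, ZeroAtInftyContinuousMap.ext_iff]
        rfl
    exact ⟨Φ', fun x ω => by rw [h]; rfl⟩

end TopQuiver.IsLoopQuiver

namespace DirGraph

variable {E : DirGraph.{u}}

/-- For the parameter `0` the two admissibility conditions on `(μ, t)` agree. -/
noncomputable def dropPre : E.FracEdgePre 0 ≃ₜ E.FracVPre where
  toFun x := ⟨x.1, x.2.1, x.2.2.1⟩
  invFun x := ⟨x.1, x.2.1, x.2.2, by rw [add_zero]; exact x.2.2⟩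
  left_inv _ := rfl
  right_inv _ := rfl
  continuous_toFun := continuous_sigma fun μ =>
    (continuous_sigmaMk (σ := fun μ : E.Path => {t : ℝ // 0 ≤ t ∧ t ≤ μ.length}) (i := μ)).comp
      (continuous_induced_rng.2 continuous_subtype_val)
  continuous_invFun := continuous_sigma fun μ =>
    (continuous_sigmaMk (σ := fun μ : E.Path => {t : ℝ // (0 ≤ t ∧ t ≤ μ.length) ∧
      0 ≤ t + 0 ∧ t + 0 ≤ μ.length}) (i := μ)).comp
      (continuous_induced_rng.2 continuous_subtype_val)

theorem fracEdgeSetoid_zero_iff (x y : E.FracEdgePre 0) :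
    E.fracEdgeSetoid 0 x y ↔ E.fracVSetoid (dropPre x) (dropPre y) := by
  change (_, if (0 : ℝ) ≤ 0 then _ else _) = (_, if (0 : ℝ) ≤ 0 then _ else _) ↔ _
  rw [if_pos le_rfl, if_pos le_rfl, add_zero, add_zero]
  rfl

variable (E) in
/-- The range map of the quiver with parameter `0`. -/
noncomputable def fractionalZeroHomeomorph : (E.fractional 0).Edge ≃ₜ (E.fractional 0).V :=
  Homeomorph.Quotient.congr dropPre fracEdgeSetoid_zero_iff

theorem isLoopQuiver_fractional_zero :
    TopQuiver.IsLoopQuiver (E.fractionalZeroHomeomorph) where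
  r_eq := by
    rintro ⟨x⟩
    rfl
  s_eq := by
    rintro ⟨x⟩
    change FracV.mk x.1 (x.2.1 + 0) _ = FracV.mk x.1 x.2.1 _
    congr 1
    exact add_zero _

end DirGraph

theorem mainTheorem9 (E : DirGraph.{u}) [Countable E.V] [Countable E.Edge]
    (hfin : E.LocallyFinite) (hsrc : E.NoSources) :
    -- the operators generating the algebras exist
    (E.suspension.Represented ∧ E.op.suspension.Represented ∧
      (E.fractional 1).Represented ∧ (E.fractional 0).Represented ∧
      (E.fractional (-1)).Represented) ∧
    -- parameter `1`
    (∃ θ : TopQuiver.Iso (E.fractional 1) E.suspension,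
      (∀ (e : E.Edge) (t : unitInterval) h,
        θ.onV (DirGraph.FracV.mk (DirGraph.Path.single e) t h) = DirGraph.SuspV.mk e t) ∧
      (∀ (e f : E.Edge) (hef : E.s e = E.r f) (t : unitInterval) h,
        θ.onEdge (DirGraph.FracEdge.mk (DirGraph.Path.pair e f hef) t h) =
          DirGraph.SuspEdge.mk e f hef t) ∧
      ∃ Φ : TopQuiver.ToeplitzEquiv (E.fractional 1) E.suspension,
        Φ.Carries θ ∧
        Φ.Descends id id ∧
        Φ.Descends DirGraph.FracV.toCircle DirGraph.SuspV.toCircle ∧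
        (Finite E.V → Φ.Descends id DirGraph.SuspV.toCircle)) ∧
    -- parameter `0`
    (∃ θ : (E.fractional 0).Edge ≃ₜ (E.fractional 0).V,
      (∀ x, θ x = (E.fractional 0).r x) ∧
      ∃ Φ : (E.fractional 0).ToeplitzTensorEquiv ToeplitzAlg,
        Φ.Carries θ ∧
        ∃ τ : ToeplitzAlg →⋆ₐ[ℂ] C(Circle, ℂ), τ shiftT = circleCoord ∧
          ∃ Φ' : (E.fractional 0).CuntzKriegerTensorEquiv C(Circle, ℂ), Φ.DescendsTo τ Φ') ∧
    -- parameter `-1`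
    (∃ θ : TopQuiver.Iso (E.fractional (-1)) E.op.suspension,
      (∀ (e : E.Edge) (t : unitInterval) h,
        θ.onV (DirGraph.FracV.mk (DirGraph.Path.single e) t h) =
          DirGraph.SuspV.mk (E := E.op) e (unitInterval.symm t)) ∧
      (∀ (e f : E.Edge) (hef : E.s e = E.r f) (t : unitInterval) h,
        θ.onEdge (DirGraph.FracEdge.mk (DirGraph.Path.pair e f hef) (1 + t) h) =
          DirGraph.SuspEdge.mk (E := E.op) f e hef.symm (unitInterval.symm t)) ∧
      ∃ Φ : TopQuiver.ToeplitzEquiv (E.fractional (-1)) E.op.suspension,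
        Φ.Carries θ ∧
        Φ.Descends id id ∧
        Φ.Descends DirGraph.FracV.toCircle DirGraph.SuspV.toCircle ∧
        (Finite E.V → Φ.Descends id DirGraph.SuspV.toCircle)) := by
  obtain ⟨h1, H1⟩ := hfin.fractional_one
  obtain ⟨h2, H2⟩ := hfin.fractional_neg_one
  have h0 := DirGraph.isLoopQuiver_fractional_zero (E := E)
  obtain ⟨Φ, hΦ, Φ', hΦ'⟩ := h0.exists_descendsTo
  exact ⟨⟨hfin.represented_suspension, hfin.op.represented_suspension, h1, h0.represented, h2⟩,
    H1, ⟨E.fractionalZeroHomeomorph, h0.r_eq, Φ, hΦ, symbolHom, symbolHom_shiftT, Φ', hΦ'⟩, H2⟩
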